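/- Let $M$ be a connected smooth manifold (finite-dimensional, Hausdorff, second countable, without boundary) with a smooth foliation $\mathcal F$ of codimension $2n$, let $P\subseteq TM$ be its tangent distribution, and let $\omega$ be a transversely symplectic form: a smooth closed two-form on $M$ such that $\ker\omega_p=P_p$ for every $p\in M$. Let $s$ be an integer with $0\le s\le n-1$. Notation. $\Omega^k_{\rm bas}(M)$ is the space of basic $k$-forms, i.e. smooth $k$-forms $\alpha$ with $\iota_X\alpha=0$ and $\mathcal L_X\alpha=0$ for all smooth sections $X$ of $P$; $H^k_B(M,\mathbb R)$ is the cohomology of the complex $(\Omega^*_{\rm bas}(M),d)$. The form $\omega$ induces a symplectic form $\sigma_x$ on each normal space $Q_x=T_xM/P_x$. The symplectic Hodge star $\star:\Lambda^kQ_x^*\to\Lambda^{2n-k}Q_x^*$ is determined by $\beta\wedge\star\alpha=B(\beta,\alpha)\,\sigma_x^n/n!$ for all $\beta\in\Lambda^kQ_x^*$, where $B(\beta,\alpha)=\langle\sharp\beta,\alpha\rangle$ and $\sharp:\Lambda^kQ_x^*\to\Lambda^kQ_x$ extends the inverse of $X\mapsto\iota_X\sigma_x$. Identifying forms on $M$ annihilated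 by contraction with $P$ with sections of $\Lambda^*Q^*$, one obtains $\star$ on basic forms, and $\delta\alpha=(-1)^{k+1}\star d\star\alpha$ for $\alpha\in\Omega^k_{\rm bas}(M)$. Below, $\operatorname{Im}d$, $\operatorname{Im}\delta$, $\operatorname{Im}d\delta$, $\ker d$, $\ker\delta$ refer to these operators acting on basic forms (forms of negative degree and basic forms of degree $>2n$ are zero). Then the following statements are equivalent: 1. (Transverse $s$-Lefschetz property.) For every $0\le k\le s$ the map $H^k_B(M,\mathbb R)\to H^{2n-k}_B(M,\mathbb R)$, $[\alpha]\mapsto[\omega^{n-k}\wedge\alpha]$, is an isomorphism. 2. (Symplectic $d\delta$-lemma up to degree $s$.) $\operatorname{Im}d\cap\ker\delta=\operatorname{Im}d\delta=\operatorname{Im}\delta\cap\ker d$ on $\Omega^k_{\rm bas}(M)$ for all $k\le s$, and $\operatorname{Im}d\cap\ker\delta=\operatorname{Im}d\delta$ on $\Omega^{s+1}_{\rm bas}(M)$. 3. $\operatorname{Im}d\cap\ker\delta=\operatorname{Im}d\delta=\operatorname{Im}\delta\cap\ker d$ on $\Omega^k_{\rm bas}(M)$ for all $k\ge 2n-s$,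 and $\operatorname{Im}\delta\cap\ker d=\operatorname{Im}d\delta$ on $\Omega^{2n-s-1}_{\rm bas}(M)$. -/

import Mathlib

open scoped Manifold ContDiff

set_option linter.unusedSectionVars false

noncomputable section

namespace TransverseHodge

/-! ### Exterior algebra of a real vector space

A `k`-form on a real vector space `V` is an alternating map `V [⋀^Fin k]→ₗ[ℝ] ℝ`. -/

section LinearAlgebra

variable {V : Type*} [AddCommGroup V] [Module ℝ V]

/-- The exterior product of alternating forms, as a signed sum over `(k, l)`-shuffles, so that
`(θ ∧ η) (v, w) = θ v * η w - θ w * η v` for one-forms. -/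
def wedge {k l : ℕ} (a : V [⋀^Fin k]→ₗ[ℝ] ℝ) (b : V [⋀^Fin l]→ₗ[ℝ] ℝ) :
    V [⋀^Fin (k + l)]→ₗ[ℝ] ℝ :=
  ((LinearMap.mul' ℝ ℝ).compAlternatingMap (a.domCoprod b)).domDomCongr finSumFinEquiv

/-- `L^j a = a ∧ σ ∧ ⋯ ∧ σ` (`j` factors `σ`). -/
def lefschetz (σ : V [⋀^Fin 2]→ₗ[ℝ] ℝ) {k : ℕ} (a : V [⋀^Fin k]→ₗ[ℝ] ℝ) :
    (j : ℕ) → V [⋀^Fin (k + 2 * j)]→ₗ[ℝ] ℝ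
  | 0 => a
  | j + 1 => wedge (k := k + 2 * j) (l := 2) (lefschetz σ a j) σ

/-- The `j`-th exterior power `σ^j = σ ∧ ⋯ ∧ σ` of a two-form. -/
def wedgePow (σ : V [⋀^Fin 2]→ₗ[ℝ] ℝ) : (j : ℕ) → V [⋀^Fin (2 * j)]→ₗ[ℝ] ℝ
  | 0 => AlternatingMap.constOfIsEmpty ℝ V (Fin 0) 1
  | j + 1 => wedge (wedgePow σ j) σ

/-- The map `V → V*`, `X ↦ ι_X σ = σ (X, ·)`. -/
def flat (σ : V [⋀^Fin 2]→ₗ[ℝ] ℝ) : V →ₗ[ℝ] Module.Dual ℝ V where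
  toFun X := AlternatingMap.ofSubsingleton ℝ V ℝ (0 : Fin 1) |>.symm (σ.curryLeft X)
  map_add' X Y := by ext Z; simp
  map_smul' c X := by ext Z; simp

open Classical in
/-- The inverse `♯ : V* → V` of `X ↦ ι_X σ` (used only for nondegenerate `σ`; by convention `0`
if `X ↦ ι_X σ` is not bijective). -/
def sharp (σ : V [⋀^Fin 2]→ₗ[ℝ] ℝ) : Module.Dual ℝ V →ₗ[ℝ] V :=
  if h : Function.Bijective (flat σ) then (LinearEquiv.ofBijective (flat σ) h).symm else 0

/-- The `k`-form on `V` given by an element of `⋀^k V*`; on decomposable elements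
`(θ₁ ∧ ⋯ ∧ θ_k) (v₁, …, v_k) = det (θ_j (v_i))`. -/
def formOfExterior (k : ℕ) (b : ⋀[ℝ]^k (Module.Dual ℝ V)) : V [⋀^Fin k]→ₗ[ℝ] ℝ :=
  exteriorPower.alternatingMapLinearEquiv.symm (exteriorPower.pairingDual ℝ V k b)

/-- The pairing `B(b, a) = ⟨♯ b, a⟩`. Here `♯ b` is the `k`-vector obtained from `b ∈ ⋀^k V*` by
extending `♯ : V* → V` to exterior powers, and `⟨v₁ ∧ ⋯ ∧ v_k, a⟩ = a (v₁, …, v_k)` is the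
natural pairing of `k`-vectors with `k`-forms. -/
def symplecticPairing (σ : V [⋀^Fin 2]→ₗ[ℝ] ℝ) {k : ℕ} (b : ⋀[ℝ]^k (Module.Dual ℝ V))
    (a : V [⋀^Fin k]→ₗ[ℝ] ℝ) : ℝ :=
  exteriorPower.alternatingMapLinearEquiv a (exteriorPower.map k (sharp σ) b)

/-- The defining property of `c = ⋆ a` on a `2n`-dimensional symplectic vector space `(V, σ)`:
`b ∧ c = B(b, a) σ^n / n!` for all `b ∈ ⋀^k V*`. -/
def IsSymplecticStar (σ : V [⋀^Fin 2]→ₗ[ℝ] ℝ) (n : ℕ) {k l : ℕ} (h : k + l = 2 * n)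
    (a : V [⋀^Fin k]→ₗ[ℝ] ℝ) (c : V [⋀^Fin l]→ₗ[ℝ] ℝ) : Prop :=
  ∀ b : ⋀[ℝ]^k (Module.Dual ℝ V),
    (wedge (formOfExterior k b) c).domDomCongr (finCongr h) =
      (symplecticPairing σ b a / (n.factorial : ℝ)) • wedgePow σ n

open Classical in
/-- The symplectic Hodge star `⋆ : Λ^k V* → Λ^{2n-k} V*` of a `2n`-dimensional symplectic vector
space: the form uniquely determined by `IsSymplecticStar`. -/
def symplecticStar (σ : V [⋀^Fin 2]→ₗ[ℝ] ℝ) (n : ℕ) {k l : ℕ} (h : k + l = 2 * n)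
    (a : V [⋀^Fin k]→ₗ[ℝ] ℝ) : V [⋀^Fin l]→ₗ[ℝ] ℝ :=
  if hc : ∃ c : V [⋀^Fin l]→ₗ[ℝ] ℝ, IsSymplecticStar σ n h a c then hc.choose else 0

open Classical in
/-- The form on `V ⧸ P` whose pullback to `V` is the given form `a`. It exists (and is then unique)
precisely when `a` is annihilated by contraction with all vectors of `P`. -/
def descend (P : Submodule ℝ V) {k : ℕ} (a : V [⋀^Fin k]→ₗ[ℝ] ℝ) :
    (V ⧸ P) [⋀^Fin k]→ₗ[ℝ] ℝ :=
  if h : ∃ c : (V ⧸ P) [⋀^Fin k]→ₗ[ℝ] ℝ, c.compLinearMap P.mkQ = a then h.choose else 0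

end LinearAlgebra

/-! ### Alternating maps on a finite dimensional space are continuous -/

section Continuity

variable {E : Type*} [NormedAddCommGroup E] [NormedSpace ℝ E] [FiniteDimensional ℝ E]

theorem continuous_alternatingMap {k : ℕ} (a : E [⋀^Fin k]→ₗ[ℝ] ℝ) : Continuous a := by
  have h : (a : (Fin k → E) → ℝ) = fun v =>
      ∑ r : Fin k → Fin (Module.finrank ℝ E),
        (∏ i, (Module.finBasis ℝ E).coord (r i) (v i)) *
          a (fun i => Module.finBasis ℝ E (r i)) := by
    funext v
    have hv : v = fun i => ∑ j, (Module.finBasis ℝ E).coord j (v i) • Module.finBasis ℝ E j := by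
      funext i
      exact ((Module.finBasis ℝ E).sum_repr (v i)).symm
    conv_lhs => rw [hv]
    have h1 := a.toMultilinearMap.map_sum
      (fun (i : Fin k) (j : Fin (Module.finrank ℝ E)) =>
        (Module.finBasis ℝ E).coord j (v i) • Module.finBasis ℝ E j)
    refine h1.trans (Finset.sum_congr rfl fun r _ => ?_)
    exact a.toMultilinearMap.map_smul_univ _ _
  rw [h]
  refine continuous_finsetSum _ fun r _ => Continuous.mul (continuous_finsetProd _ fun i _ => ?_)
    continuous_const
  exact (LinearMap.continuous_of_finiteDimensional _).comp (continuous_apply i)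

/-- An alternating form on a finite dimensional space, as a continuous alternating form. -/
def toCont {k : ℕ} : (E [⋀^Fin k]→ₗ[ℝ] ℝ) →ₗ[ℝ] E [⋀^Fin k]→L[ℝ] ℝ where
  toFun a := { a with cont := continuous_alternatingMap a }
  map_add' _ _ := rfl
  map_smul' _ _ := rfl

end Continuity

/-! ### Differential forms on a manifold -/

section Manifold

variable {E : Type*} [NormedAddCommGroup E] [NormedSpace ℝ E] [FiniteDimensional ℝ E]
  {M : Type*} [TopologicalSpace M] [ChartedSpace E M]

variable (E M) in
/-- Families of `k`-forms on the tangent spaces of `M`, with no regularity required. -/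
abbrev DiffForm (k : ℕ) : Type _ := (x : M) → TangentSpace 𝓘(ℝ, E) x [⋀^Fin k]→ₗ[ℝ] ℝ

instance instAddCommGroupDiffForm (k : ℕ) : AddCommGroup (DiffForm E M k) :=
  inferInstance

/-- The pullback `(φ⁻¹)^* α` of a form on `M` by the inverse of a chart `φ`, a form on (an open
subset of) the model space `E`. -/
def localRep {k : ℕ} (φ : OpenPartialHomeomorph M E) (α : DiffForm E M k) (y : E) :
    E [⋀^Fin k]→L[ℝ] ℝ :=
  toCont ((α (φ.symm y)).compLinearMap
    ((mfderiv 𝓘(ℝ, E) 𝓘(ℝ, E) φ.symm y).toLinearMap ∘ₗ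
      (NormedSpace.fromTangentSpace y).symm.toLinearMap))

/-- A form is smooth if its expression in every chart of the atlas is smooth. -/
def IsSmoothForm {k : ℕ} (α : DiffForm E M k) : Prop :=
  ∀ φ ∈ atlas E M, ContDiffOn ℝ ∞ (localRep φ α) φ.target

/-- The exterior derivative, computed at `x` in the preferred chart `φ` at `x`:
`dα = φ^* d ((φ⁻¹)^* α)`. -/
def extD {k : ℕ} (α : DiffForm E M k) : DiffForm E M (k + 1) := fun x =>
  (extDeriv (localRep (chartAt E x) α) (chartAt E x x)).toAlternatingMap.compLinearMap
    ((NormedSpace.fromTangentSpace (chartAt E x x)).toLinearMap ∘ₗ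
      (mfderiv 𝓘(ℝ, E) 𝓘(ℝ, E) (chartAt E x) x).toLinearMap)

/-- The contraction `ι_X α` of a form with a vector field. -/
def contract {k : ℕ} (X : (x : M) → TangentSpace 𝓘(ℝ, E) x) (α : DiffForm E M (k + 1)) :
    DiffForm E M k := fun x => (α x).curryLeft (X x)

/-- The Lie derivative `𝓛_X α = d ι_X α + ι_X d α`; the first term is absent in degree `0`. -/
def lieDeriv (X : (x : M) → TangentSpace 𝓘(ℝ, E) x) : {k : ℕ} → DiffForm E M k → DiffForm E M k
  | 0, α => contract X (extD α)
  | _ + 1, α => extD (contract X α) + contract X (extD α)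

theorem localRep_add {k : ℕ} (φ : OpenPartialHomeomorph M E) (α β : DiffForm E M k) :
    localRep φ (α + β) = localRep φ α + localRep φ β := rfl

theorem localRep_smul {k : ℕ} (φ : OpenPartialHomeomorph M E) (c : ℝ) (α : DiffForm E M k) :
    localRep φ (c • α) = c • localRep φ α := rfl

theorem localRep_zero {k : ℕ} (φ : OpenPartialHomeomorph M E) :
    localRep φ (0 : DiffForm E M k) = 0 := rfl

theorem IsSmoothForm.differentiableAt {k : ℕ} {α : DiffForm E M k} (h : IsSmoothForm α) (x : M) :
    DifferentiableAt ℝ (localRep (chartAt E x) α) (chartAt E x x) :=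
  ((h _ (chart_mem_atlas E x)).contDiffAt
    ((chartAt E x).open_target.mem_nhds (mem_chart_target E x))).differentiableAt (by simp)

theorem IsSmoothForm.add {k : ℕ} {α β : DiffForm E M k} (hα : IsSmoothForm α)
    (hβ : IsSmoothForm β) : IsSmoothForm (α + β) := fun φ hφ => by
  rw [localRep_add]
  exact (hα φ hφ).add (hβ φ hφ)

theorem IsSmoothForm.smul {k : ℕ} (c : ℝ) {α : DiffForm E M k} (hα : IsSmoothForm α) :
    IsSmoothForm (c • α) := fun φ hφ => by
  rw [localRep_smul]
  exact (hα φ hφ).const_smul c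

theorem isSmoothForm_zero {k : ℕ} : IsSmoothForm (0 : DiffForm E M k) := fun φ _ => by
  rw [localRep_zero]
  exact contDiffOn_const

theorem extD_add {k : ℕ} {α β : DiffForm E M k} (hα : IsSmoothForm α) (hβ : IsSmoothForm β) :
    extD (α + β) = extD α + extD β := by
  funext x
  simp only [extD, localRep_add, Pi.add_apply]
  rw [extDeriv_add (hα.differentiableAt x) (hβ.differentiableAt x)]
  rfl

theorem extD_smul {k : ℕ} (c : ℝ) (α : DiffForm E M k) : extD (c • α) = c • extD α := by
  funext x
  simp only [extD, localRep_smul, Pi.smul_apply]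
  rw [extDeriv_smul]
  rfl

theorem extD_zero {k : ℕ} : extD (0 : DiffForm E M k) = 0 := by
  have h := extD_smul (0 : ℝ) (0 : DiffForm E M k)
  rwa [zero_smul, zero_smul] at h

theorem contract_add {k : ℕ} (X : (x : M) → TangentSpace 𝓘(ℝ, E) x) (α β : DiffForm E M (k + 1)) :
    contract X (α + β) = contract X α + contract X β := rfl

theorem contract_smul {k : ℕ} (X : (x : M) → TangentSpace 𝓘(ℝ, E) x) (c : ℝ)
    (α : DiffForm E M (k + 1)) : contract X (c • α) = c • contract X α := rfl

theorem contract_zero {k : ℕ} (X : (x : M) → TangentSpace 𝓘(ℝ, E) x) :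
    contract X (0 : DiffForm E M (k + 1)) = 0 := rfl

/-! ### Foliations and basic forms -/

variable (E M) in
/-- A (regular, smooth) foliation of codimension `q`, given by its tangent distribution `P ⊆ TM`.
Around every point there is a foliation chart `φ`, that is, a smooth chart and a splitting of the
model space as `ker π × ℝ^q`, such that `P` is the distribution tangent to the plaques
`π ∘ φ = const`. -/
structure Foliation (q : ℕ) where
  /-- The tangent spaces of the leaves. -/
  tangent : (x : M) → Submodule ℝ (TangentSpace 𝓘(ℝ, E) x)
  exists_foliationChart : ∀ p : M,
    ∃ φ ∈ IsManifold.maximalAtlas 𝓘(ℝ, E) ∞ M, p ∈ φ.source ∧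
      ∃ π : E →L[ℝ] (Fin q → ℝ), Function.Surjective π ∧
        ∀ z ∈ φ.source, ∀ X : TangentSpace 𝓘(ℝ, E) z,
          X ∈ tangent z ↔
            π (NormedSpace.fromTangentSpace (φ z) (mfderiv 𝓘(ℝ, E) 𝓘(ℝ, E) φ z X)) = 0

variable {q : ℕ}

/-- `Γ(P)`: the smooth vector fields on `M` that are tangent to the leaves. -/
def Foliation.sections [IsManifold 𝓘(ℝ, E) ∞ M] (F : Foliation E M q) :
    Set ((x : M) → TangentSpace 𝓘(ℝ, E) x) :=
  {X | ContMDiff 𝓘(ℝ, E) 𝓘(ℝ, E).tangent ∞ (fun x => (⟨x, X x⟩ : TangentBundle 𝓘(ℝ, E) M)) ∧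
    ∀ x, X x ∈ F.tangent x}

variable [IsManifold 𝓘(ℝ, E) ∞ M]

/-- `ι_X α = 0` for all `X ∈ Γ(P)` (no condition in degree `0`). -/
def IsHorizontal (F : Foliation E M q) : {k : ℕ} → DiffForm E M k → Prop
  | 0, _ => True
  | _ + 1, α => ∀ X ∈ F.sections, contract X α = 0

/-- A basic form: a smooth form with `ι_X α = 0` and `𝓛_X α = 0` for all `X ∈ Γ(P)`. -/
def IsBasic (F : Foliation E M q) {k : ℕ} (α : DiffForm E M k) : Prop :=
  IsSmoothForm α ∧ IsHorizontal F α ∧ ∀ X ∈ F.sections, lieDeriv X α = 0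

/-- A transversely symplectic form: a smooth closed two-form whose kernel at each point is the
tangent space of the leaf. -/
structure IsTransverselySymplectic (F : Foliation E M q) (σ : DiffForm E M 2) : Prop where
  smooth : IsSmoothForm σ
  closed : extD σ = 0
  ker_eq : ∀ (x : M) (X : TangentSpace 𝓘(ℝ, E) x),
    X ∈ F.tangent x ↔ ∀ Y : TangentSpace 𝓘(ℝ, E) x, σ x ![X, Y] = 0

/-! ### The linear structure of basic forms -/

theorem isBasic_zero (F : Foliation E M q) {k : ℕ} : IsBasic F (0 : DiffForm E M k) := by
  refine ⟨isSmoothForm_zero, ?_, ?_⟩ <;> cases k <;>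
    simp [IsHorizontal, lieDeriv, contract_zero, extD_zero]

theorem IsBasic.add {F : Foliation E M q} {k : ℕ} {α β : DiffForm E M k} (hα : IsBasic F α)
    (hβ : IsBasic F β) : IsBasic F (α + β) := by
  obtain ⟨sα, iα, lα⟩ := hα
  obtain ⟨sβ, iβ, lβ⟩ := hβ
  refine ⟨sα.add sβ, ?_, fun X hX => ?_⟩
  · cases k with
    | zero => trivial
    | succ k => exact fun X hX => by rw [contract_add, iα X hX, iβ X hX, add_zero]
  · have h1 := lα X hX
    have h2 := lβ X hX
    cases k with
    | zero =>
      simp only [lieDeriv] at h1 h2 ⊢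
      rw [extD_add sα sβ, contract_add, h1, h2, add_zero]
    | succ k =>
      simp only [lieDeriv, iα X hX, iβ X hX, contract_add, extD_add sα sβ, extD_zero,
        zero_add, add_zero] at h1 h2 ⊢
      rw [h1, h2, add_zero]

theorem IsBasic.smul {F : Foliation E M q} {k : ℕ} (c : ℝ) {α : DiffForm E M k}
    (hα : IsBasic F α) : IsBasic F (c • α) := by
  obtain ⟨sα, iα, lα⟩ := hα
  refine ⟨sα.smul c, ?_, fun X hX => ?_⟩
  · cases k with
    | zero => trivial
    | succ k => exact fun X hX => by rw [contract_smul, iα X hX, smul_zero]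
  · have h1 := lα X hX
    cases k with
    | zero =>
      simp only [lieDeriv] at h1 ⊢
      rw [extD_smul, contract_smul, h1, smul_zero]
    | succ k =>
      simp only [lieDeriv] at h1 ⊢
      rw [extD_smul, contract_smul, contract_smul, extD_smul, ← smul_add, h1, smul_zero]

/-- `Ω_bas^k(M)`, the space of basic `k`-forms. -/
def basicForms (F : Foliation E M q) (k : ℕ) : Submodule ℝ (DiffForm E M k) where
  carrier := {α | IsBasic F α}
  zero_mem' := isBasic_zero F
  add_mem' := IsBasic.add
  smul_mem' c _ := IsBasic.smul c

/-- `ker d` on `Ω_bas^k(M)`. -/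
def closedBasic (F : Foliation E M q) (k : ℕ) : Submodule ℝ (DiffForm E M k) where
  carrier := {α | α ∈ basicForms F k ∧ extD α = 0}
  zero_mem' := ⟨zero_mem _, extD_zero⟩
  add_mem' := fun ⟨hα, dα⟩ ⟨hβ, dβ⟩ =>
    ⟨add_mem hα hβ, by rw [extD_add hα.1 hβ.1, dα, dβ, add_zero]⟩
  smul_mem' c _ := fun ⟨hα, dα⟩ =>
    ⟨Submodule.smul_mem _ c hα, by rw [extD_smul, dα, smul_zero]⟩

/-- `Im d` in degree `k`: the image of `d : Ω_bas^{k-1}(M) → Ω_bas^k(M)`, which is zero for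
`k = 0`. -/
def exactBasic (F : Foliation E M q) : (k : ℕ) → Submodule ℝ (DiffForm E M k)
  | 0 => ⊥
  | k + 1 =>
    { carrier := {α | ∃ β ∈ basicForms F k, extD β = α}
      zero_mem' := ⟨0, zero_mem _, extD_zero⟩
      add_mem' := fun ⟨β, hβ, dβ⟩ ⟨γ, hγ, dγ⟩ =>
        ⟨β + γ, add_mem hβ hγ, by rw [extD_add hβ.1 hγ.1, dβ, dγ]⟩
      smul_mem' := fun c _ ⟨β, hβ, dβ⟩ =>
        ⟨c • β, Submodule.smul_mem _ c hβ, by rw [extD_smul, dβ]⟩ }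

/-- The basic de Rham cohomology `H_B^k(M, ℝ)`: closed basic `k`-forms modulo differentials of
basic `(k-1)`-forms. -/
abbrev BasicCohomology (F : Foliation E M q) (k : ℕ) : Type _ :=
  closedBasic F k ⧸ (exactBasic F k).submoduleOf (closedBasic F k)

/-! ### The symplectic Hodge operators of a transversely symplectic foliation -/

/-- `L^j α = α ∧ σ^j`. -/
def lefschetzForm (σ : DiffForm E M 2) {k : ℕ} (α : DiffForm E M k) (j : ℕ) :
    DiffForm E M (k + 2 * j) := fun x => lefschetz (σ x) (α x) j

/-- The symplectic Hodge star of horizontal forms for a transversely symplectic form `σ` of a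
foliation of codimension `2n`. A horizontal form and `σ` descend to the normal space
`Q_x = T_x M ⧸ P_x`, where `σ` is a symplectic form; `⋆` is the symplectic star of `Q_x`, followed
by the pullback along `T_x M → Q_x`. -/
def hodgeStar {n : ℕ} (F : Foliation E M (2 * n)) (σ : DiffForm E M 2) {k l : ℕ}
    (h : k + l = 2 * n) (α : DiffForm E M k) : DiffForm E M l := fun x =>
  (symplecticStar (descend (F.tangent x) (σ x)) n h
    (descend (F.tangent x) (α x))).compLinearMap (F.tangent x).mkQ

/-- The symplectic codifferential `δ α = (-1)^{deg α + 1} ⋆ d ⋆ α` on forms of degree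
`deg α = k + 1 ≤ 2n`. (Basic forms of degree `> 2n` vanish, and `δ` is set to be `0` there.) -/
def delta {n : ℕ} (F : Foliation E M (2 * n)) (σ : DiffForm E M 2) {k : ℕ}
    (α : DiffForm E M (k + 1)) : DiffForm E M k :=
  if h : k + 1 ≤ 2 * n then
    (-1 : ℝ) ^ (k + 1 + 1) • hodgeStar F σ (k := 2 * n - (k + 1) + 1) (l := k) (by omega)
      (extD (hodgeStar F σ (k := k + 1) (l := 2 * n - (k + 1)) (by omega) α))
  else 0

/-! ### The Lefschetz property and the `dδ`-lemma -/

variable {n : ℕ}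

/-- `ker δ` on `Ω_bas^k(M)`; `δ` vanishes on functions. -/
def deltaClosed (F : Foliation E M (2 * n)) (σ : DiffForm E M 2) :
    (k : ℕ) → Set (DiffForm E M k)
  | 0 => basicForms F 0
  | k + 1 => {α | α ∈ basicForms F (k + 1) ∧ delta F σ α = 0}

/-- `Im δ` in degree `k`: the image of `δ : Ω_bas^{k+1}(M) → Ω_bas^k(M)`. -/
def deltaExact (F : Foliation E M (2 * n)) (σ : DiffForm E M 2) (k : ℕ) : Set (DiffForm E M k) :=
  {α | ∃ β ∈ basicForms F (k + 1), delta F σ β = α}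

/-- `Im dδ` in degree `k`: the image of `dδ : Ω_bas^k(M) → Ω_bas^k(M)`, which is zero for
`k = 0`. -/
def dDeltaExact (F : Foliation E M (2 * n)) (σ : DiffForm E M 2) :
    (k : ℕ) → Set (DiffForm E M k)
  | 0 => {0}
  | k + 1 => {α | ∃ β ∈ basicForms F (k + 1), extD (delta F σ β) = α}

/-- `Im d ∩ ker δ = Im dδ` on `Ω_bas^k(M)`. -/
def ExactIdentity (F : Foliation E M (2 * n)) (σ : DiffForm E M 2) (k : ℕ) : Prop :=
  (exactBasic F k : Set (DiffForm E M k)) ∩ deltaClosed F σ k = dDeltaExact F σ k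

/-- `Im δ ∩ ker d = Im dδ` on `Ω_bas^k(M)`. -/
def CoexactIdentity (F : Foliation E M (2 * n)) (σ : DiffForm E M 2) (k : ℕ) : Prop :=
  deltaExact F σ k ∩ (closedBasic F k : Set (DiffForm E M k)) = dDeltaExact F σ k

/-- The transverse `s`-Lefschetz property: for `0 ≤ k ≤ s` the assignment `[α] ↦ [σ^{n-k} ∧ α]`
is a well-defined isomorphism `H_B^k(M, ℝ) ≃ H_B^{2n-k}(M, ℝ)`. Here `2n - k` is written as
`k + 2 (n - k)`. -/
def TransverseLefschetz (F : Foliation E M (2 * n)) (σ : DiffForm E M 2) (s : ℕ) : Prop :=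
  ∀ k ≤ s, ∃ f : BasicCohomology F k ≃ₗ[ℝ] BasicCohomology F (k + 2 * (n - k)),
    ∀ α : closedBasic F k, ∃ β : closedBasic F (k + 2 * (n - k)),
      (β : DiffForm E M (k + 2 * (n - k))) = lefschetzForm σ (α : DiffForm E M k) (n - k) ∧
        f (Submodule.Quotient.mk α) = Submodule.Quotient.mk β

/-- The symplectic `dδ`-lemma up to degree `s`: `Im d ∩ ker δ = Im dδ = Im δ ∩ ker d` on
`Ω_bas^k(M)` for all `k ≤ s`, and `Im d ∩ ker δ = Im dδ` on `Ω_bas^{s+1}(M)`. -/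
def DDeltaLemmaUpTo (F : Foliation E M (2 * n)) (σ : DiffForm E M 2) (s : ℕ) : Prop :=
  (∀ k ≤ s, ExactIdentity F σ k ∧ CoexactIdentity F σ k) ∧ ExactIdentity F σ (s + 1)

/-- `Im d ∩ ker δ = Im dδ = Im δ ∩ ker d` on basic forms of all degrees `≥ 2n - s`, and
`Im δ ∩ ker d = Im dδ` on `Ω_bas^{2n-s-1}(M)`. -/
def DDeltaLemmaFrom (F : Foliation E M (2 * n)) (σ : DiffForm E M 2) (s : ℕ) : Prop :=
  (∀ k ≥ 2 * n - s, ExactIdentity F σ k ∧ CoexactIdentity F σ k) ∧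
    CoexactIdentity F σ (2 * n - s - 1)

end Manifold

end TransverseHodge

end

/-!
On the space of forms of a symplectic vector space of dimension `2n`, the operator `L = (· ∧ σ)`
satisfies `L^j : Λ^k ≃ Λ^{k+2j}` for `k + j = n`, so every form is a sum of terms `L^r a` with `a`
primitive (`isLefschetzModule_forms`, `IsLefschetzModule.induction_on`), and the symplectic star is
given on these terms by Weil's formula `⋆ (L^r a / r!) = ± L^m a / m!`
(`isSymplecticStar_lefschetzOp_pow`).

Both facts pass to basic forms. They hold on each normal space `T_x M ⧸ P_x`; the pointwise preimage
under `L^j` of a basic form is smooth because, in a foliation chart, it comes from applying the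
inverse of a smooth family of invertible operators, and its differential is again transverse because
`L^j` is injective (`exists_lefschetzForm_eq`). Weil's formula then shows that `⋆` preserves basic
forms (`hodgeStar_mem_basicForms`).

What remains is algebra in a graded space with operators `L`, `d`, `⋆`, `δ` such that `dL = Ld`
(here `dσ = 0` enters) and Weil's formula holds: `IsHodgeLefschetz`, satisfied by basic forms
according to `isHodgeLefschetz_basic`. Evaluating `δ` on `L^r a` for primitive `a` gives
`δ L = L δ + d`, hence `d δ = -δ d`. If `L^{n-k}` is an isomorphism on cohomology for `k ≤ s`, the
`dδ`-identities follow by induction on the degree: decompose the form under consideration (a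
potential for `d` or for `δ`) as `a₀ + L a₁` with `a₀` primitive, treat `L a₁` by the identities two
degrees lower, and apply the Lefschetz property to `a₀` through `L^{j+1} δ a₀ = -(j+1) L^j d a₀`,
valid when `L^{j+1} a₀ = 0` (`pow_δ_primitive`, `identities_of_lefschetz`).
Conversely the identities in degrees `k` and `k + 1` give injectivity and surjectivity of `L^{n-k}`
on cohomology (`lefschetz_of_identities`). Finally `⋆` exchanges `d` and `δ` up to sign and degree
`k` with degree `2n - k`, which matches the identities in low degrees with those in high degrees
(`gradedCoexactIdentity_iff`).
-/

noncomputable section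

namespace TransverseHodge


/-! ### Graded spaces with a Lefschetz operator -/

section LefschetzAlgebra

variable {A : Type*} [AddCommGroup A] [Module ℝ A]

/-- A Lefschetz module of half-length `n`: a space `A` with homogeneous parts `G k`, concentrated in
degrees `0, …, 2n`, and an operator `L` of degree `2` such that `L^j : G k → G (k + 2j)` is
bijective whenever `k + j = n`. Degrees are integers, so that no degree has to be treated separately at the
ends of the complex. -/
structure IsLefschetzModule (G : ℤ → Submodule ℝ A) (L : Module.End ℝ A) (n : ℕ) : Prop where
  map_mem : ∀ {k : ℤ} {a : A}, a ∈ G k → L a ∈ G (k + 2)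
  eq_zero : ∀ {k : ℤ} {a : A}, (k < 0 ∨ 2 * n < k) → a ∈ G k → a = 0
  inj : ∀ {k : ℤ} {j : ℕ} {a : A}, k + j = n → a ∈ G k → (L ^ j) a = 0 → a = 0
  surj : ∀ {k : ℤ} {j : ℕ} {c : A}, k + j = n → c ∈ G (k + 2 * j) → ∃ a ∈ G k, (L ^ j) a = c

namespace IsLefschetzModule

variable {G : ℤ → Submodule ℝ A} {L : Module.End ℝ A} {n : ℕ}

theorem pow_mem (h : IsLefschetzModule G L n) {k l : ℤ} {j : ℕ} {a : A} (ha : a ∈ G k)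
    (hl : l = k + 2 * j) : (L ^ j) a ∈ G l := by
  subst hl
  induction j with
  | zero => simpa using ha
  | succ j ih =>
    rw [pow_succ', Module.End.mul_apply]
    have := h.map_mem ih
    rwa [show k + 2 * ((j + 1 : ℕ) : ℤ) = k + 2 * j + 2 by push_cast; ring]

/-- One step of the Lefschetz decomposition: a form is the sum of a primitive form and a form in the
image of `L`. -/
theorem exists_primitive_add (h : IsLefschetzModule G L n) {k : ℤ} {j : ℕ} {a : A}
    (hk : k + j = n) (ha : a ∈ G k) :
    ∃ a₀ ∈ G k, ∃ a₁ ∈ G (k - 2), (L ^ (j + 1)) a₀ = 0 ∧ a = a₀ + L a₁ := by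
  have h1 : (L ^ (j + 1)) a ∈ G ((k - 2) + 2 * ((j + 2 : ℕ) : ℤ)) :=
    h.pow_mem ha (by push_cast; ring)
  obtain ⟨a₁, ha₁, he⟩ := h.surj (by push_cast; omega) h1
  have h2 := h.map_mem ha₁
  rw [show k - 2 + 2 = k by ring] at h2
  refine ⟨a - L a₁, sub_mem ha h2, a₁, ha₁, ?_, by abel⟩
  rw [map_sub, ← he, ← Module.End.mul_apply, ← pow_succ, sub_self]

/-- The Lefschetz decomposition as an induction principle: an additive property of forms of degree
`k` holds for all of them once it holds for the forms `L^r a` with `a` primitive. -/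
theorem induction_on (h : IsLefschetzModule G L n) {P : A → Prop} (k : ℤ)
    (zero : P 0) (add : ∀ a b, a ∈ G k → b ∈ G k → P a → P b → P (a + b))
    (prim : ∀ (p : ℤ) (r m : ℕ) (a : A), p + 2 * r = k → p + r + m = n → a ∈ G p →
      (L ^ (r + m + 1)) a = 0 → P ((L ^ r) a)) {a : A} (ha : a ∈ G k) : P a := by
  -- degrees `≤ n`, by repeated primitive decomposition; the extra power `L^i` serves to treat
  -- the degrees above `n`
  have key : ∀ (N : ℕ) (q : ℤ) (i : ℕ) (b : A), q ≤ N → q + i ≤ n → q + 2 * i = k → b ∈ G q →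
      P ((L ^ i) b) := by
    intro N
    induction N using Nat.strong_induction_on with
    | _ N ih =>
      intro q i b hqN hqi hk hb
      rcases lt_or_ge q 0 with hq | hq
      · rw [h.eq_zero (Or.inl hq) hb, map_zero]; exact zero
      obtain ⟨b₀, hb₀, b₁, hb₁, hp, rfl⟩ :=
        h.exists_primitive_add (j := (n - q).toNat) (by omega) hb
      rw [map_add, ← Module.End.mul_apply, ← pow_succ]
      refine add _ _ (h.pow_mem hb₀ hk.symm) (h.pow_mem hb₁ (by push_cast; omega)) ?_ ?_
      · refine prim q i ((n - q).toNat - i) b₀ hk (by omega) hb₀ ?_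
        rwa [show i + ((n - q).toNat - i) + 1 = (n - q).toNat + 1 by omega]
      · rcases lt_or_ge (q - 2) 0 with hq2 | hq2
        · rw [h.eq_zero (Or.inl hq2) hb₁, map_zero]; exact zero
        · exact ih (q - 2).toNat (by omega) (q - 2) (i + 1) b₁ (by omega) (by push_cast; omega)
            (by push_cast; omega) hb₁
  rcases le_or_gt k n with hkn | hkn
  · exact key k.toNat k 0 a (by omega) (by simpa using hkn) (by simp) ha
  · have hd : (2 * n - k) + ((k - n).toNat : ℤ) = n := by omega
    obtain ⟨b, hb, rfl⟩ := h.surj (j := (k - n).toNat) (c := a) hd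
      (by rwa [show 2 * (n : ℤ) - k + 2 * ((k - n).toNat : ℤ) = k by omega])
    exact key (2 * n - k).toNat _ _ b (by omega) (by omega) (by omega) hb

end IsLefschetzModule

/-- The sign `(-1)^{p(p+1)/2}` by which the Hodge star acts on primitive forms of degree `p`. -/
def weilSign (p : ℤ) : ℝ := (-1 : ℝ) ^ (p * (p + 1) / 2)

theorem weilSign_zero : weilSign 0 = 1 := by simp [weilSign]

theorem weilSign_succ (p : ℤ) : weilSign (p + 1) = (-1) ^ (p + 1) * weilSign p := by
  have h : (p + 1) * (p + 1 + 1) / 2 = (p + 1) + p * (p + 1) / 2 := by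
    rw [show (p + 1) * (p + 1 + 1) = (p + 1) * 2 + p * (p + 1) by ring,
      Int.add_ediv_of_dvd_left (Dvd.intro_left _ rfl)]
    simp
  rw [weilSign, h, zpow_add₀ (by norm_num), weilSign]

theorem neg_one_zpow_mul_self (p : ℤ) : (-1 : ℝ) ^ p * (-1) ^ p = 1 := by
  rw [← mul_zpow]; simp

theorem weilSign_mul_self (p : ℤ) : weilSign p * weilSign p = 1 := neg_one_zpow_mul_self _

theorem neg_one_zpow_succ (p : ℤ) : (-1 : ℝ) ^ (p + 1) = -(-1) ^ p := by
  rw [zpow_add_one₀ (by norm_num)]; ring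

theorem neg_one_zpow_add_two_mul (p q : ℤ) : (-1 : ℝ) ^ (p + 2 * q) = (-1) ^ p := by
  rw [zpow_add₀ (by norm_num), zpow_mul]; simp

theorem neg_one_zpow_two_mul_sub (p q : ℤ) : (-1 : ℝ) ^ (2 * q - p) = (-1) ^ p := by
  rw [show 2 * q - p = -p + 2 * q by ring, neg_one_zpow_add_two_mul, zpow_neg, ← inv_zpow]
  norm_num

/-- Weil's formula for an operator `S` (the Hodge star):
`⋆ (L^r a / r!) = (-1)^{p(p+1)/2} L^m a / m!` for primitive `a` of degree `p`, where
`p + r + m = n`. -/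
def SatisfiesWeilFormula (G : ℤ → Submodule ℝ A) (L S : Module.End ℝ A) (n : ℕ) : Prop :=
  ∀ (p : ℤ) (r m : ℕ) (a : A), p + r + m = n → a ∈ G p → (L ^ (r + m + 1)) a = 0 →
    (m.factorial : ℝ) • S ((L ^ r) a) = (weilSign p * r.factorial) • (L ^ m) a

/-- A Lefschetz module with a differential `d` commuting with `L`, a Hodge star `S` given by Weil's
formula and the codifferential `δ = (-1)^{k+1} ⋆ d ⋆`. -/
structure IsHodgeLefschetz (G : ℤ → Submodule ℝ A) (L d S δ : Module.End ℝ A) (n : ℕ) : Prop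
    extends IsLefschetzModule G L n where
  d_mem : ∀ {k : ℤ} {a : A}, a ∈ G k → d a ∈ G (k + 1)
  d_d : ∀ {k : ℤ} {a : A}, a ∈ G k → d (d a) = 0
  d_L : ∀ {k : ℤ} {a : A}, a ∈ G k → d (L a) = L (d a)
  weil : SatisfiesWeilFormula G L S n
  δ_eq : ∀ {k : ℤ} {a : A}, a ∈ G k → δ a = (-1 : ℝ) ^ (k + 1) • S (d (S a))

namespace IsHodgeLefschetz

variable {G : ℤ → Submodule ℝ A} {L d S δ : Module.End ℝ A} {n : ℕ}

theorem star_eq (h : IsHodgeLefschetz G L d S δ n) {p : ℤ} {r m : ℕ} {a : A} (hn : p + r + m = n)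
    (ha : a ∈ G p) (hL : (L ^ (r + m + 1)) a = 0) :
    S ((L ^ r) a) = ((m.factorial : ℝ)⁻¹ * (weilSign p * r.factorial)) • (L ^ m) a := by
  rw [mul_smul, ← h.weil p r m a hn ha hL, smul_smul, inv_mul_cancel₀ (by positivity), one_smul]

theorem star_mem (h : IsHodgeLefschetz G L d S δ n) {k l : ℤ} {a : A} (ha : a ∈ G k)
    (hl : k + l = 2 * n) : S a ∈ G l := by
  refine h.induction_on (P := fun a => S a ∈ G l) k (by simp) (fun a b _ _ ha hb => ?_)
    (fun p r m a hk hn ha hL => ?_) ha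
  · rw [map_add]; exact add_mem ha hb
  · rw [h.star_eq hn ha hL]
    exact Submodule.smul_mem _ _ (h.pow_mem ha (by omega))

theorem star_star (h : IsHodgeLefschetz G L d S δ n) {k : ℤ} {a : A} (ha : a ∈ G k) :
    S (S a) = a := by
  refine h.induction_on (P := fun a => S (S a) = a) k (by simp) (fun a b _ _ ha hb => ?_)
    (fun p r m a hk hn ha hL => ?_) ha
  · rw [map_add, map_add, ha, hb]
  · rw [h.star_eq hn ha hL, map_smul,
      h.star_eq (r := m) (m := r) (by omega) ha (by rwa [add_comm m r]), smul_smul]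
    have h1 := weilSign_mul_self p
    have : ((m.factorial : ℝ)⁻¹ * (weilSign p * r.factorial)) *
        ((r.factorial : ℝ)⁻¹ * (weilSign p * m.factorial)) = 1 := by
      field_simp
      linear_combination h1
    rw [this, one_smul]

theorem d_pow (h : IsHodgeLefschetz G L d S δ n) {k : ℤ} {a : A} (ha : a ∈ G k) (j : ℕ) :
    d ((L ^ j) a) = (L ^ j) (d a) := by
  induction j with
  | zero => simp
  | succ j ih =>
    rw [pow_succ', Module.End.mul_apply, h.d_L (h.pow_mem ha rfl), ih, Module.End.mul_apply]

theorem star_d (h : IsHodgeLefschetz G L d S δ n) {k : ℤ} {a : A} (ha : a ∈ G k) :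
    S (d a) = (-1 : ℝ) ^ (k + 1) • δ (S a) := by
  rw [h.δ_eq (h.star_mem (l := 2 * n - k) ha (by ring)), h.star_star ha, smul_smul,
    neg_one_zpow_succ, neg_one_zpow_succ, neg_one_zpow_two_mul_sub, neg_mul_neg,
    neg_one_zpow_mul_self, one_smul]

theorem star_δ (h : IsHodgeLefschetz G L d S δ n) {k : ℤ} {a : A} (ha : a ∈ G k) :
    S (δ a) = (-1 : ℝ) ^ (k + 1) • d (S a) := by
  rw [h.δ_eq ha, map_smul, h.star_star (h.d_mem (h.star_mem (l := 2 * n - k) ha (by ring)))]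

theorem δ_mem (h : IsHodgeLefschetz G L d S δ n) {k : ℤ} {a : A} (ha : a ∈ G k) :
    δ a ∈ G (k - 1) := by
  rw [h.δ_eq ha]
  exact Submodule.smul_mem _ _
    (h.star_mem (h.d_mem (h.star_mem (l := 2 * n - k) ha (by ring))) (by ring))

theorem δ_δ (h : IsHodgeLefschetz G L d S δ n) {k : ℤ} {a : A} (ha : a ∈ G k) : δ (δ a) = 0 := by
  have hs := h.star_mem (l := 2 * n - k) ha (by ring)
  rw [h.δ_eq (h.δ_mem ha), h.star_δ ha, map_smul, h.d_d hs, smul_zero, map_zero, smul_zero]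

/-- The differential of a primitive form has at most two components in its Lefschetz
decomposition. -/
theorem d_primitive (h : IsHodgeLefschetz G L d S δ n) {p : ℤ} {j : ℕ} {a : A} (hp : p + j = n)
    (ha : a ∈ G p) (hL : (L ^ (j + 1)) a = 0) :
    ∃ b ∈ G (p + 1), ∃ c ∈ G (p - 1), (L ^ j) b = 0 ∧ (L ^ (j + 2)) c = 0 ∧ d a = b + L c := by
  have hd : (L ^ (j + 1)) (d a) = 0 := by rw [← h.d_pow ha, hL, map_zero]
  cases j with
  | zero =>
    obtain ⟨c, hc, he⟩ := h.surj (k := p - 1) (j := 1) (c := d a) (by push_cast; omega)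
      (by have := h.d_mem ha; rwa [show p - 1 + 2 * ((1 : ℕ) : ℤ) = p + 1 by push_cast; ring])
    refine ⟨0, zero_mem _, c, hc, map_zero _, ?_, ?_⟩
    · rw [← he] at hd
      rw [pow_succ, Module.End.mul_apply]
      simpa using hd
    · rw [← he]; simp
  | succ j =>
    obtain ⟨b, hb, c, hc, hb0, he⟩ := h.exists_primitive_add (j := j) (k := p + 1)
      (by push_cast at hp; omega) (h.d_mem ha)
    refine ⟨b, hb, c, by rwa [show p - 1 = p + 1 - 2 by ring], hb0, ?_, he⟩
    rw [he, map_add, pow_succ' L (j + 1), Module.End.mul_apply, hb0, map_zero, zero_add,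
      ← pow_succ', ← Module.End.mul_apply, ← pow_succ] at hd
    exact hd

/-- The codifferential on `L^r a` with `a` primitive, in terms of the decomposition
`d a = b + L c` of `d a`. -/
theorem δ_pow_primitive (h : IsHodgeLefschetz G L d S δ n) {p : ℤ} {r m : ℕ} {a b c : A}
    (hn : p + r + m = n) (ha : a ∈ G p) (hL : (L ^ (r + m + 1)) a = 0) (hb : b ∈ G (p + 1))
    (hb0 : (L ^ (r + m)) b = 0) (hc : c ∈ G (p - 1)) (hc0 : (L ^ (r + m + 2)) c = 0)
    (he : d a = b + L c) :
    δ ((L ^ r) a) = (r : ℝ) • (L ^ (r - 1)) b - ((m : ℝ) + 1) • (L ^ r) c := by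
  have hm0 : (m.factorial : ℝ) ≠ 0 := by positivity
  have hr0 : (r.factorial : ℝ) ≠ 0 := by positivity
  have e1 : weilSign (p + 1) = -(-1) ^ p * weilSign p := by
    rw [weilSign_succ, neg_one_zpow_succ]
  have e2 : weilSign p = (-1) ^ p * weilSign (p - 1) := by
    have := weilSign_succ (p - 1)
    rwa [sub_add_cancel] at this
  have e3 := weilSign_mul_self p
  have e4 := neg_one_zpow_mul_self p
  have e5 : weilSign (p - 1) = (-1) ^ p * weilSign p := by
    rw [e2, ← mul_assoc, e4, one_mul]
  -- the star of the two components of `d ⋆ L^r a`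
  have sb : ((m.factorial : ℝ)⁻¹ * r.factorial) • S ((L ^ m) b) =
      (weilSign (p + 1) * r) • (L ^ (r - 1)) b := by
    cases r with
    | zero =>
      rw [zero_add] at hb0
      simp [hb0]
    | succ r =>
      have hw := h.star_eq (p := p + 1) (r := m) (m := r) (by push_cast at hn; omega) hb
        (by rwa [show m + r + 1 = r + 1 + m by ring])
      rw [hw, smul_smul, Nat.factorial_succ]
      congr 1
      push_cast
      field_simp
  have sc : ((m.factorial : ℝ)⁻¹ * r.factorial) • S ((L ^ (m + 1)) c) =
      (weilSign (p - 1) * (m + 1)) • (L ^ r) c := by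
    have hw := h.star_eq (p := p - 1) (r := m + 1) (m := r) (by push_cast; omega) hc
      (by rwa [show m + 1 + r + 1 = r + m + 2 by ring])
    rw [hw, smul_smul, Nat.factorial_succ]
    congr 1
    push_cast
    field_simp
  rw [h.δ_eq (h.pow_mem ha rfl), h.star_eq hn ha hL, map_smul, h.d_pow ha, he, map_smul, map_add,
    ← Module.End.mul_apply (L ^ m) L, ← pow_succ, map_add,
    show ((m.factorial : ℝ)⁻¹ * (weilSign p * r.factorial)) =
      weilSign p * ((m.factorial : ℝ)⁻¹ * r.factorial) by ring, mul_smul, smul_add, sb, sc,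
    show p + 2 * (r : ℤ) + 1 = p + 1 + 2 * r by ring, neg_one_zpow_add_two_mul, neg_one_zpow_succ,
    e1, e5, smul_add, smul_add, smul_smul, smul_smul, smul_smul, smul_smul, sub_eq_add_neg,
    ← neg_smul]
  congr 2
  · linear_combination ((-1) ^ p * (-1) ^ p * (r : ℝ)) * e3 + (r : ℝ) * e4
  · linear_combination (-(-1) ^ p * (-1) ^ p * ((m : ℝ) + 1)) * e3 - ((m : ℝ) + 1) * e4

/-- The symplectic Kähler identity `[δ, L] = d`. -/
theorem δ_L (h : IsHodgeLefschetz G L d S δ n) {k : ℤ} {a : A} (ha : a ∈ G k) :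
    δ (L a) = L (δ a) + d a := by
  refine h.induction_on (P := fun a => δ (L a) = L (δ a) + d a) k (by simp)
    (fun a b _ _ ha hb => ?_) (fun p r m a hk hn ha hL => ?_) ha
  · simp only [map_add, ha, hb]; abel
  obtain ⟨b, hb, c, hc, hb0, hc0, he⟩ := h.d_primitive (j := r + m) (by push_cast; omega) ha hL
  have hLr : L (((r : ℝ)) • (L ^ (r - 1)) b) = (r : ℝ) • (L ^ r) b := by
    cases r with
    | zero => simp
    | succ r => rw [map_smul, Nat.add_sub_cancel, pow_succ', Module.End.mul_apply]
  rw [h.δ_pow_primitive hn ha hL hb hb0 hc hc0 he, map_sub, hLr, map_smul,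
    ← Module.End.mul_apply L (L ^ r), ← pow_succ', h.d_pow ha, he, map_add,
    ← Module.End.mul_apply (L ^ r) L, ← pow_succ, ← Module.End.mul_apply L (L ^ r), ← pow_succ']
  cases m with
  | zero =>
    rw [add_zero] at hL hb0
    rw [hL, hb0]
    simp
  | succ m =>
    rw [h.δ_pow_primitive (r := r + 1) (m := m) (by push_cast at hn ⊢; omega) ha
      (by rwa [show r + 1 + m + 1 = r + (m + 1) + 1 by ring]) hb
      (by rwa [show r + 1 + m = r + (m + 1) by ring]) hc
      (by rwa [show r + 1 + m + 2 = r + (m + 1) + 2 by ring]) he, Nat.add_sub_cancel]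
    push_cast
    module

theorem d_δ (h : IsHodgeLefschetz G L d S δ n) {k : ℤ} {a : A} (ha : a ∈ G k) :
    d (δ a) = -δ (d a) := by
  have h1 := h.δ_L (h.δ_mem ha)
  have h2 := congrArg δ (h.δ_L ha)
  rw [h.δ_δ (h.map_mem ha), map_add, h1, h.δ_δ ha, map_zero, zero_add] at h2
  exact eq_neg_of_add_eq_zero_left h2.symm

theorem δ_pow (h : IsHodgeLefschetz G L d S δ n) {k : ℤ} {a : A} (ha : a ∈ G k) (j : ℕ) :
    δ ((L ^ (j + 1)) a) = (L ^ (j + 1)) (δ a) + ((j : ℝ) + 1) • (L ^ j) (d a) := by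
  induction j with
  | zero => simpa using h.δ_L ha
  | succ j ih =>
    rw [pow_succ' L (j + 1), Module.End.mul_apply, h.δ_L (h.pow_mem ha rfl), ih, map_add, map_smul,
      h.d_pow ha, ← Module.End.mul_apply L (L ^ j), ← pow_succ', Module.End.mul_apply]
    push_cast
    module

theorem dδ_L (h : IsHodgeLefschetz G L d S δ n) {k : ℤ} {a : A} (ha : a ∈ G k) :
    d (δ (L a)) = L (d (δ a)) := by
  rw [h.δ_L ha, map_add, h.d_d ha, add_zero, h.d_L (h.δ_mem ha)]

theorem dδ_pow (h : IsHodgeLefschetz G L d S δ n) {k : ℤ} {a : A} (ha : a ∈ G k) (j : ℕ) :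
    d (δ ((L ^ j) a)) = (L ^ j) (d (δ a)) := by
  induction j with
  | zero => simp
  | succ j ih =>
    rw [pow_succ', Module.End.mul_apply, h.dδ_L (h.pow_mem ha rfl), ih, Module.End.mul_apply]

end IsHodgeLefschetz

end LefschetzAlgebra


/-! ### The `dδ`-lemma and the Lefschetz property for graded spaces -/

section DDeltaAlgebra

variable {A : Type*} [AddCommGroup A] [Module ℝ A]

/-- `Im d ∩ ker δ ⊆ Im dδ` in degree `k`. -/
def GradedExactIdentity (G : ℤ → Submodule ℝ A) (d δ : Module.End ℝ A) (k : ℤ) : Prop :=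
  ∀ a ∈ G (k - 1), δ (d a) = 0 → ∃ b ∈ G k, d (δ b) = d a

/-- `Im δ ∩ ker d ⊆ Im dδ` in degree `k`. -/
def GradedCoexactIdentity (G : ℤ → Submodule ℝ A) (d δ : Module.End ℝ A) (k : ℤ) : Prop :=
  ∀ a ∈ G (k + 1), d (δ a) = 0 → ∃ b ∈ G k, d (δ b) = δ a

/-- `L^j` induces a bijection on cohomology from degree `k` to degree `k + 2j`. -/
def GradedLefschetz (G : ℤ → Submodule ℝ A) (d L : Module.End ℝ A) (k : ℤ) (j : ℕ) : Prop :=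
  (∀ a ∈ G k, d a = 0 → (∃ b ∈ G (k + 2 * j - 1), d b = (L ^ j) a) → ∃ b ∈ G (k - 1), d b = a) ∧
    ∀ c ∈ G (k + 2 * j), d c = 0 →
      ∃ a ∈ G k, d a = 0 ∧ ∃ b ∈ G (k + 2 * j - 1), d b = c - (L ^ j) a

namespace IsHodgeLefschetz

variable {G : ℤ → Submodule ℝ A} {L d S δ : Module.End ℝ A} {n : ℕ}

theorem gradedExactIdentity_of_neg (h : IsHodgeLefschetz G L d S δ n) {k : ℤ} (hk : k < 0) :
    GradedExactIdentity G d δ k := fun a ha _ =>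
  ⟨0, zero_mem _, by rw [h.eq_zero (Or.inl (by omega)) ha]; simp⟩

theorem gradedCoexactIdentity_of_neg (h : IsHodgeLefschetz G L d S δ n) {k : ℤ} (hk : k < 0) :
    GradedCoexactIdentity G d δ k := fun a ha _ =>
  ⟨0, zero_mem _, by
    have := h.δ_mem ha
    rw [add_sub_cancel_right] at this
    rw [h.eq_zero (Or.inl hk) this]; simp⟩

/-- For primitive `a` of degree `k < n`, `L^{n-k+1} δ a` is a multiple of `L^{n-k} d a`. -/
theorem pow_δ_primitive (h : IsHodgeLefschetz G L d S δ n) {k : ℤ} {j : ℕ} {a : A}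
    (ha : a ∈ G k) (hL : (L ^ (j + 1)) a = 0) :
    (L ^ (j + 1)) (δ a) = -((j : ℝ) + 1) • (L ^ j) (d a) := by
  have := h.δ_pow ha j
  rw [hL, map_zero] at this
  rw [neg_smul]
  exact eq_neg_of_add_eq_zero_left this.symm

/-- If `d δ a = 0` then `d δ` kills both terms of the decomposition `a = a₀ + L a₁`. -/
theorem dδ_primitive_eq_zero (h : IsHodgeLefschetz G L d S δ n) {k : ℤ} {j : ℕ} {a₀ a₁ : A}
    (hk : k + j = n) (h₀ : a₀ ∈ G k) (h₁ : a₁ ∈ G (k - 2)) (hL : (L ^ (j + 1)) a₀ = 0)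
    (hd : (L ^ (j + 1)) (d (δ (a₀ + L a₁))) = 0) :
    d (δ a₁) = 0 := by
  have hm : d (δ a₁) ∈ G (k - 2) := by
    have := h.d_mem (h.δ_mem h₁)
    rwa [sub_add_cancel] at this
  refine h.inj (j := j + 2) (by push_cast; omega) hm ?_
  rw [map_add, map_add, h.dδ_L h₁, map_add, ← h.dδ_pow h₀, hL, map_zero, map_zero, zero_add,
    ← Module.End.mul_apply, ← pow_succ] at hd
  exact hd

/-- A primitive form of degree `k < n` whose codifferential is closed has exact codifferential, if
`L^{n-k+1}` is injective on cohomology. -/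
theorem exists_d_eq_δ_primitive (h : IsHodgeLefschetz G L d S δ n) {k : ℤ} {j : ℕ} {a : A}
    (hlef : GradedLefschetz G d L k (j + 1)) (ha : a ∈ G (k + 1)) (hL : (L ^ (j + 1)) a = 0)
    (hd : d (δ a) = 0) : ∃ b ∈ G (k - 1), d b = δ a := by
  have hδ := h.δ_mem ha
  rw [add_sub_cancel_right] at hδ
  refine hlef.1 _ hδ hd ⟨-((j : ℝ) + 1) • (L ^ j) a, Submodule.smul_mem _ _
    (h.pow_mem ha (by push_cast; ring)), ?_⟩
  rw [map_smul, h.d_pow ha, h.pow_δ_primitive ha hL]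

/-- The step `Im d ∩ ker δ ⊆ Im dδ` for the differential of a form `a` of degree `k` with primitive
differential, from the surjectivity of `L^{n-k}` on cohomology. -/
theorem exists_dδ_eq_of_pow_d_eq_zero (h : IsHodgeLefschetz G L d S δ n) {k : ℤ} {j : ℕ} {a : A}
    (hk : k + (j + 1 : ℕ) = n) (hlef : GradedLefschetz G d L k (j + 1)) (ha : a ∈ G k)
    (hL : (L ^ (j + 1)) (d a) = 0) : ∃ b ∈ G (k + 1), d (δ b) = d a := by
  obtain ⟨z, hz, hdz, x, hx, hdx⟩ := hlef.2 ((L ^ (j + 1)) a) (h.pow_mem ha rfl)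
    (by rw [h.d_pow ha, hL])
  obtain ⟨y, hy, rfl⟩ := h.surj (k := k + 1) (j := j) (c := x) (by push_cast at hk; omega)
    (by rwa [show k + 1 + 2 * (j : ℤ) = k + 2 * ((j + 1 : ℕ) : ℤ) - 1 by push_cast; ring])
  obtain ⟨y₀, hy₀, y₁, hy₁, hp, rfl⟩ :=
    h.exists_primitive_add (j := j) (by push_cast at hk; omega) hy
  have hδ := h.δ_mem hy₀
  rw [add_sub_cancel_right] at hδ
  have hdy₁ := h.d_mem hy₁
  rw [show k + 1 - 2 + 1 = k by ring] at hdy₁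
  set c : ℝ := ((j : ℝ) + 1)⁻¹ with hc
  have hc1 : c * ((j : ℝ) + 1) = 1 := inv_mul_cancel₀ (by positivity)
  have key : a - z - d y₁ + c • δ y₀ = 0 := by
    refine h.inj hk (add_mem (sub_mem (sub_mem ha hz) hdy₁) (Submodule.smul_mem _ _ hδ)) ?_
    rw [map_add, map_sub, map_sub, ← hdx, map_smul, h.pow_δ_primitive hy₀ hp, map_add, map_add,
      ← Module.End.mul_apply (L ^ j) L, ← pow_succ, h.d_pow hy₀, h.d_pow hy₁, smul_smul,
      mul_neg, hc1]
    module
  refine ⟨-c • y₀, Submodule.smul_mem _ _ hy₀, ?_⟩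
  have := congrArg d key
  rw [map_add, map_sub, map_sub, hdz, h.d_d hy₁, map_zero, sub_zero, sub_zero, map_smul] at this
  rw [map_smul, map_smul, neg_smul]
  exact (eq_neg_of_add_eq_zero_left this).symm

/-- Hard Lefschetz in degree `k` and the two identities in degree `k - 1` give
`Im d ∩ ker δ ⊆ Im dδ` in degree `k + 1`. -/
theorem gradedExactIdentity_succ (h : IsHodgeLefschetz G L d S δ n) {k : ℤ} {j : ℕ}
    (hk : k + (j + 1 : ℕ) = n) (hlef : GradedLefschetz G d L k (j + 1))
    (hE : GradedExactIdentity G d δ (k - 1)) (hC : GradedCoexactIdentity G d δ (k - 1)) :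
    GradedExactIdentity G d δ (k + 1) := by
  intro a ha hda
  rw [add_sub_cancel_right] at ha
  have hdδ : d (δ a) = 0 := by rw [h.d_δ ha, hda, neg_zero]
  obtain ⟨a₀, h₀, a₁, h₁, hp, rfl⟩ := h.exists_primitive_add hk ha
  have hd₁ : d (δ a₁) = 0 := h.dδ_primitive_eq_zero hk h₀ h₁ hp (by rw [hdδ, map_zero])
  have hd₀ : d (δ a₀) = 0 := by
    rwa [map_add, map_add, h.dδ_L h₁, hd₁, map_zero, add_zero] at hdδ
  obtain ⟨b, hb, hdb⟩ := hE a₁ (by rwa [show k - 1 - 1 = k - 2 by ring])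
    (by rw [← neg_eq_zero, ← h.d_δ h₁, hd₁])
  obtain ⟨x, hx, hdx⟩ := hC a₀ (by rwa [sub_add_cancel]) hd₀
  have hδx := h.δ_mem hx
  -- `a₀` is corrected by a multiple of `L δ x` so that its differential becomes primitive
  set c : ℝ := ((j : ℝ) + 1 + 1)⁻¹ with hc
  have hc1 : c * ((j : ℝ) + 1 + 1) = 1 := inv_mul_cancel₀ (by positivity)
  have hLδ := h.map_mem hδx
  rw [show k - 1 - 1 + 2 = k by ring] at hLδ
  have hLx := h.map_mem hx
  rw [show k - 1 + 2 = k + 1 by ring] at hLx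
  have hLb := h.map_mem hb
  rw [show k - 1 + 2 = k + 1 by ring] at hLb
  obtain ⟨y, hy, hdy⟩ := h.exists_dδ_eq_of_pow_d_eq_zero hk hlef
    (add_mem h₀ (Submodule.smul_mem _ c hLδ)) (by
      have hq := h.pow_δ_primitive h₀ hp
      rw [← hdx, pow_succ, Module.End.mul_apply] at hq
      rw [map_add, map_smul, h.d_L hδx, map_add, map_smul, hq, smul_smul]
      push_cast
      rw [mul_neg, hc1]
      module)
  refine ⟨y - c • L x + L b, add_mem (sub_mem hy (Submodule.smul_mem _ _ hLx)) hLb, ?_⟩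
  rw [map_add, map_add, map_sub, map_sub, hdy, map_smul, map_smul, h.dδ_L hx, h.dδ_L hb, hdb,
    map_add, map_add, map_smul, h.d_L hδx, h.d_L h₁]
  abel

/-- Hard Lefschetz in degree `k`, the identity `Im d ∩ ker δ ⊆ Im dδ` in degree `k` and the identity
`Im δ ∩ ker d ⊆ Im dδ` in degree `k - 2` give `Im δ ∩ ker d ⊆ Im dδ` in degree `k`. -/
theorem gradedCoexactIdentity_of_lefschetz (h : IsHodgeLefschetz G L d S δ n) {k : ℤ} {j : ℕ}
    (hk : k + (j + 1 : ℕ) = n) (hlef : GradedLefschetz G d L k (j + 1))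
    (hE : GradedExactIdentity G d δ k) (hC : GradedCoexactIdentity G d δ (k - 2)) :
    GradedCoexactIdentity G d δ k := by
  intro a ha hda
  obtain ⟨a₀, h₀, a₁, h₁, hp, rfl⟩ :=
    h.exists_primitive_add (j := j) (by push_cast at hk; omega) ha
  have hd₁ : d (δ a₁) = 0 := h.dδ_primitive_eq_zero (j := j) (by push_cast at hk; omega) h₀ h₁ hp
    (by rw [hda, map_zero])
  have hd₀ : d (δ a₀) = 0 := by
    rwa [map_add, map_add, h.dδ_L h₁, hd₁, map_zero, add_zero] at hda
  obtain ⟨x, hx, hdx⟩ := hC a₁ (by rwa [show k - 2 + 1 = k + 1 - 2 by ring]) hd₁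
  obtain ⟨y, hy, hdy⟩ := h.exists_d_eq_δ_primitive hlef h₀ hp hd₀
  have hδx := h.δ_mem hx
  have hLδ := h.map_mem hδx
  have e : δ (a₀ + L a₁) = d (y + L (δ x) + a₁) := by
    rw [map_add, map_add, map_add, hdy, h.δ_L h₁, ← hdx, h.d_L hδx]
    abel
  obtain ⟨b, hb, hdb⟩ := hE (y + L (δ x) + a₁)
    (add_mem (add_mem hy (by rwa [show k - 2 - 1 + 2 = k - 1 by ring] at hLδ))
      (by rwa [show k + 1 - 2 = k - 1 by ring] at h₁)) (by rw [← e, h.δ_δ ha])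
  exact ⟨b, hb, by rw [hdb, e]⟩

/-- The Lefschetz property up to degree `s` implies the `dδ`-lemma up to degree `s`. -/
theorem identities_of_lefschetz (h : IsHodgeLefschetz G L d S δ n) {s : ℕ} (hs : s < n)
    (hlef : ∀ k j : ℕ, k ≤ s → k + j = n → GradedLefschetz G d L k j) :
    (∀ k : ℤ, k ≤ s + 1 → GradedExactIdentity G d δ k) ∧
      ∀ k : ℤ, k ≤ s → GradedCoexactIdentity G d δ k := by
  have key : ∀ (N : ℕ) (k : ℤ), k < N → (k ≤ s + 1 → GradedExactIdentity G d δ k) ∧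
      (k ≤ s → GradedCoexactIdentity G d δ k) := by
    intro N
    induction N with
    | zero => exact fun k hk => ⟨fun _ => h.gradedExactIdentity_of_neg (by exact_mod_cast hk),
        fun _ => h.gradedCoexactIdentity_of_neg (by exact_mod_cast hk)⟩
    | succ N ih =>
      intro k hk
      rcases lt_or_ge k 0 with hk0 | hk0
      · exact ⟨fun _ => h.gradedExactIdentity_of_neg hk0,
          fun _ => h.gradedCoexactIdentity_of_neg hk0⟩
      have hE : k ≤ s + 1 → GradedExactIdentity G d δ k := by
        intro hks
        obtain ⟨i1, i2⟩ := ih (k - 2) (by push_cast at hk; omega)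
        rcases eq_or_lt_of_le hk0 with rfl | hk1
        · intro a ha _
          exact ⟨0, zero_mem _, by rw [h.eq_zero (Or.inl (by norm_num)) ha]; simp⟩
        have hl := hlef (k - 1).toNat (n - k + 1).toNat (by omega) (by omega)
        rw [show ((k - 1).toNat : ℤ) = k - 1 by omega,
          show (n - k + 1).toNat = (n - k).toNat + 1 by omega] at hl
        have := h.gradedExactIdentity_succ (k := k - 1) (by omega) hl
          (by rw [show k - 1 - 1 = k - 2 by ring]; exact i1 (by omega))
          (by rw [show k - 1 - 1 = k - 2 by ring]; exact i2 (by omega))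
        rwa [sub_add_cancel] at this
      refine ⟨hE, fun hks => ?_⟩
      have hl := hlef k.toNat (n - k).toNat (by omega) (by omega)
      rw [show (k.toNat : ℤ) = k by omega,
        show (n - k).toNat = (n - k - 1).toNat + 1 by omega] at hl
      exact h.gradedCoexactIdentity_of_lefschetz (by omega) hl (hE (by omega))
        ((ih (k - 2) (by push_cast at hk; omega)).2 (by omega))
  exact ⟨fun k => (key (k.toNat + 1) k (by push_cast; omega)).1,
    fun k => (key (k.toNat + 1) k (by push_cast; omega)).2⟩

/-- The identity `Im δ ∩ ker d ⊆ Im dδ` in degree `k` and `Im d ∩ ker δ ⊆ Im dδ` in degree `k + 1`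
imply that `L^{n-k}` is bijective on cohomology in degree `k < n`. -/
theorem lefschetz_of_identities (h : IsHodgeLefschetz G L d S δ n) {k : ℤ} {j : ℕ}
    (hk : k + (j + 1 : ℕ) = n) (hC : GradedCoexactIdentity G d δ k)
    (hE : GradedExactIdentity G d δ (k + 1)) : GradedLefschetz G d L k (j + 1) := by
  have hk' : k + 1 + (j : ℤ) = n := by push_cast at hk; omega
  refine ⟨fun a ha hda ⟨x, hx, hdx⟩ => ?_, fun c hc hdc => ?_⟩
  · obtain ⟨y, hy, rfl⟩ := h.surj (k := k + 1) (j := j) (c := x) hk'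
      (by rwa [show k + 1 + 2 * (j : ℤ) = k + 2 * ((j + 1 : ℕ) : ℤ) - 1 by push_cast; ring])
    obtain ⟨y₀, hy₀, y₁, hy₁, hp, rfl⟩ := h.exists_primitive_add hk' hy
    have hδ := h.δ_mem hy₀
    rw [add_sub_cancel_right] at hδ
    have hdy₁ := h.d_mem hy₁
    rw [show k + 1 - 2 + 1 = k by ring] at hdy₁
    have hc1 : ((j : ℝ) + 1)⁻¹ * ((j : ℝ) + 1) = 1 := inv_mul_cancel₀ (by positivity)
    have key : a - d y₁ + ((j : ℝ) + 1)⁻¹ • δ y₀ = 0 := by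
      refine h.inj hk (add_mem (sub_mem ha hdy₁) (Submodule.smul_mem _ _ hδ)) ?_
      rw [map_add, map_sub, ← hdx, map_smul, h.pow_δ_primitive hy₀ hp, map_add, map_add,
        ← Module.End.mul_apply (L ^ j) L, ← pow_succ, h.d_pow hy₀, h.d_pow hy₁, smul_smul,
        mul_neg, hc1]
      module
    have hdδ : d (δ y₀) = 0 := by
      have := congrArg d key
      rw [map_add, map_sub, hda, h.d_d hy₁, map_smul, map_zero, sub_zero, zero_add] at this
      exact (smul_eq_zero.1 this).resolve_left (by positivity)
    obtain ⟨z, hz, hdz⟩ := hC y₀ hy₀ hdδ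
    refine ⟨y₁ - ((j : ℝ) + 1)⁻¹ • δ z,
      sub_mem (by rwa [show k + 1 - 2 = k - 1 by ring] at hy₁)
        (Submodule.smul_mem _ _ (h.δ_mem hz)), ?_⟩
    rw [map_sub, map_smul, hdz]
    linear_combination (norm := module) -key
  · obtain ⟨a, ha, rfl⟩ := h.surj hk hc
    have hL : (L ^ (j + 1)) (d a) = 0 := by rw [← h.d_pow ha, hdc]
    have hδd : δ (d a) = 0 := by
      have hm := h.δ_mem (h.d_mem ha)
      rw [add_sub_cancel_right] at hm
      refine h.inj hk hm ?_
      rw [h.pow_δ_primitive (h.d_mem ha) hL, h.d_d ha, map_zero, smul_zero]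
    obtain ⟨b, hb, hdb⟩ := hE a (by rwa [add_sub_cancel_right]) hδd
    obtain ⟨b₀, hb₀, b₁, hb₁, hp, rfl⟩ := h.exists_primitive_add hk' hb
    -- `d δ b` is primitive, hence equal to `d δ b₀`
    have hd₁ : d (δ b₁) = 0 := h.dδ_primitive_eq_zero hk' hb₀ hb₁ hp (by rw [hdb, hL])
    have hd₀ : d (δ b₀) = d a := by
      rwa [map_add, map_add, h.dδ_L hb₁, hd₁, map_zero, add_zero] at hdb
    have hδ := h.δ_mem hb₀
    rw [add_sub_cancel_right] at hδ
    refine ⟨a - δ b₀, sub_mem ha hδ, by rw [map_sub, hd₀, sub_self],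
      -((j : ℝ) + 1) • (L ^ j) b₀, Submodule.smul_mem _ _ (h.pow_mem hb₀ (by push_cast; ring)), ?_⟩
    rw [map_smul, h.d_pow hb₀, ← h.pow_δ_primitive hb₀ hp, map_sub]
    abel

/-- The Hodge star exchanges the two identities of the `dδ`-lemma. -/
theorem gradedCoexactIdentity_iff (h : IsHodgeLefschetz G L d S δ n) {k l : ℤ}
    (hkl : k + l = 2 * n) : GradedCoexactIdentity G d δ l ↔ GradedExactIdentity G d δ k := by
  have hu : ∀ i : ℤ, (-1 : ℝ) ^ i ≠ 0 := fun i => zpow_ne_zero _ (by norm_num)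
  constructor
  · intro hC a ha hda
    have hS := h.star_mem (l := l + 1) ha (by omega)
    have e := h.star_d ha
    obtain ⟨b, hb, hdb⟩ := hC (S a) hS (by
      have h2 := h.star_δ (h.d_mem ha)
      rw [hda, map_zero, e, map_smul, smul_smul] at h2
      exact (smul_eq_zero.1 h2.symm).resolve_left (mul_ne_zero (hu _) (hu _)))
    have hSb := h.star_mem (l := k) hb (by omega)
    rw [← hdb] at e
    have h3 := congrArg S e
    rw [h.star_star (h.d_mem ha), map_smul, h.star_d (h.δ_mem hb), h.star_δ hb, map_smul,
      ← neg_eq_iff_eq_neg.2 (h.d_δ hSb)] at h3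
    refine ⟨-((-1 : ℝ) ^ (k - 1 + 1) * ((-1) ^ (l - 1 + 1) * (-1) ^ (l + 1))) • S b,
      Submodule.smul_mem _ _ hSb, ?_⟩
    rw [h3, map_smul, map_smul, smul_neg, smul_neg, smul_neg, smul_smul, smul_smul, neg_smul,
      mul_assoc]
  · intro hE a ha hda
    have hS := h.star_mem (l := k - 1) ha (by omega)
    have e := h.star_δ ha
    obtain ⟨b, hb, hdb⟩ := hE (S a) hS (by
      have h2 := h.star_d (h.δ_mem ha)
      rw [hda, map_zero, e, map_smul, smul_smul] at h2
      exact (smul_eq_zero.1 h2.symm).resolve_left (mul_ne_zero (hu _) (hu _)))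
    have hSb := h.star_mem (l := l) hb (by omega)
    rw [← hdb] at e
    have h3 := congrArg S e
    rw [h.star_star (h.δ_mem ha), map_smul, h.star_d (h.δ_mem hb), h.star_δ hb, map_smul,
      ← neg_eq_iff_eq_neg.2 (h.d_δ hSb)] at h3
    refine ⟨-((-1 : ℝ) ^ (l + 1 + 1) * ((-1) ^ (k - 1 + 1) * (-1) ^ (k + 1))) • S b,
      Submodule.smul_mem _ _ hSb, ?_⟩
    rw [h3, map_smul, map_smul, smul_neg, smul_neg, smul_neg, smul_smul, smul_smul, neg_smul,
      mul_assoc]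

end IsHodgeLefschetz

end DDeltaAlgebra


/-! ### The exterior product and contractions -/

section Wedge

variable {V : Type*} [AddCommGroup V] [Module ℝ V]

/-- Expansion of an alternatization along the position of the first vector. -/
theorem alternatization_cons {N : ℕ} (m : MultilinearMap ℝ (fun _ : Fin (N + 1) => V) ℝ) (X : V)
    (w : Fin N → V) :
    MultilinearMap.alternatization m (Fin.cons X w : Fin (N + 1) → V) =
      ∑ i : Fin (N + 1), (-1 : ℝ) ^ (i : ℕ) *
        MultilinearMap.alternatization (m.curryMid i X) w := by
  -- permutations of `N + 1` letters are indexed by the preimage `i` of `0` and a permutation `τ`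
  let f : Fin (N + 1) × Equiv.Perm (Fin N) → Equiv.Perm (Fin (N + 1)) := fun x =>
    Equiv.Perm.decomposeFin.symm (0, x.2) * x.1.cycleRange
  have hf0 : ∀ x, f x x.1 = 0 := fun x => by simp [f]
  have hinj : Function.Injective f := by
    rintro ⟨i, τ⟩ ⟨i', τ'⟩ h
    have h1 : i = i' := by
      have h2 := hf0 (i, τ)
      rw [h, ← hf0 (i', τ')] at h2
      exact (f (i', τ')).injective h2
    subst h1
    have h3 := mul_right_cancel h
    have h4 := Equiv.Perm.decomposeFin.symm.injective h3
    simpa using h4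
  have hbij : Function.Bijective f := by
    rw [Fintype.bijective_iff_injective_and_card]
    refine ⟨hinj, ?_⟩
    rw [Fintype.card_prod, Fintype.card_fin, Fintype.card_perm, Fintype.card_perm,
      Fintype.card_fin, Fintype.card_fin, Nat.factorial_succ]
  rw [MultilinearMap.alternatization_apply, ← hbij.sum_comp, Fintype.sum_prod_type]
  refine Finset.sum_congr rfl fun i _ => ?_
  rw [MultilinearMap.alternatization_apply, Finset.mul_sum]
  refine Finset.sum_congr rfl fun τ _ => ?_
  have hsign : Equiv.Perm.sign (f (i, τ)) = (-1) ^ (i : ℕ) * Equiv.Perm.sign τ := by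
    simp [f, mul_comm]
  have hv : (fun j => (Fin.cons X w : Fin (N + 1) → V) (f (i, τ) j)) =
      i.insertNth X (fun j => w (τ j)) := by
    funext j
    refine Fin.succAboveCases i ?_ (fun j => ?_) j
    · rw [hf0]; simp
    · simp only [f, Equiv.Perm.coe_mul, Function.comp_apply, Fin.cycleRange_succAbove,
        Equiv.Perm.decomposeFin_symm_apply_succ, Equiv.swap_self, Equiv.refl_apply, Fin.cons_succ,
        Fin.insertNth_apply_succAbove]
  simp only [MultilinearMap.domDomCongr_apply, hsign]
  rw [hv, MultilinearMap.curryMid_apply_apply]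
  simp only [Units.smul_def]
  push_cast
  simp [mul_assoc]

/-- The exterior product of a `k`-form and an `l`-form as an `N`-form, where `k + l = N`. -/
def wedgeAt {k l N : ℕ} (h : k + l = N) (a : V [⋀^Fin k]→ₗ[ℝ] ℝ) (b : V [⋀^Fin l]→ₗ[ℝ] ℝ) :
    V [⋀^Fin N]→ₗ[ℝ] ℝ :=
  (wedge a b).domDomCongr (finCongr h)

theorem wedgeAt_rfl {k l : ℕ} (a : V [⋀^Fin k]→ₗ[ℝ] ℝ) (b : V [⋀^Fin l]→ₗ[ℝ] ℝ) :
    wedgeAt rfl a b = wedge a b := by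
  ext v
  simp [wedgeAt]

/-- The multilinear map `v ↦ a (v₁, …, v_k) * b (v_{k+1}, …, v_{k+l})`. -/
def outerProduct {k l N : ℕ} (h : k + l = N) (a : V [⋀^Fin k]→ₗ[ℝ] ℝ) (b : V [⋀^Fin l]→ₗ[ℝ] ℝ) :
    MultilinearMap ℝ (fun _ : Fin N => V) ℝ :=
  ((LinearMap.mul' ℝ ℝ).compMultilinearMap
    (MultilinearMap.domCoprod a.toMultilinearMap b.toMultilinearMap)).domDomCongr
      (finSumFinEquiv.trans (finCongr h))

theorem outerProduct_apply {k l N : ℕ} (h : k + l = N) (a : V [⋀^Fin k]→ₗ[ℝ] ℝ)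
    (b : V [⋀^Fin l]→ₗ[ℝ] ℝ) (v : Fin N → V) :
    outerProduct h a b v =
      a (fun i => v (Fin.cast h (Fin.castAdd l i))) *
        b (fun i => v (Fin.cast h (Fin.natAdd k i))) := by
  simp [outerProduct]

theorem alternatization_domDomCongr {ι ι' : Type*} [Fintype ι] [DecidableEq ι] [Fintype ι']
    [DecidableEq ι'] (e : ι ≃ ι') (m : MultilinearMap ℝ (fun _ : ι => V) ℝ) :
    MultilinearMap.alternatization (m.domDomCongr e) =
      (MultilinearMap.alternatization m).domDomCongr e := by
  ext v
  rw [AlternatingMap.domDomCongr_apply, MultilinearMap.alternatization_apply,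
    MultilinearMap.alternatization_apply, ← (Equiv.permCongr e).sum_comp]
  refine Finset.sum_congr rfl fun τ _ => ?_
  rw [Equiv.Perm.sign_permCongr]
  simp [MultilinearMap.domDomCongr_apply, Equiv.permCongr_apply, Function.comp_def]

theorem alternatization_outerProduct {k l N : ℕ} (h : k + l = N) (a : V [⋀^Fin k]→ₗ[ℝ] ℝ)
    (b : V [⋀^Fin l]→ₗ[ℝ] ℝ) :
    MultilinearMap.alternatization (outerProduct h a b) =
      ((k.factorial : ℝ) * l.factorial) • wedgeAt h a b := by
  have h1 := MultilinearMap.domCoprod_alternization_eq a b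
  have h2 := congrArg (fun c : V [⋀^Fin k ⊕ Fin l]→ₗ[ℝ] (TensorProduct ℝ ℝ ℝ) =>
    ((LinearMap.mul' ℝ ℝ).compAlternatingMap c)) h1
  simp only [Fintype.card_fin] at h2
  rw [← LinearMap.compMultilinearMap_alternatization] at h2
  rw [outerProduct, alternatization_domDomCongr]
  ext v
  rw [AlternatingMap.domDomCongr_apply]
  refine (DFunLike.congr_fun h2 _).trans ?_
  simp [wedgeAt, wedge, Function.comp_def]

/-- The term `ι_X a ∧ b` of the contraction `ι_X (a ∧ b)`; it is zero if `a` has degree `0`. -/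
def wedgeLeft (X : V) : {k l N : ℕ} → k + l = N + 1 → (V [⋀^Fin k]→ₗ[ℝ] ℝ) →
    (V [⋀^Fin l]→ₗ[ℝ] ℝ) → V [⋀^Fin N]→ₗ[ℝ] ℝ
  | 0, _, _, _, _, _ => 0
  | _ + 1, _, _, h, a, b => wedgeAt (by omega) (a.curryLeft X) b

/-- The term `(-1)^k a ∧ ι_X b` of the contraction `ι_X (a ∧ b)`; it is zero if `b` has degree
`0`. -/
def wedgeRight (X : V) : {k l N : ℕ} → k + l = N + 1 → (V [⋀^Fin k]→ₗ[ℝ] ℝ) →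
    (V [⋀^Fin l]→ₗ[ℝ] ℝ) → V [⋀^Fin N]→ₗ[ℝ] ℝ
  | _, 0, _, _, _, _ => 0
  | k, _ + 1, _, h, a, b => (-1 : ℝ) ^ k • wedgeAt (by omega) a (b.curryLeft X)

theorem cons_succAbove_aux {k : ℕ} (a : V [⋀^Fin (k + 1)]→ₗ[ℝ] ℝ) (i : Fin (k + 1)) (X : V)
    (w : Fin k → V) :
    (-1 : ℝ) ^ (i : ℕ) * a (i.insertNth X w) = a.curryLeft X w := by
  have := a.neg_one_pow_smul_map_insertNth i X w
  rw [AlternatingMap.curryLeft_apply_apply, ← this]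
  simp

theorem curryMid_outerProduct_left {k l N : ℕ} (h : k + 1 + l = N + 1) (h' : k + l = N)
    (a : V [⋀^Fin (k + 1)]→ₗ[ℝ] ℝ) (b : V [⋀^Fin l]→ₗ[ℝ] ℝ) (i : Fin (k + 1)) (X : V) :
    (-1 : ℝ) ^ (i : ℕ) • (outerProduct h a b).curryMid (Fin.cast h (Fin.castAdd l i)) X =
      outerProduct h' (a.curryLeft X) b := by
  subst h'
  ext w
  rw [_root_.smul_apply, MultilinearMap.curryMid_apply_apply, outerProduct_apply,
    outerProduct_apply, ← cons_succAbove_aux a i, smul_eq_mul, mul_assoc]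
  congr 3
  · funext j
    refine Fin.succAboveCases i ?_ (fun j => ?_) j
    · simp
    · have : Fin.cast h (Fin.castAdd l (i.succAbove j)) =
          (Fin.cast h (Fin.castAdd l i)).succAbove (Fin.castAdd l j) := by
        ext
        simp only [Fin.val_cast, Fin.val_castAdd, Fin.succAbove, Fin.lt_def, Fin.val_castSucc]
        split_ifs <;> simp
      rw [this]
      simp
  · funext j
    have : Fin.cast h (Fin.natAdd (k + 1) j) =
        (Fin.cast h (Fin.castAdd l i)).succAbove (Fin.natAdd k j) := by
      ext
      have := i.2
      simp only [Fin.val_cast, Fin.val_castAdd, Fin.succAbove, Fin.lt_def, Fin.val_castSucc,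
        Fin.val_natAdd]
      split_ifs <;> simp <;> omega
    rw [this]
    simp

theorem curryMid_outerProduct_right {k l N : ℕ} (h : k + (l + 1) = N + 1) (h' : k + l = N)
    (a : V [⋀^Fin k]→ₗ[ℝ] ℝ) (b : V [⋀^Fin (l + 1)]→ₗ[ℝ] ℝ) (i : Fin (l + 1)) (X : V) :
    (-1 : ℝ) ^ (i : ℕ) • (outerProduct h a b).curryMid (Fin.cast h (Fin.natAdd k i)) X =
      outerProduct h' a (b.curryLeft X) := by
  subst h'
  ext w
  rw [_root_.smul_apply, MultilinearMap.curryMid_apply_apply, outerProduct_apply,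
    outerProduct_apply, ← cons_succAbove_aux b i, smul_eq_mul, mul_left_comm]
  congr 3
  · funext j
    have : Fin.cast h (Fin.castAdd (l + 1) j) =
        (Fin.cast h (Fin.natAdd k i)).succAbove (Fin.castAdd l j) := by
      ext
      have := j.2
      simp only [Fin.val_cast, Fin.val_castAdd, Fin.succAbove, Fin.lt_def, Fin.val_castSucc,
        Fin.val_natAdd]
      split_ifs <;> simp <;> omega
    rw [this]
    simp
  · funext j
    refine Fin.succAboveCases i ?_ (fun j => ?_) j
    · simp
    · have : Fin.cast h (Fin.natAdd k (i.succAbove j)) =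
          (Fin.cast h (Fin.natAdd k i)).succAbove (Fin.natAdd k j) := by
        ext
        simp only [Fin.val_cast, Fin.succAbove, Fin.lt_def, Fin.val_castSucc,
          Fin.val_natAdd]
        split_ifs <;> simp_all <;> omega
      rw [this]
      simp

/-- Contraction with a vector is an antiderivation of the exterior product. -/
theorem curryLeft_wedgeAt {k l N : ℕ} (h : k + l = N + 1) (a : V [⋀^Fin k]→ₗ[ℝ] ℝ)
    (b : V [⋀^Fin l]→ₗ[ℝ] ℝ) (X : V) :
    (wedgeAt h a b).curryLeft X = wedgeLeft X h a b + wedgeRight X h a b := by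
  have hfac : ((k.factorial : ℝ) * l.factorial) ≠ 0 := by positivity
  ext w
  have h1 := alternatization_cons (outerProduct h a b) X w
  rw [alternatization_outerProduct] at h1
  have h2 : ∑ i : Fin (N + 1), (-1 : ℝ) ^ (i : ℕ) *
        MultilinearMap.alternatization ((outerProduct h a b).curryMid i X) w =
      ∑ i : Fin k, (-1 : ℝ) ^ (i : ℕ) * MultilinearMap.alternatization
        ((outerProduct h a b).curryMid (Fin.cast h (Fin.castAdd l i)) X) w +
      ∑ i : Fin l, (-1 : ℝ) ^ (k + (i : ℕ)) * MultilinearMap.alternatization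
        ((outerProduct h a b).curryMid (Fin.cast h (Fin.natAdd k i)) X) w := by
    rw [← (finSumFinEquiv.trans (finCongr h)).sum_comp, Fintype.sum_sum_type]
    simp
  have hsm : ∀ (c : ℝ) (m : MultilinearMap ℝ (fun _ : Fin N => V) ℝ),
      c * MultilinearMap.alternatization m w = MultilinearMap.alternatization (c • m) w := by
    intro c m
    simp only [MultilinearMap.alternatization_apply, Finset.mul_sum]
    refine Finset.sum_congr rfl fun τ _ => ?_
    simp [Units.smul_def, mul_left_comm]
  have h3 : ∑ i : Fin k, (-1 : ℝ) ^ (i : ℕ) * MultilinearMap.alternatization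
        ((outerProduct h a b).curryMid (Fin.cast h (Fin.castAdd l i)) X) w =
      ((k.factorial : ℝ) * l.factorial) * wedgeLeft X h a b w := by
    cases k with
    | zero => simp [wedgeLeft]
    | succ k =>
      have h' : k + l = N := by omega
      have : ∀ i : Fin (k + 1), (-1 : ℝ) ^ (i : ℕ) * MultilinearMap.alternatization
          ((outerProduct h a b).curryMid (Fin.cast h (Fin.castAdd l i)) X) w =
          ((k.factorial : ℝ) * l.factorial) * wedgeAt h' (a.curryLeft X) b w := fun i => by
        rw [hsm, curryMid_outerProduct_left h h', alternatization_outerProduct]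
        rfl
      rw [Finset.sum_congr rfl fun i _ => this i]
      simp only [wedgeLeft, Finset.sum_const, Finset.card_univ, Fintype.card_fin, nsmul_eq_mul,
        Nat.factorial_succ]
      push_cast
      ring
  have h4 : ∑ i : Fin l, (-1 : ℝ) ^ (k + (i : ℕ)) * MultilinearMap.alternatization
        ((outerProduct h a b).curryMid (Fin.cast h (Fin.natAdd k i)) X) w =
      ((k.factorial : ℝ) * l.factorial) * wedgeRight X h a b w := by
    cases l with
    | zero => simp [wedgeRight]
    | succ l =>
      have h' : k + l = N := by omega
      have : ∀ i : Fin (l + 1), (-1 : ℝ) ^ (k + (i : ℕ)) * MultilinearMap.alternatization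
          ((outerProduct h a b).curryMid (Fin.cast h (Fin.natAdd k i)) X) w =
          ((k.factorial : ℝ) * l.factorial) *
            ((-1 : ℝ) ^ k * wedgeAt h' a (b.curryLeft X) w) := fun i => by
        rw [pow_add, mul_assoc, hsm, curryMid_outerProduct_right h h', alternatization_outerProduct,
          AlternatingMap.smul_apply, smul_eq_mul]
        ring
      rw [Finset.sum_congr rfl fun i _ => this i]
      simp only [wedgeRight, Finset.sum_const, Finset.card_univ, Fintype.card_fin, nsmul_eq_mul,
        Nat.factorial_succ, AlternatingMap.smul_apply, smul_eq_mul]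
      push_cast
      ring
  rw [h2, h3, h4, ← mul_add] at h1
  exact mul_left_cancel₀ hfac h1

end Wedge


section WedgeAlgebra

variable {V W : Type*} [AddCommGroup V] [Module ℝ V] [AddCommGroup W] [Module ℝ W]

theorem wedgeAt_apply {k l N : ℕ} (h : k + l = N) (a : V [⋀^Fin k]→ₗ[ℝ] ℝ)
    (b : V [⋀^Fin l]→ₗ[ℝ] ℝ) (v : Fin N → V) :
    wedgeAt h a b v = ((k.factorial : ℝ) * l.factorial)⁻¹ *
      MultilinearMap.alternatization (outerProduct h a b) v := by
  rw [alternatization_outerProduct, AlternatingMap.smul_apply, smul_eq_mul, ← mul_assoc,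
    inv_mul_cancel₀ (by positivity), one_mul]

theorem wedgeAt_add_left {k l N : ℕ} (h : k + l = N) (a a' : V [⋀^Fin k]→ₗ[ℝ] ℝ)
    (b : V [⋀^Fin l]→ₗ[ℝ] ℝ) : wedgeAt h (a + a') b = wedgeAt h a b + wedgeAt h a' b := by
  ext v
  simp only [AlternatingMap.add_apply, wedgeAt_apply, MultilinearMap.alternatization_apply,
    MultilinearMap.domDomCongr_apply, outerProduct_apply, add_mul, smul_add,
    Finset.sum_add_distrib, mul_add]

theorem wedgeAt_add_right {k l N : ℕ} (h : k + l = N) (a : V [⋀^Fin k]→ₗ[ℝ] ℝ)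
    (b b' : V [⋀^Fin l]→ₗ[ℝ] ℝ) : wedgeAt h a (b + b') = wedgeAt h a b + wedgeAt h a b' := by
  ext v
  simp only [AlternatingMap.add_apply, wedgeAt_apply, MultilinearMap.alternatization_apply,
    MultilinearMap.domDomCongr_apply, outerProduct_apply, mul_add, smul_add,
    Finset.sum_add_distrib]

theorem wedgeAt_smul_left {k l N : ℕ} (h : k + l = N) (c : ℝ) (a : V [⋀^Fin k]→ₗ[ℝ] ℝ)
    (b : V [⋀^Fin l]→ₗ[ℝ] ℝ) : wedgeAt h (c • a) b = c • wedgeAt h a b := by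
  ext v
  simp only [AlternatingMap.smul_apply, wedgeAt_apply, MultilinearMap.alternatization_apply,
    MultilinearMap.domDomCongr_apply, outerProduct_apply, smul_eq_mul, Finset.mul_sum,
    Units.smul_def, zsmul_eq_mul]
  exact Finset.sum_congr rfl fun _ _ => by ring

theorem wedgeAt_smul_right {k l N : ℕ} (h : k + l = N) (c : ℝ) (a : V [⋀^Fin k]→ₗ[ℝ] ℝ)
    (b : V [⋀^Fin l]→ₗ[ℝ] ℝ) : wedgeAt h a (c • b) = c • wedgeAt h a b := by
  ext v
  simp only [AlternatingMap.smul_apply, wedgeAt_apply, MultilinearMap.alternatization_apply,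
    MultilinearMap.domDomCongr_apply, outerProduct_apply, smul_eq_mul, Finset.mul_sum,
    Units.smul_def, zsmul_eq_mul]
  exact Finset.sum_congr rfl fun _ _ => by ring

theorem wedgeAt_compLinearMap {k l N : ℕ} (h : k + l = N) (a : V [⋀^Fin k]→ₗ[ℝ] ℝ)
    (b : V [⋀^Fin l]→ₗ[ℝ] ℝ) (f : W →ₗ[ℝ] V) :
    (wedgeAt h a b).compLinearMap f = wedgeAt h (a.compLinearMap f) (b.compLinearMap f) := by
  ext v
  simp only [AlternatingMap.compLinearMap_apply, wedgeAt_apply,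
    MultilinearMap.alternatization_apply, MultilinearMap.domDomCongr_apply, outerProduct_apply]

/-- The exterior product as a bilinear map. -/
def wedgeAtₗ {k l N : ℕ} (h : k + l = N) :
    (V [⋀^Fin k]→ₗ[ℝ] ℝ) →ₗ[ℝ] (V [⋀^Fin l]→ₗ[ℝ] ℝ) →ₗ[ℝ] V [⋀^Fin N]→ₗ[ℝ] ℝ :=
  LinearMap.mk₂ ℝ (wedgeAt h) (wedgeAt_add_left h) (wedgeAt_smul_left h)
    (wedgeAt_add_right h) (fun c a b => wedgeAt_smul_right h c a b)

theorem wedge_compLinearMap {k l : ℕ} (a : V [⋀^Fin k]→ₗ[ℝ] ℝ) (b : V [⋀^Fin l]→ₗ[ℝ] ℝ)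
    (f : W →ₗ[ℝ] V) :
    (wedge a b).compLinearMap f = wedge (a.compLinearMap f) (b.compLinearMap f) := by
  rw [← wedgeAt_rfl, wedgeAt_compLinearMap, wedgeAt_rfl]

theorem ext_curryLeft {k : ℕ} {a b : V [⋀^Fin (k + 1)]→ₗ[ℝ] ℝ}
    (h : ∀ X, a.curryLeft X = b.curryLeft X) : a = b := by
  ext v
  have := DFunLike.congr_fun (h (v 0)) (Fin.tail v)
  simp only [AlternatingMap.curryLeft_apply_apply, Matrix.vecCons] at this
  rwa [Fin.cons_self_tail] at this

theorem wedgeAt_zeroForm_right {k N : ℕ} (h : k + 0 = N) (a : V [⋀^Fin k]→ₗ[ℝ] ℝ)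
    (b : V [⋀^Fin 0]→ₗ[ℝ] ℝ) :
    wedgeAt h a b = (b ![]) • a.domDomCongr (finCongr (by omega)) := by
  subst h
  have h1 := alternatization_outerProduct (rfl : k + 0 = k + 0) a b
  have h2 : outerProduct (rfl : k + 0 = k + 0) a b = (b ![] • a).toMultilinearMap := by
    ext v
    rw [outerProduct_apply]
    simp [mul_comm, Subsingleton.elim _ ![]]
  rw [h2] at h1
  have h3 := AlternatingMap.coe_alternatization (b ![] • a)
  ext v
  have h4 := DFunLike.congr_fun (h1.symm.trans h3) v
  simp only [AlternatingMap.smul_apply, Fintype.card_fin, Nat.factorial_zero, Nat.cast_one,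
    mul_one, smul_eq_mul, nsmul_eq_mul] at h4 ⊢
  exact mul_left_cancel₀ (by positivity) h4

theorem wedgeAt_zeroForm_left {l N : ℕ} (h : 0 + l = N) (a : V [⋀^Fin 0]→ₗ[ℝ] ℝ)
    (b : V [⋀^Fin l]→ₗ[ℝ] ℝ) :
    wedgeAt h a b = (a ![]) • b.domDomCongr (finCongr (by omega)) := by
  obtain rfl : l = N := by omega
  have h1 := alternatization_outerProduct h a b
  have h2 : outerProduct h a b = (a ![] • b).toMultilinearMap := by
    ext v
    rw [outerProduct_apply]
    have : (fun i => v (Fin.cast h (Fin.natAdd 0 i))) = v := by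
      funext i
      congr 1
      ext
      simp
    rw [this, Subsingleton.elim (fun i => v (Fin.cast h (Fin.castAdd l i))) ![]]
    rfl
  rw [h2] at h1
  have h3 := AlternatingMap.coe_alternatization (a ![] • b)
  ext v
  have h4 := DFunLike.congr_fun (h1.symm.trans h3) v
  simp only [AlternatingMap.smul_apply, Fintype.card_fin, Nat.factorial_zero, Nat.cast_one,
    one_mul, smul_eq_mul, nsmul_eq_mul] at h4 ⊢
  exact mul_left_cancel₀ (by positivity) h4

/-- Contraction with `X` of each value of a linear family of forms. -/
def curryLeftFamily {k : ℕ} (f : V →ₗ[ℝ] V [⋀^Fin (k + 1)]→ₗ[ℝ] ℝ) (X : V) :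
    V →ₗ[ℝ] V [⋀^Fin k]→ₗ[ℝ] ℝ where
  toFun Y := (f Y).curryLeft X
  map_add' Y Z := by simp
  map_smul' c Y := by simp

theorem curryLeft_alternatizeUncurryFin {k : ℕ} (f : V →ₗ[ℝ] V [⋀^Fin (k + 1)]→ₗ[ℝ] ℝ) (X : V) :
    (AlternatingMap.alternatizeUncurryFin f).curryLeft X =
      f X - AlternatingMap.alternatizeUncurryFin (curryLeftFamily f X) := by
  ext v
  rw [AlternatingMap.curryLeft_apply_apply, AlternatingMap.alternatizeUncurryFin_apply,
    Fin.sum_univ_succ, AlternatingMap.sub_apply, AlternatingMap.alternatizeUncurryFin_apply,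
    sub_eq_add_neg, ← Finset.sum_neg_distrib]
  congr 1
  · simp [Matrix.vecCons]
  · refine Finset.sum_congr rfl fun i _ => ?_
    have : i.succ.removeNth (Matrix.vecCons X v) = Matrix.vecCons X (i.removeNth v) := by
      funext j
      refine Fin.cases ?_ (fun j => ?_) j
      · simp [Fin.removeNth]
      · simp [Fin.removeNth]
    rw [this]
    simp [curryLeftFamily, pow_succ]

theorem curryLeft_alternatizeUncurryFin_zero (f : V →ₗ[ℝ] V [⋀^Fin 0]→ₗ[ℝ] ℝ) (X : V) :
    (AlternatingMap.alternatizeUncurryFin f).curryLeft X = f X := by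
  ext v
  rw [AlternatingMap.curryLeft_apply_apply, AlternatingMap.alternatizeUncurryFin_apply]
  simp [Matrix.vecCons]

/-- The exterior product `θ ∧ a` with a one-form on the left. -/
def extMul (θ : Module.Dual ℝ V) {k : ℕ} (a : V [⋀^Fin k]→ₗ[ℝ] ℝ) : V [⋀^Fin (k + 1)]→ₗ[ℝ] ℝ :=
  AlternatingMap.alternatizeUncurryFin (θ.smulRight a)

theorem extMul_add (θ : Module.Dual ℝ V) {k : ℕ} (a b : V [⋀^Fin k]→ₗ[ℝ] ℝ) :
    extMul θ (a + b) = extMul θ a + extMul θ b := by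
  rw [extMul, extMul, extMul, ← AlternatingMap.alternatizeUncurryFin_add]
  congr 1
  ext X : 1
  simp

theorem extMul_smul (θ : Module.Dual ℝ V) {k : ℕ} (c : ℝ) (a : V [⋀^Fin k]→ₗ[ℝ] ℝ) :
    extMul θ (c • a) = c • extMul θ a := by
  rw [extMul, extMul, ← AlternatingMap.alternatizeUncurryFin_smul]
  congr 1
  ext X : 1
  simp [smul_comm c]

theorem curryLeft_extMul (θ : Module.Dual ℝ V) {k : ℕ} (a : V [⋀^Fin (k + 1)]→ₗ[ℝ] ℝ) (X : V) :
    (extMul θ a).curryLeft X = θ X • a - extMul θ (a.curryLeft X) := by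
  rw [extMul, curryLeft_alternatizeUncurryFin]
  congr 2

theorem curryLeft_extMul_zero (θ : Module.Dual ℝ V) (a : V [⋀^Fin 0]→ₗ[ℝ] ℝ) (X : V) :
    (extMul θ a).curryLeft X = θ X • a := by
  rw [extMul, curryLeft_alternatizeUncurryFin_zero]
  rfl

theorem wedgeAt_oneForm {k N : ℕ} (h : k + 1 = N) (a : V [⋀^Fin k]→ₗ[ℝ] ℝ)
    (η : V [⋀^Fin 1]→ₗ[ℝ] ℝ) :
    wedgeAt h a η = (-1 : ℝ) ^ k •
      (extMul ((AlternatingMap.ofSubsingleton ℝ V ℝ (0 : Fin 1)).symm η) a).domDomCongr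
        (finCongr h) := by
  subst h
  have hη : ∀ X, η.curryLeft X ![] =
      (AlternatingMap.ofSubsingleton ℝ V ℝ (0 : Fin 1)).symm η X := fun X => by
    change η (Matrix.vecCons X ![]) = η fun _ => X
    congr 1
    funext i
    rw [Subsingleton.elim i 0]
    rfl
  change wedgeAt _ a η = (-1 : ℝ) ^ k • extMul _ a
  induction k with
  | zero =>
    refine ext_curryLeft fun X => ?_
    rw [curryLeft_wedgeAt, AlternatingMap.curryLeft_smul, LinearMap.smul_apply,
      curryLeft_extMul_zero]
    simp only [wedgeLeft, wedgeRight, wedgeAt_zeroForm_right, hη]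
    simp
  | succ k ih =>
    refine ext_curryLeft fun X => ?_
    rw [curryLeft_wedgeAt, AlternatingMap.curryLeft_smul, LinearMap.smul_apply, curryLeft_extMul]
    simp only [wedgeLeft, wedgeRight, wedgeAt_zeroForm_right, hη, ih]
    rw [show (AlternatingMap.domDomCongr (finCongr (by omega : k + 1 = k + 1)) a) = a from rfl,
      pow_succ]
    module

theorem curryLeft_wedge_two (σ : V [⋀^Fin 2]→ₗ[ℝ] ℝ) {k : ℕ} (a : V [⋀^Fin (k + 1)]→ₗ[ℝ] ℝ)
    (X : V) :
    (wedge a σ).curryLeft X = wedge (a.curryLeft X) σ + extMul (flat σ X) a := by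
  have h := curryLeft_wedgeAt (l := 2) (N := k + 2) (by omega) a σ X
  simp only [wedgeLeft, wedgeRight, wedgeAt_oneForm, smul_smul, ← mul_pow] at h
  rw [neg_one_mul, neg_neg, one_pow, one_smul] at h
  exact h

theorem curryLeft_wedge_two_zero (σ : V [⋀^Fin 2]→ₗ[ℝ] ℝ) (a : V [⋀^Fin 0]→ₗ[ℝ] ℝ) (X : V) :
    AlternatingMap.curryLeft (n := 1) (wedge a σ) X = extMul (flat σ X) a := by
  have h := curryLeft_wedgeAt (l := 2) (N := 1) (by omega) a σ X
  simp only [wedgeLeft, wedgeRight, wedgeAt_oneForm, smul_smul, ← mul_pow] at h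
  rw [neg_one_mul, neg_neg, one_pow, one_smul] at h
  exact h.trans (zero_add _)

/-- A one-form can be moved from the left factor of an exterior product to the right factor. -/
theorem wedgeAt_extMul_left (θ : Module.Dual ℝ V) {k l N : ℕ} (h : k + 1 + l = N)
    (h' : k + (l + 1) = N) (a : V [⋀^Fin k]→ₗ[ℝ] ℝ) (b : V [⋀^Fin l]→ₗ[ℝ] ℝ) :
    wedgeAt h (extMul θ a) b = (-1 : ℝ) ^ k • wedgeAt h' a (extMul θ b) := by
  induction N generalizing k l with
  | zero => omega
  | succ N ih =>
    refine ext_curryLeft fun X => ?_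
    rw [AlternatingMap.curryLeft_smul, LinearMap.smul_apply, curryLeft_wedgeAt, curryLeft_wedgeAt]
    -- the two terms of the contraction that differentiate `a` and `b`
    have hl : wedgeLeft X h (extMul θ a) b = θ X • wedgeAt (by omega) a b +
        (-1 : ℝ) ^ k • wedgeLeft X h' a (extMul θ b) := by
      cases k with
      | zero =>
        simp only [wedgeLeft, curryLeft_extMul_zero, wedgeAt_smul_left, smul_zero, add_zero]
      | succ k =>
        simp only [wedgeLeft, curryLeft_extMul, sub_eq_add_neg, ← neg_one_smul ℝ (extMul θ _),
          wedgeAt_add_left, wedgeAt_smul_left]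
        rw [ih (by omega) (by omega), smul_smul, pow_succ, mul_comm]
    have hr : wedgeRight X h (extMul θ a) b + θ X • wedgeAt (by omega) a b =
        (-1 : ℝ) ^ k • wedgeRight X h' a (extMul θ b) := by
      have hk : (-1 : ℝ) ^ k * (-1) ^ k = 1 := by rw [← mul_pow]; norm_num
      cases l with
      | zero =>
        simp only [wedgeRight, curryLeft_extMul_zero, wedgeAt_smul_right, zero_add, smul_smul,
          hk, one_mul, ← mul_assoc]
      | succ l =>
        simp only [wedgeRight, curryLeft_extMul, sub_eq_add_neg, ← neg_one_smul ℝ (extMul θ _),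
          wedgeAt_add_right, wedgeAt_smul_right]
        rw [ih (by omega) (by omega), smul_add, smul_add, smul_smul, smul_smul, smul_smul, hk,
          one_mul, add_comm]
        congr 1
        rw [smul_smul, smul_smul, pow_succ]
        congr 1
        ring
    rw [hl, smul_add, ← hr]
    abel

end WedgeAlgebra

/-! ### The total space of forms -/

section Graded

variable {B : ℕ → Type*} [∀ k, AddCommGroup (B k)] [∀ k, Module ℝ (B k)]

/-- The homogeneous elements of degree `k` of a product `Π k, B k`; it is zero for `k < 0`. -/
def gradedPart (B : ℕ → Type*) [∀ k, AddCommGroup (B k)] [∀ k, Module ℝ (B k)] (k : ℤ) :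
    Submodule ℝ (∀ k, B k) where
  carrier := {a | ∀ j : ℕ, (j : ℤ) ≠ k → a j = 0}
  zero_mem' _ _ := rfl
  add_mem' ha hb j hj := by simp [ha j hj, hb j hj]
  smul_mem' c a ha j hj := by simp [ha j hj]

theorem single_mem_gradedPart {k : ℕ} {l : ℤ} (h : l = k) (b : B k) :
    Pi.single k b ∈ gradedPart B l := fun j hj => by
  subst h
  exact Pi.single_eq_of_ne (by exact_mod_cast hj) b

theorem eq_single_of_mem_gradedPart {k : ℕ} {a : ∀ k, B k} (ha : a ∈ gradedPart B k) :
    a = Pi.single k (a k) := by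
  funext j
  by_cases hj : j = k
  · subst hj; simp
  · rw [ha j (by exact_mod_cast hj), Pi.single_eq_of_ne hj]

theorem eq_zero_of_mem_gradedPart {k : ℤ} {a : ∀ k, B k} (ha : a ∈ gradedPart B k)
    (h : ∀ j : ℕ, (j : ℤ) = k → a j = 0) : a = 0 := by
  funext j
  by_cases hj : (j : ℤ) = k
  · exact h j hj
  · exact ha j hj

end Graded

section TotalForms

variable {V : Type*} [AddCommGroup V] [Module ℝ V]

variable (V) in
/-- The space of all families of alternating forms, one in each degree. -/
abbrev TotalForms : Type _ := ∀ k : ℕ, V [⋀^Fin k]→ₗ[ℝ] ℝ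

theorem wedge_add_left {k l : ℕ} (a a' : V [⋀^Fin k]→ₗ[ℝ] ℝ) (b : V [⋀^Fin l]→ₗ[ℝ] ℝ) :
    wedge (a + a') b = wedge a b + wedge a' b := by
  simp only [← wedgeAt_rfl, wedgeAt_add_left]

theorem wedge_smul_left {k l : ℕ} (c : ℝ) (a : V [⋀^Fin k]→ₗ[ℝ] ℝ) (b : V [⋀^Fin l]→ₗ[ℝ] ℝ) :
    wedge (c • a) b = c • wedge a b := by
  simp only [← wedgeAt_rfl, wedgeAt_smul_left]

/-- The Lefschetz operator `a ↦ a ∧ σ` on forms of all degrees. -/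
def lefschetzOp (σ : V [⋀^Fin 2]→ₗ[ℝ] ℝ) : Module.End ℝ (TotalForms V) where
  toFun a
    | 0 => 0
    | 1 => 0
    | k + 2 => wedge (a k) σ
  map_add' a b := by
    funext k
    match k with
    | 0 => simp
    | 1 => simp
    | k + 2 => exact wedge_add_left _ _ _
  map_smul' c a := by
    funext k
    match k with
    | 0 => simp
    | 1 => simp
    | k + 2 => exact wedge_smul_left _ _ _

/-- Contraction with a vector, on forms of all degrees. -/
def contractOp (X : V) : Module.End ℝ (TotalForms V) where
  toFun a k := (a (k + 1)).curryLeft X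
  map_add' _ _ := rfl
  map_smul' _ _ := rfl

/-- Exterior multiplication by a one-form, on forms of all degrees. -/
def extMulOp (θ : Module.Dual ℝ V) : Module.End ℝ (TotalForms V) where
  toFun a
    | 0 => 0
    | k + 1 => extMul θ (a k)
  map_add' a b := by
    funext k
    match k with
    | 0 => simp
    | k + 1 => exact extMul_add _ _ _
  map_smul' c a := by
    funext k
    match k with
    | 0 => simp
    | k + 1 => exact extMul_smul _ _ _

theorem contractOp_extMulOp (X : V) (θ : Module.Dual ℝ V) (a : TotalForms V) :
    contractOp X (extMulOp θ a) = θ X • a - extMulOp θ (contractOp X a) := by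
  funext k
  match k with
  | 0 =>
    have h : (θ X • a - extMulOp θ (contractOp X a)) 0 = θ X • a 0 := sub_zero _
    exact (curryLeft_extMul_zero θ (a 0) X).trans h.symm
  | k + 1 => exact curryLeft_extMul θ (a (k + 1)) X

theorem contractOp_lefschetzOp (X : V) (σ : V [⋀^Fin 2]→ₗ[ℝ] ℝ) (a : TotalForms V) :
    contractOp X (lefschetzOp σ a) = lefschetzOp σ (contractOp X a) + extMulOp (flat σ X) a := by
  funext k
  match k with
  | 0 => exact (add_zero (0 : V [⋀^Fin 0]→ₗ[ℝ] ℝ)).symm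
  | 1 => exact (curryLeft_wedge_two_zero σ (a 0) X).trans (zero_add _).symm
  | k + 2 => exact curryLeft_wedge_two σ (a (k + 1)) X

/-- A form of positive degree all of whose contractions vanish is zero. -/
theorem eq_zero_of_contractOp {a : TotalForms V} (h0 : a 0 = 0) (h : ∀ X, contractOp X a = 0) :
    a = 0 := by
  funext k
  match k with
  | 0 => exact h0
  | k + 1 => exact ext_curryLeft fun X => congrFun (h X) k

theorem contractOp_apply_injective {a b : TotalForms V} (h0 : a 0 = b 0)
    (h : ∀ X, contractOp X a = contractOp X b) : a = b := by
  rw [← sub_eq_zero]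
  exact eq_zero_of_contractOp (by simp [h0]) fun X => by rw [map_sub, h X, sub_self]

theorem extMulOp_anticomm (θ η : Module.Dual ℝ V) (a : TotalForms V) :
    extMulOp θ (extMulOp η a) = -extMulOp η (extMulOp θ a) := by
  have key : ∀ (k : ℕ) (a : TotalForms V),
      (extMulOp θ (extMulOp η a) + extMulOp η (extMulOp θ a)) k = 0 := by
    intro k
    induction k with
    | zero => intro a; simp [extMulOp]
    | succ k ih =>
      intro a
      refine ext_curryLeft fun X => ?_
      have h1 : contractOp X (extMulOp θ (extMulOp η a) + extMulOp η (extMulOp θ a)) =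
          extMulOp θ (extMulOp η (contractOp X a)) + extMulOp η (extMulOp θ (contractOp X a)) := by
        simp only [map_add, contractOp_extMulOp, map_sub, map_smul]
        abel
      exact (congrFun h1 k).trans (ih _)
  exact eq_neg_of_add_eq_zero_left (funext fun k => key k a)

theorem lefschetzOp_extMulOp (σ : V [⋀^Fin 2]→ₗ[ℝ] ℝ) (θ : Module.Dual ℝ V) (a : TotalForms V) :
    lefschetzOp σ (extMulOp θ a) = extMulOp θ (lefschetzOp σ a) := by
  have key : ∀ (k : ℕ) (a : TotalForms V),
      (lefschetzOp σ (extMulOp θ a) - extMulOp θ (lefschetzOp σ a)) k = 0 := by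
    intro k
    induction k with
    | zero => intro a; simp [extMulOp, lefschetzOp]
    | succ k ih =>
      intro a
      refine ext_curryLeft fun X => ?_
      have h1 : contractOp X (lefschetzOp σ (extMulOp θ a) - extMulOp θ (lefschetzOp σ a)) =
          -(lefschetzOp σ (extMulOp θ (contractOp X a)) -
            extMulOp θ (lefschetzOp σ (contractOp X a))) := by
        simp only [map_sub, contractOp_extMulOp, contractOp_lefschetzOp, map_smul, map_add,
          extMulOp_anticomm θ (flat σ X)]
        abel
      have h2 := congrFun h1 k
      rw [Pi.neg_apply, ih, neg_zero] at h2
      exact h2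
  exact sub_eq_zero.1 (funext fun k => key k a)

theorem lefschetzOp_pow_extMulOp (σ : V [⋀^Fin 2]→ₗ[ℝ] ℝ) (θ : Module.Dual ℝ V)
    (a : TotalForms V) (j : ℕ) :
    (lefschetzOp σ ^ j) (extMulOp θ a) = extMulOp θ ((lefschetzOp σ ^ j) a) := by
  induction j with
  | zero => simp
  | succ j ih =>
    rw [pow_succ', Module.End.mul_apply, ih, lefschetzOp_extMulOp, Module.End.mul_apply]

theorem contractOp_lefschetzOp_pow (X : V) (σ : V [⋀^Fin 2]→ₗ[ℝ] ℝ) (a : TotalForms V) (j : ℕ) :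
    contractOp X ((lefschetzOp σ ^ j) a) = (lefschetzOp σ ^ j) (contractOp X a) +
      (j : ℝ) • extMulOp (flat σ X) ((lefschetzOp σ ^ (j - 1)) a) := by
  induction j with
  | zero => simp
  | succ j ih =>
    rw [pow_succ', Module.End.mul_apply, contractOp_lefschetzOp, ih, map_add, map_smul,
      Module.End.mul_apply, lefschetzOp_extMulOp, Nat.add_sub_cancel]
    cases j with
    | zero => simp
    | succ j =>
      rw [Nat.add_sub_cancel, ← Module.End.mul_apply (lefschetzOp σ) (lefschetzOp σ ^ j),
        ← pow_succ']
      push_cast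
      module

theorem contractOp_mem {X : V} {k : ℤ} {a : TotalForms V}
    (ha : a ∈ gradedPart (fun k => V [⋀^Fin k]→ₗ[ℝ] ℝ) k) :
    contractOp X a ∈ gradedPart (fun k => V [⋀^Fin k]→ₗ[ℝ] ℝ) (k - 1) := fun j hj => by
  change (a (j + 1)).curryLeft X = 0
  rw [ha (j + 1) (by push_cast; omega)]
  rfl

theorem extMulOp_mem {θ : Module.Dual ℝ V} {k : ℤ} {a : TotalForms V}
    (ha : a ∈ gradedPart (fun k => V [⋀^Fin k]→ₗ[ℝ] ℝ) k) :
    extMulOp θ a ∈ gradedPart (fun k => V [⋀^Fin k]→ₗ[ℝ] ℝ) (k + 1) := fun j hj => by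
  match j with
  | 0 => rfl
  | j + 1 =>
    change extMul θ (a j) = 0
    rw [ha j (by push_cast at hj; omega)]
    simpa using extMul_smul θ (0 : ℝ) (0 : V [⋀^Fin j]→ₗ[ℝ] ℝ)

theorem lefschetzOp_mem {σ : V [⋀^Fin 2]→ₗ[ℝ] ℝ} {k : ℤ} {a : TotalForms V}
    (ha : a ∈ gradedPart (fun k => V [⋀^Fin k]→ₗ[ℝ] ℝ) k) :
    lefschetzOp σ a ∈ gradedPart (fun k => V [⋀^Fin k]→ₗ[ℝ] ℝ) (k + 2) := fun j hj => by
  match j with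
  | 0 => rfl
  | 1 => rfl
  | j + 2 =>
    change wedge (a j) σ = 0
    rw [ha j (by push_cast at hj; omega)]
    simpa using wedge_smul_left (0 : ℝ) (0 : V [⋀^Fin j]→ₗ[ℝ] ℝ) σ

theorem lefschetzOp_pow_single (σ : V [⋀^Fin 2]→ₗ[ℝ] ℝ) {k : ℕ} (a : V [⋀^Fin k]→ₗ[ℝ] ℝ)
    (j : ℕ) : (lefschetzOp σ ^ j) (Pi.single k a) = Pi.single (k + 2 * j) (lefschetz σ a j) := by
  induction j with
  | zero => rfl
  | succ j ih =>
    rw [pow_succ', Module.End.mul_apply, ih]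
    have hm := lefschetzOp_mem (σ := σ) (single_mem_gradedPart (l := (k + 2 * j : ℕ)) rfl
      (lefschetz σ a j))
    rw [show (((k + 2 * j : ℕ) : ℤ) + 2) = ((k + 2 * (j + 1) : ℕ) : ℤ) by push_cast; ring] at hm
    rw [eq_single_of_mem_gradedPart hm]
    congr 1
    change wedge (Pi.single (M := fun k => V [⋀^Fin k]→ₗ[ℝ] ℝ) (k + 2 * j) (lefschetz σ a j)
      (k + 2 * j)) σ = _
    rw [Pi.single_eq_same]
    rfl

end TotalForms


/-! ### Linear algebra of a symplectic vector space -/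

section Symplectic

variable {V : Type*} [AddCommGroup V] [Module ℝ V]

variable (V) in
/-- The forms of degree `k` in the total space of forms. -/
abbrev formsOfDegree (k : ℤ) : Submodule ℝ (TotalForms V) :=
  gradedPart (fun k => V [⋀^Fin k]→ₗ[ℝ] ℝ) k

theorem contractOp_anticomm (X Y : V) (a : TotalForms V) :
    contractOp X (contractOp Y a) = -contractOp Y (contractOp X a) := by
  funext k
  have h := AlternatingMap.curryLeft_same (a (k + 2)) (X + Y)
  simp only [map_add, AlternatingMap.curryLeft_add, LinearMap.add_apply] at h
  have hX := AlternatingMap.curryLeft_same (a (k + 2)) X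
  have hY := AlternatingMap.curryLeft_same (a (k + 2)) Y
  refine eq_neg_of_add_eq_zero_left ?_
  change ((a (k + 2)).curryLeft Y).curryLeft X + ((a (k + 2)).curryLeft X).curryLeft Y = 0
  rw [hX, hY, zero_add, add_zero] at h
  rw [← h, add_comm]

theorem sum_smul_contractOp {ι : Type*} [Fintype ι] (b : Module.Basis ι ℝ V) (X : V)
    (a : TotalForms V) : ∑ i, b.coord i X • contractOp (b i) a = contractOp X a := by
  funext k
  rw [Finset.sum_apply]
  change ∑ i, b.coord i X • (a (k + 1)).curryLeft (b i) = (a (k + 1)).curryLeft X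
  conv_rhs => rw [← b.sum_repr X, map_sum]
  simp

/-- Euler's formula: `∑ e^i ∧ ι_{e_i} a = k a` for forms `a` of degree `k`. -/
theorem sum_extMulOp_contractOp {ι : Type*} [Fintype ι] (b : Module.Basis ι ℝ V) (k : ℕ)
    {a : TotalForms V} (ha : a ∈ formsOfDegree V k) :
    ∑ i, extMulOp (b.coord i) (contractOp (b i) a) = (k : ℝ) • a := by
  induction k generalizing a with
  | zero =>
    have h0 : ∀ X, contractOp X a = 0 := fun X => eq_zero_of_mem_gradedPart (contractOp_mem ha)
      (fun j hj => by omega)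
    simp [h0]
  | succ k ih =>
    refine contractOp_apply_injective ?_ fun X => ?_
    · have h0 : a 0 = 0 := ha 0 (by omega)
      rw [Finset.sum_apply, Pi.smul_apply, h0, smul_zero]
      exact Finset.sum_eq_zero fun _ _ => rfl
    · have hX := ih (a := contractOp X a) (by
        have := contractOp_mem (X := X) ha
        rwa [show (((k + 1 : ℕ) : ℤ) - 1) = k by push_cast; ring] at this)
      rw [map_sum, map_smul]
      simp only [contractOp_extMulOp, contractOp_anticomm X (b _), map_neg, sub_neg_eq_add,
        Finset.sum_add_distrib, sum_smul_contractOp, hX]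
      push_cast
      module

/-- A form of degree less than the dimension is determined by its products with one-forms. -/
theorem eq_zero_of_extMulOp [FiniteDimensional ℝ V] {k : ℕ} (hk : k < Module.finrank ℝ V)
    {a : TotalForms V} (ha : a ∈ formsOfDegree V k) (h : ∀ θ, extMulOp θ a = 0) : a = 0 := by
  have h1 := sum_extMulOp_contractOp (Module.finBasis ℝ V) k ha
  have h2 : ∀ i, extMulOp ((Module.finBasis ℝ V).coord i) (contractOp (Module.finBasis ℝ V i) a) =
      a := fun i => by
    have := contractOp_extMulOp (Module.finBasis ℝ V i) ((Module.finBasis ℝ V).coord i) a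
    rw [h, map_zero] at this
    rw [← sub_eq_zero.1 this.symm]
    simp
  simp only [h2, Finset.sum_const, Finset.card_univ, Fintype.card_fin] at h1
  rw [← Nat.cast_smul_eq_nsmul ℝ, ← sub_eq_zero, ← sub_smul] at h1
  refine (smul_eq_zero.1 h1).resolve_left ?_
  exact sub_ne_zero.2 (by exact_mod_cast hk.ne')

instance finite_alternatingMap [FiniteDimensional ℝ V] (k : ℕ) :
    Module.Finite ℝ (V [⋀^Fin k]→ₗ[ℝ] ℝ) :=
  Module.Finite.equiv (exteriorPower.alternatingMapLinearEquiv (R := ℝ) (M := V) (N := ℝ)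
    (n := k)).symm

theorem finrank_alternatingMap [FiniteDimensional ℝ V] (k : ℕ) :
    Module.finrank ℝ (V [⋀^Fin k]→ₗ[ℝ] ℝ) = (Module.finrank ℝ V).choose k := by
  rw [(exteriorPower.alternatingMapLinearEquiv (R := ℝ) (M := V) (N := ℝ) (n := k)).finrank_eq]
  exact (Subspace.dual_finrank_eq (K := ℝ) (V := ⋀[ℝ]^k V)).trans (exteriorPower.finrank_eq ..)

theorem alternatingMap_eq_zero_of_finrank_lt [FiniteDimensional ℝ V] {k : ℕ}
    (h : Module.finrank ℝ V < k) (a : V [⋀^Fin k]→ₗ[ℝ] ℝ) : a = 0 := by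
  have h0 : Module.finrank ℝ (V [⋀^Fin k]→ₗ[ℝ] ℝ) = 0 := by
    rw [finrank_alternatingMap, Nat.choose_eq_zero_of_lt h]
  exact (Module.finrank_zero_iff.1 h0).elim a 0

/-- `a ↦ L^j a` as a linear map. -/
def lefschetzₗ (σ : V [⋀^Fin 2]→ₗ[ℝ] ℝ) (k j : ℕ) :
    (V [⋀^Fin k]→ₗ[ℝ] ℝ) →ₗ[ℝ] V [⋀^Fin (k + 2 * j)]→ₗ[ℝ] ℝ where
  toFun a := lefschetz σ a j
  map_add' a b := by
    induction j with
    | zero => rfl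
    | succ j ih => simp only [lefschetz, ih, wedge_add_left]
  map_smul' c a := by
    induction j with
    | zero => rfl
    | succ j ih =>
      simp only [RingHom.id_apply] at ih
      simp only [lefschetz, ih, wedge_smul_left, RingHom.id_apply]

section Nondegenerate

variable [FiniteDimensional ℝ V] {σ : V [⋀^Fin 2]→ₗ[ℝ] ℝ} {n : ℕ}

/-- The powers of a symplectic form do not vanish up to half the dimension. -/
theorem eq_zero_of_lefschetzOp_pow_zeroForm (hσ : Function.Bijective (flat σ))
    (hV : Module.finrank ℝ V = 2 * n) {a : TotalForms V} (ha : a ∈ formsOfDegree V 0) (m : ℕ)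
    (hm : m ≤ n) (h : (lefschetzOp σ ^ m) a = 0) : a = 0 := by
  induction m with
  | zero => simpa using h
  | succ m ih =>
    have hι : ∀ X, contractOp X a = 0 := fun X => eq_zero_of_mem_gradedPart (contractOp_mem ha)
      (fun j hj => by omega)
    refine ih (by omega) ?_
    have hmem : ∀ m : ℕ, (lefschetzOp σ ^ m) a ∈ formsOfDegree V ((2 * m : ℕ) : ℤ) := by
      intro m
      induction m with
      | zero => simpa using ha
      | succ m ih =>
        have := lefschetzOp_mem (σ := σ) ih
        rw [pow_succ', Module.End.mul_apply]
        rwa [show ((2 * m : ℕ) : ℤ) + 2 = ((2 * (m + 1) : ℕ) : ℤ) by push_cast; ring] at this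
    refine eq_zero_of_extMulOp (by omega) (hmem m) fun θ => ?_
    obtain ⟨X, rfl⟩ := hσ.2 θ
    have h1 := contractOp_lefschetzOp_pow X σ a (m + 1)
    rw [h, map_zero, hι, map_zero, zero_add, Nat.add_sub_cancel] at h1
    exact (smul_eq_zero.1 h1.symm).resolve_left (by positivity)

/-- The contraction of a form killed by `L^j` is killed by `L^{j+1}`. -/
theorem lefschetzOp_pow_succ_contractOp {a : TotalForms V} {j : ℕ} (X : V)
    (h : (lefschetzOp σ ^ j) a = 0) : (lefschetzOp σ ^ (j + 1)) (contractOp X a) = 0 := by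
  have h1 := contractOp_lefschetzOp_pow X σ a (j + 1)
  rw [Nat.add_sub_cancel, h, map_zero, smul_zero, add_zero, pow_succ' _ j, Module.End.mul_apply, h,
    map_zero, map_zero] at h1
  rw [pow_succ', h1]

theorem lefschetzOp_pow_injective (hσ : Function.Bijective (flat σ))
    (hV : Module.finrank ℝ V = 2 * n) {k j : ℕ} (hk : k + j = n) {a : TotalForms V}
    (ha : a ∈ formsOfDegree V k) (h : (lefschetzOp σ ^ j) a = 0) : a = 0 := by
  induction k generalizing j a with
  | zero =>
    exact eq_zero_of_lefschetzOp_pow_zeroForm hσ hV ha j (by omega) h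
  | succ k ih =>
    refine eq_zero_of_contractOp (ha 0 (by push_cast; omega)) fun X => ?_
    refine ih (j := j + 1) (by omega) ?_ (lefschetzOp_pow_succ_contractOp X h)
    have := contractOp_mem (X := X) ha
    rwa [show (((k + 1 : ℕ) : ℤ) - 1) = k by push_cast; ring] at this

/-- `L^j : Λ^k → Λ^{2n-k}` is bijective: injectivity follows by contracting with vectors down
to degree `0`, and both sides have the same dimension. -/
theorem lefschetzₗ_bijective (hσ : Function.Bijective (flat σ))
    (hV : Module.finrank ℝ V = 2 * n) {k j : ℕ} (hk : k + j = n) :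
    Function.Bijective (lefschetzₗ σ k j) := by
  have hinj : Function.Injective (lefschetzₗ σ k j) := by
    rw [← LinearMap.ker_eq_bot, LinearMap.ker_eq_bot']
    intro a ha
    have h1 := lefschetzOp_pow_single σ a j
    have h2 : lefschetz σ a j = 0 := ha
    rw [h2, Pi.single_zero] at h1
    have h3 := lefschetzOp_pow_injective hσ hV hk (single_mem_gradedPart rfl a) h1
    simpa using congrFun h3 k
  refine ⟨hinj, (LinearMap.injective_iff_surjective_of_finrank_eq_finrank ?_).1 hinj⟩
  rw [finrank_alternatingMap, finrank_alternatingMap, hV,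
    ← Nat.choose_symm (show k ≤ 2 * n by omega)]
  congr 1
  omega

/-- Forms on a symplectic vector space form a Lefschetz module. -/
theorem isLefschetzModule_forms (hσ : Function.Bijective (flat σ))
    (hV : Module.finrank ℝ V = 2 * n) :
    IsLefschetzModule (formsOfDegree V) (lefschetzOp σ) n where
  map_mem := lefschetzOp_mem
  eq_zero {k a} hk ha := eq_zero_of_mem_gradedPart ha fun j hj => by
    rcases hk with hk | hk
    · omega
    · exact alternatingMap_eq_zero_of_finrank_lt (by omega) _
  inj {k j a} hk ha h := by
    rcases lt_or_ge k 0 with h0 | h0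
    · exact eq_zero_of_mem_gradedPart ha fun j hj => by omega
    · lift k to ℕ using h0
      exact lefschetzOp_pow_injective hσ hV (by exact_mod_cast hk) ha h
  surj {k j c} hk hc := by
    rcases lt_or_ge k 0 with h0 | h0
    · refine ⟨0, zero_mem _, ?_⟩
      rw [map_zero]
      exact (eq_zero_of_mem_gradedPart hc fun i hi =>
        alternatingMap_eq_zero_of_finrank_lt (by omega) _).symm
    · lift k to ℕ using h0
      obtain ⟨a, ha⟩ := (lefschetzₗ_bijective hσ hV (by exact_mod_cast hk)).2 (c (k + 2 * j))
      refine ⟨Pi.single (M := fun k => V [⋀^Fin k]→ₗ[ℝ] ℝ) k a,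
        single_mem_gradedPart (B := fun k => V [⋀^Fin k]→ₗ[ℝ] ℝ) rfl a, ?_⟩
      have hc' : c ∈ formsOfDegree V ((k + 2 * j : ℕ) : ℤ) := by push_cast; exact hc
      rw [lefschetzOp_pow_single, eq_single_of_mem_gradedPart hc']
      congr 1

end Nondegenerate

end Symplectic


/-! ### The symplectic Hodge star of a symplectic vector space -/

section Star

variable {V : Type*} [AddCommGroup V] [Module ℝ V]

theorem formOfExterior_ιMulti_apply {k : ℕ} (θ : Fin k → Module.Dual ℝ V) (v : Fin k → V) :
    formOfExterior k (exteriorPower.ιMulti ℝ k θ) v = Matrix.det (.of fun i j => θ j (v i)) := by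
  rw [formOfExterior, exteriorPower.alternatingMapLinearEquiv_symm_apply]
  exact exteriorPower.pairingDual_ιMulti_ιMulti θ v

/-- Laplace expansion: `θ₁ ∧ ⋯ ∧ θ_{k+1} = θ₁ ∧ (θ₂ ∧ ⋯ ∧ θ_{k+1})`. -/
theorem formOfExterior_ιMulti_succ {k : ℕ} (θ : Fin (k + 1) → Module.Dual ℝ V) :
    formOfExterior (k + 1) (exteriorPower.ιMulti ℝ (k + 1) θ) =
      extMul (θ 0) (formOfExterior k (exteriorPower.ιMulti ℝ k (Fin.tail θ))) := by
  ext v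
  rw [formOfExterior_ιMulti_apply, Matrix.det_succ_column_zero, extMul,
    AlternatingMap.alternatizeUncurryFin_apply]
  refine Finset.sum_congr rfl fun i _ => ?_
  rw [LinearMap.smulRight_apply, AlternatingMap.smul_apply, formOfExterior_ιMulti_apply,
    smul_eq_mul, Matrix.of_apply, mul_assoc]
  simp [Fin.removeNth, Fin.tail, Matrix.submatrix]

theorem formOfExterior_ιMulti_zero (θ : Fin 0 → Module.Dual ℝ V) :
    formOfExterior 0 (exteriorPower.ιMulti ℝ 0 θ) ![] = 1 := by
  rw [formOfExterior_ιMulti_apply, Matrix.det_fin_zero]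

theorem symplecticPairing_ιMulti (σ : V [⋀^Fin 2]→ₗ[ℝ] ℝ) {k : ℕ} (θ : Fin k → Module.Dual ℝ V)
    (a : V [⋀^Fin k]→ₗ[ℝ] ℝ) :
    symplecticPairing σ (exteriorPower.ιMulti ℝ k θ) a = a fun i => sharp σ (θ i) := by
  rw [symplecticPairing, exteriorPower.map_apply_ιMulti,
    exteriorPower.alternatingMapLinearEquiv_apply_ιMulti]
  rfl

/-- The defining property of the star has to be tested on decomposable forms only. -/
theorem isSymplecticStar_iff {σ : V [⋀^Fin 2]→ₗ[ℝ] ℝ} {n k l : ℕ} {h : k + l = 2 * n}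
    {a : V [⋀^Fin k]→ₗ[ℝ] ℝ} {c : V [⋀^Fin l]→ₗ[ℝ] ℝ} :
    IsSymplecticStar σ n h a c ↔ ∀ θ : Fin k → Module.Dual ℝ V,
      wedgeAt h (formOfExterior k (exteriorPower.ιMulti ℝ k θ)) c =
        ((a fun i => sharp σ (θ i)) / (n.factorial : ℝ)) • wedgePow σ n := by
  constructor
  · intro hs θ
    have := hs (exteriorPower.ιMulti ℝ k θ)
    rwa [symplecticPairing_ιMulti] at this
  · intro hs b
    let f : ⋀[ℝ]^k (Module.Dual ℝ V) →ₗ[ℝ] V [⋀^Fin (2 * n)]→ₗ[ℝ] ℝ :=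
      (wedgeAtₗ h).flip c ∘ₗ exteriorPower.alternatingMapLinearEquiv.symm.toLinearMap ∘ₗ
        exteriorPower.pairingDual ℝ V k
    let g : ⋀[ℝ]^k (Module.Dual ℝ V) →ₗ[ℝ] V [⋀^Fin (2 * n)]→ₗ[ℝ] ℝ :=
      LinearMap.toSpanSingleton ℝ _ ((n.factorial : ℝ)⁻¹ • wedgePow σ n) ∘ₗ
        exteriorPower.alternatingMapLinearEquiv a ∘ₗ exteriorPower.map k (sharp σ)
    have hfg : f = g := by
      refine exteriorPower.linearMap_ext ?_
      ext1 θ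
      refine (hs θ).trans ?_
      rw [← symplecticPairing_ιMulti, div_eq_mul_inv, mul_smul]
      rfl
    refine (DFunLike.congr_fun hfg b).trans ?_
    rw [div_eq_mul_inv, mul_smul]
    rfl

theorem IsSymplecticStar.add {σ : V [⋀^Fin 2]→ₗ[ℝ] ℝ} {n k l : ℕ} {h : k + l = 2 * n}
    {a a' : V [⋀^Fin k]→ₗ[ℝ] ℝ} {c c' : V [⋀^Fin l]→ₗ[ℝ] ℝ} (hc : IsSymplecticStar σ n h a c)
    (hc' : IsSymplecticStar σ n h a' c') : IsSymplecticStar σ n h (a + a') (c + c') := by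
  rw [isSymplecticStar_iff] at *
  intro θ
  rw [wedgeAt_add_right, hc, hc', AlternatingMap.add_apply, add_div, add_smul]

theorem IsSymplecticStar.smul {σ : V [⋀^Fin 2]→ₗ[ℝ] ℝ} {n k l : ℕ} {h : k + l = 2 * n} (r : ℝ)
    {a : V [⋀^Fin k]→ₗ[ℝ] ℝ} {c : V [⋀^Fin l]→ₗ[ℝ] ℝ} (hc : IsSymplecticStar σ n h a c) :
    IsSymplecticStar σ n h (r • a) (r • c) := by
  rw [isSymplecticStar_iff] at *
  intro θ
  rw [wedgeAt_smul_right, hc, AlternatingMap.smul_apply, smul_smul, smul_eq_mul, mul_div_assoc]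

theorem isSymplecticStar_zero (σ : V [⋀^Fin 2]→ₗ[ℝ] ℝ) {n k l : ℕ} (h : k + l = 2 * n) :
    IsSymplecticStar σ n h (0 : V [⋀^Fin k]→ₗ[ℝ] ℝ) (0 : V [⋀^Fin l]→ₗ[ℝ] ℝ) := by
  rw [isSymplecticStar_iff]
  intro θ
  have := wedgeAt_smul_right h (0 : ℝ) (formOfExterior k (exteriorPower.ιMulti ℝ k θ))
    (0 : V [⋀^Fin l]→ₗ[ℝ] ℝ)
  rw [zero_smul, zero_smul] at this
  rw [this]
  simp

theorem flat_sharp {σ : V [⋀^Fin 2]→ₗ[ℝ] ℝ} (hσ : Function.Bijective (flat σ))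
    (θ : Module.Dual ℝ V) : flat σ (sharp σ θ) = θ := by
  rw [sharp, dif_pos hσ]
  exact (LinearEquiv.ofBijective (flat σ) hσ).apply_symm_apply θ

/-- The star exchanges contraction with `X` and exterior multiplication by `ι_X σ`, up to sign. -/
theorem isSymplecticStar_succ {σ : V [⋀^Fin 2]→ₗ[ℝ] ℝ} (hσ : Function.Bijective (flat σ))
    {n k l : ℕ} {h : k + 1 + l = 2 * n} (h' : k + (l + 1) = 2 * n)
    {a : V [⋀^Fin (k + 1)]→ₗ[ℝ] ℝ} {c : V [⋀^Fin l]→ₗ[ℝ] ℝ}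
    (hc : ∀ X, IsSymplecticStar σ n h' (a.curryLeft X) ((-1 : ℝ) ^ k • extMul (flat σ X) c)) :
    IsSymplecticStar σ n h a c := by
  rw [isSymplecticStar_iff]
  intro θ
  have h1 := isSymplecticStar_iff.1 (hc (sharp σ (θ 0))) (Fin.tail θ)
  rw [flat_sharp hσ, wedgeAt_smul_right] at h1
  rw [formOfExterior_ιMulti_succ, wedgeAt_extMul_left _ h h', h1]
  have h2 : (a.curryLeft (sharp σ (θ 0)) fun i => sharp σ (Fin.tail θ i)) =
      a fun i => sharp σ (θ i) := by
    rw [AlternatingMap.curryLeft_apply_apply]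
    congr 1
    funext i
    exact Fin.cases rfl (fun i => rfl) i
  rw [h2]

theorem isSymplecticStar_zeroForm {σ : V [⋀^Fin 2]→ₗ[ℝ] ℝ} {n l : ℕ} {h : 0 + l = 2 * n}
    (a : V [⋀^Fin 0]→ₗ[ℝ] ℝ) {c : V [⋀^Fin l]→ₗ[ℝ] ℝ}
    (hc : c.domDomCongr (finCongr (by omega)) = (a ![] / (n.factorial : ℝ)) • wedgePow σ n) :
    IsSymplecticStar σ n h a c := by
  rw [isSymplecticStar_iff]
  intro θ
  rw [wedgeAt_zeroForm_left, formOfExterior_ιMulti_zero, one_smul, hc]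
  congr 3
  exact Subsingleton.elim _ _

/-- The exterior product is a perfect pairing: a form whose products with all forms of complementary
degree vanish is zero. -/
theorem eq_zero_of_wedgeAt [FiniteDimensional ℝ V] {k l N : ℕ} (hV : Module.finrank ℝ V = N)
    (h : k + l = N) {c : V [⋀^Fin l]→ₗ[ℝ] ℝ}
    (hc : ∀ θ : Fin k → Module.Dual ℝ V,
      wedgeAt h (formOfExterior k (exteriorPower.ιMulti ℝ k θ)) c = 0) : c = 0 := by
  induction k generalizing l with
  | zero =>
    have h1 := hc Fin.elim0
    rw [wedgeAt_zeroForm_left, formOfExterior_ιMulti_zero, one_smul] at h1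
    obtain rfl : l = N := by omega
    exact h1
  | succ k ih =>
    have key : ∀ θ, extMul θ c = 0 := fun θ => by
      refine ih (by omega) fun η => ?_
      have h1 := hc (Fin.cons θ η)
      rw [formOfExterior_ιMulti_succ, wedgeAt_extMul_left _ h (by omega), Fin.cons_zero,
        Fin.tail_cons] at h1
      exact (smul_eq_zero.1 h1).resolve_left (pow_ne_zero _ (by norm_num))
    have h2 := eq_zero_of_extMulOp (k := l) (by omega)
      (single_mem_gradedPart (B := fun k => V [⋀^Fin k]→ₗ[ℝ] ℝ) rfl c) (fun θ => by
        have hm := extMulOp_mem (θ := θ)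
          (single_mem_gradedPart (B := fun k => V [⋀^Fin k]→ₗ[ℝ] ℝ) (l := l) rfl c)
        refine eq_zero_of_mem_gradedPart hm fun j hj => ?_
        obtain rfl : j = l + 1 := by exact_mod_cast hj
        change extMul θ (Pi.single (M := fun k => V [⋀^Fin k]→ₗ[ℝ] ℝ) l c l) = 0
        rw [Pi.single_eq_same, key])
    simpa using congrFun h2 l

theorem IsSymplecticStar.unique [FiniteDimensional ℝ V] {σ : V [⋀^Fin 2]→ₗ[ℝ] ℝ} {n k l : ℕ}
    (hV : Module.finrank ℝ V = 2 * n) {h : k + l = 2 * n}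
    {a : V [⋀^Fin k]→ₗ[ℝ] ℝ} {c c' : V [⋀^Fin l]→ₗ[ℝ] ℝ} (hc : IsSymplecticStar σ n h a c)
    (hc' : IsSymplecticStar σ n h a c') : c = c' := by
  rw [← sub_eq_zero]
  refine eq_zero_of_wedgeAt hV h fun θ => ?_
  rw [sub_eq_add_neg, ← neg_one_smul ℝ c', wedgeAt_add_right, wedgeAt_smul_right,
    isSymplecticStar_iff.1 hc, isSymplecticStar_iff.1 hc']
  module

theorem lefschetzOp_pow_zeroForm_apply (σ : V [⋀^Fin 2]→ₗ[ℝ] ℝ) (a : TotalForms V) (n : ℕ) :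
    (lefschetzOp σ ^ n) a (2 * n) = a 0 ![] • wedgePow σ n := by
  induction n with
  | zero =>
    ext v
    have hv : v = ![] := Subsingleton.elim (α := Fin 0 → V) v ![]
    subst hv
    simp [wedgePow]
  | succ n ih =>
    rw [pow_succ', Module.End.mul_apply]
    change wedge ((lefschetzOp σ ^ n) a (2 * n)) σ = _
    rw [ih, wedge_smul_left]
    rfl

variable [FiniteDimensional ℝ V] {σ : V [⋀^Fin 2]→ₗ[ℝ] ℝ} {n : ℕ}

/-- Weil's formula. The induction on the degree `k` of `L^r a` contracts with a vector `X`: if `a` is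
primitive then so are `ι_X a` and `ι_X σ ∧ a + (n - p + 1)⁻¹ L ι_X a`, and `ι_X L^r a` is a
combination of powers of `L` applied to these two. -/
theorem isSymplecticStar_lefschetzOp_pow (hσ : Function.Bijective (flat σ))
    (hV : Module.finrank ℝ V = 2 * n) (k : ℕ) {l : ℕ} (h : k + l = 2 * n) (p r m : ℕ)
    (hk : p + 2 * r = k) (hn : p + r + m = n) {a : TotalForms V} (ha : a ∈ formsOfDegree V p)
    (hL : (lefschetzOp σ ^ (r + m + 1)) a = 0) :
    IsSymplecticStar σ n h ((lefschetzOp σ ^ r) a k)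
      (((m.factorial : ℝ)⁻¹ * (weilSign p * r.factorial)) • (lefschetzOp σ ^ m) a l) := by
  have hm0 : (m.factorial : ℝ) ≠ 0 := by positivity
  induction k generalizing l p r m a with
  | zero =>
    obtain rfl : p = 0 := by omega
    obtain rfl : r = 0 := by omega
    obtain rfl : m = n := by omega
    obtain rfl : l = 2 * m := by omega
    refine isSymplecticStar_zeroForm _ ?_
    rw [lefschetzOp_pow_zeroForm_apply]
    simp only [Nat.cast_zero, weilSign_zero, Nat.factorial_zero, Nat.cast_one, mul_one, pow_zero,
      Module.End.one_apply, div_eq_mul_inv]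
    rw [smul_smul, mul_comm (m.factorial : ℝ)⁻¹]
    rfl
  | succ k ih =>
    refine isSymplecticStar_succ hσ (by omega) fun X => ?_
    set L := lefschetzOp σ with hLdef
    set N : ℝ := r + m + 1 with hN
    have hN0 : N ≠ 0 := by positivity
    set b := contractOp X a with hb
    set a' := extMulOp (flat σ X) a + N⁻¹ • L b with ha'
    have hbm := contractOp_mem (X := X) ha
    have hLb := lefschetzOp_mem (σ := σ) hbm
    rw [show (p : ℤ) - 1 + 2 = ((p + 1 : ℕ) : ℤ) by push_cast; ring] at hLb
    have ha'm : a' ∈ formsOfDegree V ((p + 1 : ℕ) : ℤ) :=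
      add_mem (extMulOp_mem ha) (Submodule.smul_mem _ _ hLb)
    have hbL : (L ^ (r + m + 1 + 1)) b = 0 := lefschetzOp_pow_succ_contractOp X hL
    have hNcast : ((r + m + 1 : ℕ) : ℝ) = N := by push_cast; rfl
    have ha'L : (L ^ (r + m)) a' = 0 := by
      have h1 := contractOp_lefschetzOp_pow X σ a (r + m + 1)
      rw [hL, map_zero, Nat.add_sub_cancel, hNcast] at h1
      rw [ha', map_add, map_smul, ← Module.End.mul_apply (L ^ (r + m)) L, ← pow_succ,
        lefschetzOp_pow_extMulOp]
      have h2 := congrArg (N⁻¹ • ·) h1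
      simp only [smul_zero, smul_add, smul_smul, inv_mul_cancel₀ hN0, one_smul] at h2
      rw [add_comm, ← h2]
    -- `ι_X σ ∧ a` in terms of the primitive forms `a'` and `b`
    have he : extMulOp (flat σ X) a = a' - N⁻¹ • L b := by rw [ha']; abel
    have hleft : ((L ^ r) a (k + 1)).curryLeft X =
        (r : ℝ) • (L ^ (r - 1)) a' k + (((m : ℝ) + 1) * N⁻¹) • (L ^ r) b k := by
      have h1 : contractOp X ((L ^ r) a) =
          (r : ℝ) • (L ^ (r - 1)) a' + (((m : ℝ) + 1) * N⁻¹) • (L ^ r) b := by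
        rw [contractOp_lefschetzOp_pow, ← lefschetzOp_pow_extMulOp, he, map_sub, map_smul, ← hb]
        simp only [← hLdef]
        have hc : ((m : ℝ) + 1) * N⁻¹ = 1 - r * N⁻¹ := by
          field_simp
          rw [hN]; ring
        cases r with
        | zero =>
          rw [hc]; simp [hb]
        | succ r =>
          rw [Nat.add_sub_cancel, ← Module.End.mul_apply (L ^ r) L, ← pow_succ, hc]
          module
      exact congrFun h1 k
    have hright : extMul (flat σ X) ((L ^ m) a l) =
        (L ^ m) a' (l + 1) - N⁻¹ • (L ^ (m + 1)) b (l + 1) := by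
      have h1 : extMulOp (flat σ X) ((L ^ m) a) = (L ^ m) a' - N⁻¹ • (L ^ (m + 1)) b := by
        rw [← lefschetzOp_pow_extMulOp, he, map_sub, map_smul, ← hLdef,
          ← Module.End.mul_apply (L ^ m) L, ← pow_succ]
      exact congrFun h1 (l + 1)
    have e1 : weilSign ((p + 1 : ℕ) : ℤ) = -(-1) ^ (p : ℤ) * weilSign p := by
      push_cast
      rw [weilSign_succ, neg_one_zpow_succ]
    have ek : (-1 : ℝ) ^ k = -(-1) ^ (p : ℤ) := by
      rw [← zpow_natCast, show (k : ℤ) = p + 2 * r - 1 by omega,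
        show (p : ℤ) + 2 * r - 1 = p - 1 + 2 * r by ring, neg_one_zpow_add_two_mul]
      have := neg_one_zpow_succ ((p : ℤ) - 1)
      rw [sub_add_cancel] at this
      rw [this, neg_neg]
    -- the two terms of the contraction
    have s1 : IsSymplecticStar σ n (by omega : k + (l + 1) = 2 * n) ((r : ℝ) • (L ^ (r - 1)) a' k)
        (((m.factorial : ℝ)⁻¹ * (weilSign ((p + 1 : ℕ) : ℤ) * r.factorial)) •
          (L ^ m) a' (l + 1)) := by
      cases r with
      | zero =>
        rw [zero_add] at ha'L
        rw [ha'L]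
        simpa using isSymplecticStar_zero σ (by omega : k + (l + 1) = 2 * n)
      | succ r =>
        have := (ih (l := l + 1) (by omega) (p + 1) r m (by omega) (by omega) ha'm
          (by rwa [show r + m + 1 = r + 1 + m by ring]) hm0).smul ((r + 1 : ℕ) : ℝ)
        rw [smul_smul] at this
        rw [Nat.add_sub_cancel]
        convert this using 2
        rw [Nat.factorial_succ]
        push_cast
        ring
    have s2 : IsSymplecticStar σ n (by omega : k + (l + 1) = 2 * n)
        ((((m : ℝ) + 1) * N⁻¹) • (L ^ r) b k)
        (((-1) ^ (p : ℤ) * N⁻¹ * ((m.factorial : ℝ)⁻¹ * (weilSign p * r.factorial))) •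
          (L ^ (m + 1)) b (l + 1)) := by
      cases p with
      | zero =>
        have hb0 : b = 0 := eq_zero_of_mem_gradedPart hbm fun j hj => by omega
        rw [hb0]
        simpa using isSymplecticStar_zero σ (by omega : k + (l + 1) = 2 * n)
      | succ p =>
        rw [show (((p + 1 : ℕ) : ℤ) - 1) = p by push_cast; ring] at hbm
        have := (ih (l := l + 1) (by omega) p r (m + 1) (by omega) (by omega) hbm
          (by rwa [show r + (m + 1) + 1 = r + m + 1 + 1 by ring]) (by positivity)).smul
            (((m : ℝ) + 1) * N⁻¹)
        rw [smul_smul] at this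
        convert this using 2
        have e3 := neg_one_zpow_mul_self (p : ℤ)
        rw [Nat.factorial_succ]
        push_cast
        rw [weilSign_succ, neg_one_zpow_succ]
        field_simp
        linear_combination (weilSign p) * e3
    have := s1.add s2
    rw [hleft]
    convert this using 1
    rw [extMul_smul, hright, e1, ek]
    module

theorem exists_isSymplecticStar (hσ : Function.Bijective (flat σ))
    (hV : Module.finrank ℝ V = 2 * n) {k l : ℕ} (h : k + l = 2 * n) (a : V [⋀^Fin k]→ₗ[ℝ] ℝ) :
    ∃ c : V [⋀^Fin l]→ₗ[ℝ] ℝ, IsSymplecticStar σ n h a c := by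
  have hm := isLefschetzModule_forms hσ hV
  have key := hm.induction_on (P := fun a => ∃ c : V [⋀^Fin l]→ₗ[ℝ] ℝ,
    IsSymplecticStar σ n h (a k) c) (k : ℤ) ⟨0, isSymplecticStar_zero σ h⟩
    (fun a b _ _ ⟨c, hc⟩ ⟨c', hc'⟩ => ⟨c + c', hc.add hc'⟩) (fun p r m a hk hn ha hL => by
      rcases lt_or_ge p 0 with hp | hp
      · rw [hm.eq_zero (Or.inl hp) ha, map_zero]
        exact ⟨0, isSymplecticStar_zero σ h⟩
      · lift p to ℕ using hp
        exact ⟨_, isSymplecticStar_lefschetzOp_pow hσ hV k h p r m (by exact_mod_cast hk)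
          (by exact_mod_cast hn) ha hL⟩)
    (single_mem_gradedPart (B := fun k => V [⋀^Fin k]→ₗ[ℝ] ℝ) rfl a)
  rwa [Pi.single_eq_same] at key

theorem isSymplecticStar_symplecticStar (hσ : Function.Bijective (flat σ))
    (hV : Module.finrank ℝ V = 2 * n) {k l : ℕ} (h : k + l = 2 * n) (a : V [⋀^Fin k]→ₗ[ℝ] ℝ) :
    IsSymplecticStar σ n h a (symplecticStar σ n h a) := by
  rw [symplecticStar, dif_pos (exists_isSymplecticStar hσ hV h a)]
  exact (exists_isSymplecticStar hσ hV h a).choose_spec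

theorem symplecticStar_eq (hσ : Function.Bijective (flat σ))
    (hV : Module.finrank ℝ V = 2 * n) {k l : ℕ} {h : k + l = 2 * n} {a : V [⋀^Fin k]→ₗ[ℝ] ℝ}
    {c : V [⋀^Fin l]→ₗ[ℝ] ℝ} (hc : IsSymplecticStar σ n h a c) :
    symplecticStar σ n h a = c :=
  (isSymplecticStar_symplecticStar hσ hV h a).unique hV hc

theorem symplecticStar_add (hσ : Function.Bijective (flat σ))
    (hV : Module.finrank ℝ V = 2 * n) {k l : ℕ} (h : k + l = 2 * n) (a b : V [⋀^Fin k]→ₗ[ℝ] ℝ) :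
    symplecticStar σ n h (a + b) = symplecticStar σ n h a + symplecticStar σ n h b :=
  symplecticStar_eq hσ hV ((isSymplecticStar_symplecticStar hσ hV h a).add
    (isSymplecticStar_symplecticStar hσ hV h b))

theorem symplecticStar_smul (hσ : Function.Bijective (flat σ))
    (hV : Module.finrank ℝ V = 2 * n) {k l : ℕ} (h : k + l = 2 * n) (r : ℝ)
    (a : V [⋀^Fin k]→ₗ[ℝ] ℝ) :
    symplecticStar σ n h (r • a) = r • symplecticStar σ n h a :=
  symplecticStar_eq hσ hV ((isSymplecticStar_symplecticStar hσ hV h a).smul r)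

end Star


/-! ### Smooth families of alternating forms -/

section SmoothFamilies

variable {E : Type*} [NormedAddCommGroup E] [NormedSpace ℝ E] [FiniteDimensional ℝ E]
  {D : Type*} [NormedAddCommGroup D] [NormedSpace ℝ D]
  {H : Type*} [NormedAddCommGroup H] [NormedSpace ℝ H] [FiniteDimensional ℝ H]

/-- Algebraic and continuous alternating forms on a finite dimensional space agree. -/
def toContEquiv (E : Type*) [NormedAddCommGroup E] [NormedSpace ℝ E] [FiniteDimensional ℝ E]
    (k : ℕ) : (E [⋀^Fin k]→ₗ[ℝ] ℝ) ≃ₗ[ℝ] E [⋀^Fin k]→L[ℝ] ℝ :=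
  { toCont with
    invFun := ContinuousAlternatingMap.toAlternatingMap
    left_inv := fun _ => rfl
    right_inv := fun _ => rfl }

@[simp] theorem toCont_toAlternatingMap {k : ℕ} (a : E [⋀^Fin k]→L[ℝ] ℝ) :
    toCont a.toAlternatingMap = a := rfl

instance finite_continuousAlternatingMap (k : ℕ) : FiniteDimensional ℝ (E [⋀^Fin k]→L[ℝ] ℝ) :=
  (toContEquiv E k).finiteDimensional

/-- Smoothness of a family of alternating forms can be tested on constant vectors, since finitely
many evaluations embed the space of forms linearly into some `ℝ^N`. -/
theorem contDiffAt_of_apply {k : ℕ} {r : WithTop ℕ∞} {f : D → E [⋀^Fin k]→L[ℝ] ℝ} {x : D}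
    (h : ∀ v, ContDiffAt ℝ r (fun y => f y v) x) : ContDiffAt ℝ r f x := by
  let b := Module.finBasis ℝ E
  let ev : (E [⋀^Fin k]→L[ℝ] ℝ) →ₗ[ℝ] ((Fin k → Fin (Module.finrank ℝ E)) → ℝ) :=
    { toFun := fun a r => a (fun i => b (r i))
      map_add' := fun _ _ => rfl
      map_smul' := fun _ _ => rfl }
  have hev : LinearMap.ker ev = ⊥ := by
    rw [LinearMap.ker_eq_bot']
    intro a ha
    have : a.toAlternatingMap = 0 :=
      b.ext_alternating fun v _ => congrFun ha v
    ext v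
    exact DFunLike.congr_fun this v
  obtain ⟨g, hg⟩ := ev.exists_leftInverse_of_injective hev
  have h1 : f = fun y => LinearMap.toContinuousLinearMap g (ev (f y)) := by
    funext y
    exact (LinearMap.congr_fun hg (f y)).symm
  rw [h1]
  exact (LinearMap.toContinuousLinearMap g).contDiff.contDiffAt.comp x
    (contDiffAt_pi.2 fun _ => h _)

theorem contDiffAt_compContinuousLinearMap {k : ℕ} {r : WithTop ℕ∞} {f : D → H [⋀^Fin k]→L[ℝ] ℝ}
    {g : D → E →L[ℝ] H} {x : D} (hf : ContDiffAt ℝ r f x) (hg : ContDiffAt ℝ r g x) :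
    ContDiffAt ℝ r (fun y => (f y).compContinuousLinearMap (g y)) x := by
  refine contDiffAt_of_apply fun v => ?_
  have h1 : ContDiffAt ℝ r (fun y =>
      ContinuousMultilinearMap.compContinuousLinearMapContinuousMultilinear ℝ
        (fun _ : Fin k => E) (fun _ : Fin k => H) ℝ (fun _ => g y)) x :=
    (ContinuousMultilinearMap.contDiff _).contDiffAt.comp x (contDiffAt_pi.2 fun _ => hg)
  have h2 : ContDiffAt ℝ r (fun y => (f y).toContinuousMultilinearMap) x :=
    (ContinuousAlternatingMap.toContinuousMultilinearMapCLM (𝕜 := ℝ) (E := H) (F := ℝ)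
      (ι := Fin k) ℝ).contDiff.contDiffAt.comp x hf
  exact (ContinuousMultilinearMap.apply ℝ (fun _ : Fin k => E) ℝ v).contDiff.contDiffAt.comp x
    (h1.clm_apply h2)

/-- The exterior product of continuous alternating forms, as a continuous bilinear map. -/
def wedgeL (E : Type*) [NormedAddCommGroup E] [NormedSpace ℝ E] [FiniteDimensional ℝ E]
    (k l : ℕ) :
    (E [⋀^Fin k]→L[ℝ] ℝ) →L[ℝ] (E [⋀^Fin l]→L[ℝ] ℝ) →L[ℝ] E [⋀^Fin (k + l)]→L[ℝ] ℝ :=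
  LinearMap.toContinuousBilinearMap
    (((wedgeAtₗ (V := E) (rfl : k + l = k + l)).compr₂ (toContEquiv E (k + l)).toLinearMap).compl₁₂
      (toContEquiv E k).symm.toLinearMap (toContEquiv E l).symm.toLinearMap)

theorem wedgeL_apply {k l : ℕ} (a : E [⋀^Fin k]→L[ℝ] ℝ) (b : E [⋀^Fin l]→L[ℝ] ℝ) :
    wedgeL E k l a b = toCont (wedge a.toAlternatingMap b.toAlternatingMap) := by
  rw [← wedgeAt_rfl]
  rfl

theorem contDiffAt_lefschetz {r : WithTop ℕ∞} {s : D → E [⋀^Fin 2]→L[ℝ] ℝ} {x : D}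
    (hs : ContDiffAt ℝ r s x) {k : ℕ} {f : D → E [⋀^Fin k]→L[ℝ] ℝ} (hf : ContDiffAt ℝ r f x)
    (j : ℕ) : ContDiffAt ℝ r
      (fun y => toCont (lefschetz (s y).toAlternatingMap (f y).toAlternatingMap j)) x := by
  induction j with
  | zero => exact hf
  | succ j ih =>
    have := ((wedgeL E (k + 2 * j) 2).contDiff.contDiffAt.comp x ih).clm_apply hs
    simp only [Function.comp_def, wedgeL_apply] at this
    exact this

theorem extMul_wedge_two (θ : Module.Dual ℝ E) {k : ℕ} (a : E [⋀^Fin k]→ₗ[ℝ] ℝ)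
    (b : E [⋀^Fin 2]→ₗ[ℝ] ℝ) :
    extMul θ (wedge a b) = wedge (k := k + 1) (l := 2) (extMul θ a) b := by
  have h := congrFun (lefschetzOp_extMulOp b θ
    (Pi.single (M := fun k => E [⋀^Fin k]→ₗ[ℝ] ℝ) k a)) (k + 3)
  have h1 : lefschetzOp b (extMulOp θ (Pi.single (M := fun k => E [⋀^Fin k]→ₗ[ℝ] ℝ) k a)) (k + 3) =
      wedge (k := k + 1) (l := 2)
        (extMul θ (Pi.single (M := fun k => E [⋀^Fin k]→ₗ[ℝ] ℝ) k a k)) b := rfl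
  have h2 : extMulOp θ (lefschetzOp b (Pi.single (M := fun k => E [⋀^Fin k]→ₗ[ℝ] ℝ) k a)) (k + 3) =
      extMul θ (wedge (Pi.single (M := fun k => E [⋀^Fin k]→ₗ[ℝ] ℝ) k a k) b) := rfl
  rw [h1, h2, Pi.single_eq_same] at h
  exact h.symm

theorem alternatizeUncurryFin_eq_sum {k : ℕ} (T : E →ₗ[ℝ] E [⋀^Fin k]→ₗ[ℝ] ℝ) :
    AlternatingMap.alternatizeUncurryFin T = ∑ i,
      extMul ((Module.finBasis ℝ E).coord i) (T (Module.finBasis ℝ E i)) := by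
  have h : T = ∑ i, ((Module.finBasis ℝ E).coord i).smulRight (T (Module.finBasis ℝ E i)) := by
    refine (Module.finBasis ℝ E).ext fun j => ?_
    simp [Finsupp.single_apply]
  conv_lhs => rw [h]
  exact map_sum AlternatingMap.alternatizeUncurryFinLM _ _

theorem toAlternatingMap_extDeriv {k : ℕ} (a : E → E [⋀^Fin k]→L[ℝ] ℝ) (x : E) :
    (extDeriv a x).toAlternatingMap = AlternatingMap.alternatizeUncurryFin
      ((toContEquiv E k).symm.toLinearMap ∘ₗ (fderiv ℝ a x).toLinearMap) :=
  ContinuousAlternatingMap.toAlternatingMap_alternatizeUncurryFin _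

/-- `d (a ∧ s) = da ∧ s` at a point where `ds = 0`. -/
theorem extDeriv_wedge_two {k : ℕ} {a : E → E [⋀^Fin k]→L[ℝ] ℝ} {s : E → E [⋀^Fin 2]→L[ℝ] ℝ}
    {x : E} (ha : DifferentiableAt ℝ a x) (hs : DifferentiableAt ℝ s x) (h0 : extDeriv s x = 0) :
    extDeriv (fun y => wedgeL E k 2 (a y) (s y)) x =
      toCont (wedge (k := k + 1) (l := 2) (extDeriv a x).toAlternatingMap
        (s x).toAlternatingMap) := by
  have hd : fderiv ℝ (fun y => wedgeL E k 2 (a y) (s y)) x =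
      (wedgeL E k 2).precompR E (a x) (fderiv ℝ s x) +
        (wedgeL E k 2).precompL E (fderiv ℝ a x) (s x) :=
    ((wedgeL E k 2).hasFDerivAt_of_bilinear ha.hasFDerivAt hs.hasFDerivAt).fderiv
  let Da : E →ₗ[ℝ] E [⋀^Fin k]→ₗ[ℝ] ℝ := (toContEquiv E k).symm.toLinearMap ∘ₗ fderiv ℝ a x
  let Ds : E →ₗ[ℝ] E [⋀^Fin 2]→ₗ[ℝ] ℝ := (toContEquiv E 2).symm.toLinearMap ∘ₗ fderiv ℝ s x
  let Dw : E →ₗ[ℝ] E [⋀^Fin (k + 2)]→ₗ[ℝ] ℝ := (toContEquiv E (k + 2)).symm.toLinearMap ∘ₗ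
    fderiv ℝ (fun y => wedgeL E k 2 (a y) (s y)) x
  have e1 : (extDeriv a x).toAlternatingMap = AlternatingMap.alternatizeUncurryFin Da :=
    toAlternatingMap_extDeriv _ _
  have e2 : (extDeriv s x).toAlternatingMap = AlternatingMap.alternatizeUncurryFin Ds :=
    toAlternatingMap_extDeriv _ _
  have e3 : (extDeriv (fun y => wedgeL E k 2 (a y) (s y)) x).toAlternatingMap =
    AlternatingMap.alternatizeUncurryFin Dw := toAlternatingMap_extDeriv _ _
  have hw : ∀ X, Dw X = wedge (a x).toAlternatingMap (Ds X) +
      wedge (Da X) (s x).toAlternatingMap := by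
    intro X
    change (fderiv ℝ (fun y => wedgeL E k 2 (a y) (s y)) x X).toAlternatingMap = _
    rw [hd]
    simp only [add_apply, ContinuousLinearMap.precompR_apply,
      ContinuousLinearMap.precompL_apply, wedgeL_apply]
    rfl
  have h0' : ∑ i, extMul ((Module.finBasis ℝ E).coord i) (Ds (Module.finBasis ℝ E i)) = 0 := by
    rw [← alternatizeUncurryFin_eq_sum, ← e2, h0]
    rfl
  rw [← toCont_toAlternatingMap (extDeriv (fun y => wedgeL E k 2 (a y) (s y)) x)]
  congr 1
  rw [e1, e3, alternatizeUncurryFin_eq_sum Dw, alternatizeUncurryFin_eq_sum Da]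
  simp only [hw, extMul_add, Finset.sum_add_distrib]
  have hA : ∑ i, extMul ((Module.finBasis ℝ E).coord i)
      (wedge (a x).toAlternatingMap (Ds (Module.finBasis ℝ E i))) = 0 := by
    have h3 : ∀ i, extMul ((Module.finBasis ℝ E).coord i)
        (wedge (a x).toAlternatingMap (Ds (Module.finBasis ℝ E i))) =
        (-1 : ℝ) ^ k • wedgeAtₗ (V := E) (N := k + 2 + 1) (by omega) (a x).toAlternatingMap
          (extMul ((Module.finBasis ℝ E).coord i) (Ds (Module.finBasis ℝ E i))) := by
      intro i
      rw [extMul_wedge_two, ← wedgeAt_rfl]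
      exact wedgeAt_extMul_left _ _ _ _ _
    simp only [h3]
    rw [← Finset.smul_sum, ← map_sum, h0', map_zero, smul_zero]
  rw [hA, zero_add]
  simp only [extMul_wedge_two]
  have h4 : ∀ b : E [⋀^Fin (k + 1)]→ₗ[ℝ] ℝ, wedge (k := k + 1) (l := 2) b (s x).toAlternatingMap =
      (wedgeAtₗ (V := E) (rfl : k + 1 + 2 = k + 1 + 2)).flip (s x).toAlternatingMap b := fun b => by
    rw [← wedgeAt_rfl]
    rfl
  simp only [h4]
  rw [map_sum]

end SmoothFamilies


/-! ### Differential forms in charts -/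

section Charts

variable {E : Type*} [NormedAddCommGroup E] [NormedSpace ℝ E] [FiniteDimensional ℝ E]
  {M : Type*} [TopologicalSpace M] [ChartedSpace E M] [IsManifold 𝓘(ℝ, E) ∞ M]

open IsManifold

/-- Evaluation of a form, with tangent vectors at `x` regarded as vectors of the model space. -/
def formEval {k : ℕ} (α : DiffForm E M k) (x : M) (v : Fin k → E) : ℝ := α x v

theorem formEval_congr {k : ℕ} (α : DiffForm E M k) {x x' : M} {v v' : Fin k → E} (hx : x = x')
    (hv : v = v') : formEval α x v = formEval α x' v' := by
  subst hx hv
  rfl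

theorem localRep_apply {k : ℕ} (e : OpenPartialHomeomorph M E) (α : DiffForm E M k) (y : E)
    (v : Fin k → E) : localRep e α y v =
      formEval α (e.symm y) (fun i => mfderiv 𝓘(ℝ, E) 𝓘(ℝ, E) e.symm y (v i)) := rfl

theorem minSmoothness_two_le : minSmoothness ℝ 2 ≤ ∞ := by
  rw [minSmoothness_of_isRCLikeNormedField]
  exact WithTop.coe_le_coe.2 (le_top : (2 : ℕ∞) ≤ ⊤)

variable {e e' : OpenPartialHomeomorph M E}

theorem mdifferentiableAt_chart (he : e ∈ maximalAtlas 𝓘(ℝ, E) ∞ M) {x : M} (hx : x ∈ e.source) :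
    MDifferentiableAt 𝓘(ℝ, E) 𝓘(ℝ, E) e x :=
  (contMDiffAt_of_mem_maximalAtlas he hx).mdifferentiableAt (by simp)

theorem mdifferentiableAt_chart_symm (he : e ∈ maximalAtlas 𝓘(ℝ, E) ∞ M) {y : E}
    (hy : y ∈ e.target) : MDifferentiableAt 𝓘(ℝ, E) 𝓘(ℝ, E) e.symm y :=
  (contMDiffAt_symm_of_mem_maximalAtlas he hy).mdifferentiableAt (by simp)

theorem contDiffAt_transition (he : e ∈ maximalAtlas 𝓘(ℝ, E) ∞ M)
    (he' : e' ∈ maximalAtlas 𝓘(ℝ, E) ∞ M) {y : E} (hy : y ∈ e'.target)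
    (hx : e'.symm y ∈ e.source) : ContDiffAt ℝ ∞ (e ∘ e'.symm) y :=
  ((contMDiffAt_of_mem_maximalAtlas he hx).comp y
    (contMDiffAt_symm_of_mem_maximalAtlas he' hy)).contDiffAt

theorem fderiv_transition (he : e ∈ maximalAtlas 𝓘(ℝ, E) ∞ M)
    (he' : e' ∈ maximalAtlas 𝓘(ℝ, E) ∞ M) {y : E} (hy : y ∈ e'.target)
    (hx : e'.symm y ∈ e.source) (v : E) : fderiv ℝ (e ∘ e'.symm) y v =
      mfderiv 𝓘(ℝ, E) 𝓘(ℝ, E) e (e'.symm y) (mfderiv 𝓘(ℝ, E) 𝓘(ℝ, E) e'.symm y v) := by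
  rw [← mfderiv_eq_fderiv, mfderiv_comp y (mdifferentiableAt_chart he hx)
    (mdifferentiableAt_chart_symm he' hy)]
  rfl

theorem mfderiv_chart_symm_mfderiv_chart (he : e ∈ maximalAtlas 𝓘(ℝ, E) ∞ M) {x : M}
    (hx : x ∈ e.source) (X : TangentSpace 𝓘(ℝ, E) x) :
    (mfderiv 𝓘(ℝ, E) 𝓘(ℝ, E) e.symm (e x) (mfderiv 𝓘(ℝ, E) 𝓘(ℝ, E) e x X) : E) = X := by
  have h : e.symm ∘ e =ᶠ[nhds x] id :=
    Filter.eventuallyEq_of_mem (e.open_source.mem_nhds hx) fun z hz => e.left_inv hz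
  have h1 := h.mfderiv_eq (I := 𝓘(ℝ, E)) (I' := 𝓘(ℝ, E))
  rw [mfderiv_comp x (mdifferentiableAt_chart_symm he (e.map_source hx))
    (mdifferentiableAt_chart he hx), mfderiv_id] at h1
  exact DFunLike.congr_fun (F := E →L[ℝ] E) h1 X

theorem mfderiv_chart_mfderiv_chart_symm (he : e ∈ maximalAtlas 𝓘(ℝ, E) ∞ M) {y : E}
    (hy : y ∈ e.target) (v : E) :
    (mfderiv 𝓘(ℝ, E) 𝓘(ℝ, E) e (e.symm y) (mfderiv 𝓘(ℝ, E) 𝓘(ℝ, E) e.symm y v) : E) = v := by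
  rw [← fderiv_transition he he hy (e.map_target hy)]
  have h : e ∘ e.symm =ᶠ[nhds y] id :=
    Filter.eventuallyEq_of_mem (e.open_target.mem_nhds hy) fun z hz => e.right_inv hz
  rw [h.fderiv_eq, fderiv_id]
  rfl

/-- The transition rule: local expressions in two charts are related by pullback along the
transition map. -/
theorem localRep_transition {k : ℕ} (he : e ∈ maximalAtlas 𝓘(ℝ, E) ∞ M)
    (he' : e' ∈ maximalAtlas 𝓘(ℝ, E) ∞ M) (α : DiffForm E M k) {y : E} (hy : y ∈ e'.target)
    (hx : e'.symm y ∈ e.source) :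
    localRep e' α y = (localRep e α ((e ∘ e'.symm) y)).compContinuousLinearMap
      (fderiv ℝ (e ∘ e'.symm) y) := by
  ext v
  rw [ContinuousAlternatingMap.compContinuousLinearMap_apply, localRep_apply, localRep_apply]
  have h1 : e.symm ((e ∘ e'.symm) y) = e'.symm y := e.left_inv hx
  have h2 : ∀ i, (mfderiv 𝓘(ℝ, E) 𝓘(ℝ, E) e.symm ((e ∘ e'.symm) y)
      (fderiv ℝ (e ∘ e'.symm) y (v i)) : E) = mfderiv 𝓘(ℝ, E) 𝓘(ℝ, E) e'.symm y (v i) := fun i => by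
    rw [fderiv_transition he he' hy hx]
    exact mfderiv_chart_symm_mfderiv_chart he hx _
  exact formEval_congr α h1.symm (funext fun i => (h2 i).symm)

theorem localRep_transition_eventuallyEq {k : ℕ} (he : e ∈ maximalAtlas 𝓘(ℝ, E) ∞ M)
    (he' : e' ∈ maximalAtlas 𝓘(ℝ, E) ∞ M) (α : DiffForm E M k) {y : E} (hy : y ∈ e'.target)
    (hx : e'.symm y ∈ e.source) :
    localRep e' α =ᶠ[nhds y] fun z => (localRep e α ((e ∘ e'.symm) z)).compContinuousLinearMap
      (fderiv ℝ (e ∘ e'.symm) z) := by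
  have h1 : ∀ᶠ z in nhds y, z ∈ e'.target := e'.open_target.mem_nhds hy
  have h2 : ∀ᶠ z in nhds y, e'.symm z ∈ e.source :=
    (e'.continuousAt_symm hy).eventually (e.open_source.mem_nhds hx)
  filter_upwards [h1, h2] with z hz hz' using localRep_transition he he' α hz hz'

theorem contDiffAt_localRep_of_transition {k : ℕ} (he : e ∈ maximalAtlas 𝓘(ℝ, E) ∞ M)
    (he' : e' ∈ maximalAtlas 𝓘(ℝ, E) ∞ M) {α : DiffForm E M k} {y : E} (hy : y ∈ e'.target)
    (hx : e'.symm y ∈ e.source) (h : ContDiffAt ℝ ∞ (localRep e α) (e (e'.symm y))) :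
    ContDiffAt ℝ ∞ (localRep e' α) y := by
  refine ContDiffAt.congr_of_eventuallyEq ?_ (localRep_transition_eventuallyEq he he' α hy hx)
  have hτ := contDiffAt_transition he he' hy hx
  exact contDiffAt_compContinuousLinearMap (ContDiffAt.comp (g := localRep e α) y h hτ)
    (hτ.fderiv_right (m := ∞) (by simp))

theorem IsSmoothForm.contDiffAt {k : ℕ} {α : DiffForm E M k} (hα : IsSmoothForm α)
    (he : e ∈ maximalAtlas 𝓘(ℝ, E) ∞ M) {y : E} (hy : y ∈ e.target) :
    ContDiffAt ℝ ∞ (localRep e α) y := by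
  refine contDiffAt_localRep_of_transition
    (chart_mem_maximalAtlas (I := 𝓘(ℝ, E)) (n := ∞) (e.symm y)) he hy (mem_chart_source E _) ?_
  exact (hα _ (chart_mem_atlas E _)).contDiffAt ((chartAt E (e.symm y)).open_target.mem_nhds
    (mem_chart_target E _))

/-- Smoothness can be tested in a single chart of the maximal atlas around each point. -/
theorem isSmoothForm_of_charts {k : ℕ} {α : DiffForm E M k}
    (h : ∀ x, ∃ e ∈ maximalAtlas 𝓘(ℝ, E) ∞ M, x ∈ e.source ∧
      ContDiffAt ℝ ∞ (localRep e α) (e x)) : IsSmoothForm α := by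
  intro c hc y hy
  obtain ⟨e, he, hx, h⟩ := h (c.symm y)
  exact (contDiffAt_localRep_of_transition he (subset_maximalAtlas hc) hy hx h).contDiffWithinAt

/-- The exterior derivative may be computed in any chart. -/
theorem localRep_extD {k : ℕ} {α : DiffForm E M k} (hα : IsSmoothForm α)
    (he : e ∈ maximalAtlas 𝓘(ℝ, E) ∞ M) {y : E} (hy : y ∈ e.target) :
    localRep e (extD α) y = extDeriv (localRep e α) y := by
  set c := chartAt E (e.symm y) with hc
  have hcm : c ∈ maximalAtlas 𝓘(ℝ, E) ∞ M := chart_mem_maximalAtlas _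
  have hx : e.symm y ∈ c.source := mem_chart_source E _
  have hd : DifferentiableAt ℝ (localRep c α) ((c ∘ e.symm) y) :=
    (hα.contDiffAt hcm (c.map_source hx)).differentiableAt (by simp)
  rw [(localRep_transition_eventuallyEq hcm he α hy hx).extDeriv_eq,
    extDeriv_pullback hd (contDiffAt_transition hcm he hy hx) minSmoothness_two_le]
  ext v
  rw [ContinuousAlternatingMap.compContinuousLinearMap_apply]
  change extDeriv (localRep c α) (c (e.symm y)) _ = extDeriv (localRep c α) (c (e.symm y)) _
  congr 1
  funext i
  exact (fderiv_transition hcm he hy hx (v i)).symm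

theorem localRep_extD_eventuallyEq {k : ℕ} {α : DiffForm E M k} (hα : IsSmoothForm α)
    (he : e ∈ maximalAtlas 𝓘(ℝ, E) ∞ M) {y : E} (hy : y ∈ e.target) :
    localRep e (extD α) =ᶠ[nhds y] extDeriv (localRep e α) :=
  Filter.eventuallyEq_of_mem (e.open_target.mem_nhds hy) fun _ hz => localRep_extD hα he hz

theorem IsSmoothForm.extD {k : ℕ} {α : DiffForm E M k} (hα : IsSmoothForm α) :
    IsSmoothForm (extD α) := by
  refine isSmoothForm_of_charts fun x => ⟨chartAt E x, chart_mem_maximalAtlas x,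
    mem_chart_source E x, ?_⟩
  have hy := mem_chart_target E x
  refine ContDiffAt.congr_of_eventuallyEq ?_
    (localRep_extD_eventuallyEq hα (chart_mem_maximalAtlas x) hy)
  exact (ContinuousAlternatingMap.alternatizeUncurryFinCLM ℝ E ℝ).contDiff.contDiffAt.comp _
    ((hα.contDiffAt (chart_mem_maximalAtlas x) hy).fderiv_right (m := ∞) (by simp))

/-- A form is determined by its local expressions. -/
theorem form_eq_of_localRep {k : ℕ} {α β : DiffForm E M k} {x : M}
    (he : e ∈ maximalAtlas 𝓘(ℝ, E) ∞ M) (hx : x ∈ e.source)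
    (h : localRep e α (e x) = localRep e β (e x)) : α x = β x := by
  have key : ∀ (γ : DiffForm E M k) (v : Fin k → E), formEval γ x v =
      localRep e γ (e x) (fun i => mfderiv 𝓘(ℝ, E) 𝓘(ℝ, E) e x (v i)) := by
    intro γ v
    refine Eq.trans ?_ (localRep_apply e γ (e x) _).symm
    exact formEval_congr γ (e.left_inv hx).symm
      (funext fun i => (mfderiv_chart_symm_mfderiv_chart he hx (v i)).symm)
  ext v
  have := key α v
  rw [h, ← key β v] at this
  exact this

theorem extD_extD {k : ℕ} {α : DiffForm E M k} (hα : IsSmoothForm α) : extD (extD α) = 0 := by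
  funext x
  have he := chart_mem_maximalAtlas (I := 𝓘(ℝ, E)) (n := ∞) x
  have hy := mem_chart_target E x
  refine form_eq_of_localRep he (mem_chart_source E x) ?_
  rw [localRep_extD hα.extD he hy, (localRep_extD_eventuallyEq hα he hy).extDeriv_eq,
    extDeriv_extDeriv_apply (hα.contDiffAt he hy) minSmoothness_two_le]
  rfl

theorem compLinearMap_lefschetz {V W : Type*} [AddCommGroup V] [Module ℝ V] [AddCommGroup W]
    [Module ℝ W] (σ : V [⋀^Fin 2]→ₗ[ℝ] ℝ) {k : ℕ} (a : V [⋀^Fin k]→ₗ[ℝ] ℝ) (j : ℕ)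
    (f : W →ₗ[ℝ] V) : (lefschetz σ a j).compLinearMap f =
      lefschetz (σ.compLinearMap f) (a.compLinearMap f) j := by
  induction j with
  | zero => rfl
  | succ j ih =>
    simp only [lefschetz]
    rw [wedge_compLinearMap, ih]

theorem localRep_lefschetzForm (σ : DiffForm E M 2) {k : ℕ} (α : DiffForm E M k) (j : ℕ) (y : E) :
    localRep e (lefschetzForm σ α j) y = toCont (lefschetz (localRep e σ y).toAlternatingMap
      (localRep e α y).toAlternatingMap j) := by
  rw [localRep, lefschetzForm, compLinearMap_lefschetz]
  rfl

theorem IsSmoothForm.lefschetzForm {σ : DiffForm E M 2} (hσ : IsSmoothForm σ) {k : ℕ}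
    {α : DiffForm E M k} (hα : IsSmoothForm α) (j : ℕ) : IsSmoothForm (lefschetzForm σ α j) := by
  refine isSmoothForm_of_charts fun x => ⟨chartAt E x, chart_mem_maximalAtlas x,
    mem_chart_source E x, ?_⟩
  have he := chart_mem_maximalAtlas (I := 𝓘(ℝ, E)) (n := ∞) x
  have hy := mem_chart_target E x
  have := contDiffAt_lefschetz (hσ.contDiffAt he hy) (hα.contDiffAt he hy) j
  refine this.congr_of_eventuallyEq (Filter.Eventually.of_forall fun y => ?_)
  exact localRep_lefschetzForm σ α j y

/-- `d (α ∧ σ) = dα ∧ σ` for a closed two-form `σ`. -/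
theorem extD_wedge_two {σ : DiffForm E M 2} (hσ : IsSmoothForm σ) (hd : extD σ = 0) {k : ℕ}
    {α : DiffForm E M k} (hα : IsSmoothForm α) (x : M) :
    extD (fun z => wedge (α z) (σ z) : DiffForm E M (k + 2)) x =
      wedge (k := k + 1) (l := 2) (extD α x) (σ x) := by
  have he := chart_mem_maximalAtlas (I := 𝓘(ℝ, E)) (n := ∞) x
  have hy := mem_chart_target E x
  refine form_eq_of_localRep (α := extD (fun z => wedge (α z) (σ z) : DiffForm E M (k + 2)))
    (β := fun z => wedge (k := k + 1) (l := 2) (extD α z) (σ z)) he (mem_chart_source E x) ?_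
  have h1 : localRep (chartAt E x) (fun z => wedge (α z) (σ z) : DiffForm E M (k + 2)) =
      fun y => wedgeL E k 2 (localRep (chartAt E x) α y) (localRep (chartAt E x) σ y) := by
    funext y
    rw [wedgeL_apply, localRep, wedge_compLinearMap]
    rfl
  have hs : IsSmoothForm (fun z => wedge (α z) (σ z) : DiffForm E M (k + 2)) :=
    hσ.lefschetzForm hα 1
  have h0 : extDeriv (localRep (chartAt E x) σ) (chartAt E x x) = 0 := by
    rw [← localRep_extD hσ he hy, hd, localRep_zero]
    rfl
  rw [localRep_extD hs he hy, h1, extDeriv_wedge_two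
    ((hα.contDiffAt he hy).differentiableAt (by simp))
    ((hσ.contDiffAt he hy).differentiableAt (by simp)) h0, ← localRep_extD hα he hy, localRep,
    localRep, localRep, wedge_compLinearMap]
  rfl

/-- `d L^j α = L^j dα` for a closed two-form `σ`, at each point. -/
theorem single_extD_lefschetzForm {σ : DiffForm E M 2} (hσ : IsSmoothForm σ) (hd : extD σ = 0)
    {k : ℕ} {α : DiffForm E M k} (hα : IsSmoothForm α) (j : ℕ) (x : M) :
    (Pi.single (k + 2 * j + 1) (extD (lefschetzForm σ α j) x) :
      TotalForms (TangentSpace 𝓘(ℝ, E) x)) =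
      (lefschetzOp (σ x) ^ j) (Pi.single (k + 1) (extD α x)) := by
  induction j with
  | zero => rfl
  | succ j ih =>
    rw [pow_succ', Module.End.mul_apply, ← ih]
    have h := lefschetzOp_pow_single (σ x) (extD (lefschetzForm σ α j) x) 1
    rw [pow_one] at h
    rw [h]
    exact congrArg (Pi.single _) (extD_wedge_two hσ hd (hσ.lefschetzForm hα j) x)

end Charts


/-! ### Forms annihilated by a subspace -/

section Descent

variable {V W : Type*} [AddCommGroup V] [Module ℝ V] [AddCommGroup W] [Module ℝ W]
  {P : Submodule ℝ V} {k : ℕ}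

/-- A form is annihilated by contraction with the vectors of `P` if it vanishes as soon as one of
its arguments lies in `P` (no condition in degree `0`). -/
def IsAnnihilatedBy (P : Submodule ℝ V) {k : ℕ} (a : V [⋀^Fin k]→ₗ[ℝ] ℝ) : Prop :=
  ∀ (v : Fin k → V) (i : Fin k), v i ∈ P → a v = 0

theorem isAnnihilatedBy_iff_curryLeft {a : V [⋀^Fin (k + 1)]→ₗ[ℝ] ℝ} :
    IsAnnihilatedBy P a ↔ ∀ X ∈ P, a.curryLeft X = 0 := by
  constructor
  · intro h X hX
    ext v
    exact h _ 0 hX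
  · intro h v i hi
    have h1 := a.map_perm v (Equiv.swap 0 i)
    have h2 : a (v ∘ Equiv.swap 0 i) = 0 := by
      have h3 := DFunLike.congr_fun (h (v i) hi) (Fin.tail (v ∘ Equiv.swap 0 i))
      rw [AlternatingMap.curryLeft_apply_apply] at h3
      have h4 : Matrix.vecCons (v i) (Fin.tail (v ∘ Equiv.swap 0 i)) = v ∘ Equiv.swap 0 i := by
        conv_rhs => rw [← Fin.cons_self_tail (v ∘ Equiv.swap 0 i)]
        simp [Matrix.vecCons]
      rw [h4] at h3
      exact h3
    rw [h2] at h1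
    rcases Int.units_eq_one_or (Equiv.Perm.sign (Equiv.swap 0 i)) with h5 | h5 <;>
      simpa [h5] using h1.symm

theorem IsAnnihilatedBy.curryLeft {a : V [⋀^Fin (k + 1)]→ₗ[ℝ] ℝ} (h : IsAnnihilatedBy P a) {X : V}
    (hX : X ∈ P) : a.curryLeft X = 0 :=
  isAnnihilatedBy_iff_curryLeft.1 h X hX

theorem isAnnihilatedBy_zero : IsAnnihilatedBy P (0 : V [⋀^Fin k]→ₗ[ℝ] ℝ) := fun _ _ _ => rfl

theorem isAnnihilatedBy_compLinearMap {f : V →ₗ[ℝ] W} (hf : ∀ X ∈ P, f X = 0)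
    (c : W [⋀^Fin k]→ₗ[ℝ] ℝ) : IsAnnihilatedBy P (c.compLinearMap f) := fun _ i hi =>
  c.map_coord_zero i (hf _ hi)

theorem IsAnnihilatedBy.congr {a : V [⋀^Fin k]→ₗ[ℝ] ℝ} (h : IsAnnihilatedBy P a) {v w : Fin k → V}
    (hvw : ∀ i, v i - w i ∈ P) : a v = a w := by
  have key : ∀ s : Finset (Fin k), a (s.piecewise v w) = a w := by
    intro s
    induction s using Finset.induction_on with
    | empty => simp
    | insert i s his ih =>
      rw [Finset.piecewise_insert, ← sub_eq_zero, ← ih]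
      conv_lhs => rw [← Function.update_eq_self i (s.piecewise v w)]
      rw [Function.update_idem, ← a.map_update_sub]
      refine h _ i ?_
      rw [Function.update_self, Finset.piecewise_eq_of_notMem _ _ _ his]
      exact hvw i
  simpa using key Finset.univ

theorem IsAnnihilatedBy.compLinearMap_section {a : V [⋀^Fin k]→ₗ[ℝ] ℝ} (h : IsAnnihilatedBy P a)
    {f : V →ₗ[ℝ] W} (hf : ∀ X, f X = 0 → X ∈ P) {g : W →ₗ[ℝ] V} (hg : ∀ w, f (g w) = w) :
    (a.compLinearMap g).compLinearMap f = a := by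
  ext v
  exact h.congr fun i => hf _ (by simp [hg])

theorem IsAnnihilatedBy.compLinearMap_descend {a : V [⋀^Fin k]→ₗ[ℝ] ℝ} (h : IsAnnihilatedBy P a) :
    (descend P a).compLinearMap P.mkQ = a := by
  have hex : ∃ c : (V ⧸ P) [⋀^Fin k]→ₗ[ℝ] ℝ, c.compLinearMap P.mkQ = a := by
    obtain ⟨g, hg⟩ := P.mkQ.exists_rightInverse_of_surjective (LinearMap.range_eq_top.2
      P.mkQ_surjective)
    exact ⟨a.compLinearMap g, h.compLinearMap_section (fun X hX => by simpa using hX)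
      (LinearMap.congr_fun hg)⟩
  rw [descend, dif_pos hex]
  exact hex.choose_spec

theorem compLinearMap_mkQ_injective {c c' : (V ⧸ P) [⋀^Fin k]→ₗ[ℝ] ℝ}
    (h : c.compLinearMap P.mkQ = c'.compLinearMap P.mkQ) : c = c' :=
  AlternatingMap.compLinearMap_injective _ P.mkQ_surjective h

theorem descend_eq {a : V [⋀^Fin k]→ₗ[ℝ] ℝ} {c : (V ⧸ P) [⋀^Fin k]→ₗ[ℝ] ℝ}
    (h : c.compLinearMap P.mkQ = a) : descend P a = c := by
  refine compLinearMap_mkQ_injective ?_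
  rw [h]
  refine IsAnnihilatedBy.compLinearMap_descend ?_
  rw [← h]
  exact isAnnihilatedBy_compLinearMap (fun X hX => by simpa using hX) c

theorem descend_add {a b : V [⋀^Fin k]→ₗ[ℝ] ℝ} (ha : IsAnnihilatedBy P a)
    (hb : IsAnnihilatedBy P b) : descend P (a + b) = descend P a + descend P b := by
  refine descend_eq ?_
  conv_rhs => rw [← ha.compLinearMap_descend, ← hb.compLinearMap_descend]
  rfl

theorem descend_smul {a : V [⋀^Fin k]→ₗ[ℝ] ℝ} (ha : IsAnnihilatedBy P a) (c : ℝ) :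
    descend P (c • a) = c • descend P a := by
  refine descend_eq ?_
  conv_rhs => rw [← ha.compLinearMap_descend]
  rfl

theorem IsAnnihilatedBy.lefschetz {σ : V [⋀^Fin 2]→ₗ[ℝ] ℝ} (hσ : IsAnnihilatedBy P σ)
    {a : V [⋀^Fin k]→ₗ[ℝ] ℝ} (ha : IsAnnihilatedBy P a) (j : ℕ) :
    (TransverseHodge.lefschetz (descend P σ) (descend P a) j).compLinearMap P.mkQ =
      TransverseHodge.lefschetz σ a j := by
  rw [compLinearMap_lefschetz, hσ.compLinearMap_descend, ha.compLinearMap_descend]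

/-- A two-form induces a symplectic form on the quotient by its kernel. -/
theorem flat_descend_bijective [FiniteDimensional ℝ V] {σ : V [⋀^Fin 2]→ₗ[ℝ] ℝ}
    (hσ : ∀ X, X ∈ P ↔ ∀ Y, σ ![X, Y] = 0) :
    IsAnnihilatedBy P σ ∧ Function.Bijective (flat (descend P σ)) := by
  have ha : IsAnnihilatedBy P σ := by
    refine isAnnihilatedBy_iff_curryLeft.2 fun X hX => ?_
    ext v
    have h1 := (hσ X).1 hX (v 0)
    rw [AlternatingMap.curryLeft_apply_apply, AlternatingMap.zero_apply, ← h1]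
    congr 1
    funext i
    fin_cases i <;> rfl
  refine ⟨ha, ?_⟩
  have hinj : Function.Injective (flat (descend P σ)) := by
    rw [← LinearMap.ker_eq_bot, LinearMap.ker_eq_bot']
    intro x hx
    obtain ⟨X, rfl⟩ := P.mkQ_surjective x
    rw [Submodule.mkQ_apply, Submodule.Quotient.mk_eq_zero, hσ]
    intro Y
    have h1 := LinearMap.congr_fun hx (P.mkQ Y)
    rw [← ha.compLinearMap_descend, AlternatingMap.compLinearMap_apply]
    refine Eq.trans ?_ h1
    change _ = descend P σ _
    congr 1
    funext i
    fin_cases i <;> rfl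
  exact ⟨hinj, (LinearMap.injective_iff_surjective_of_finrank_eq_finrank
    Subspace.dual_finrank_eq.symm).1 hinj⟩

end Descent

/-! ### Foliation charts and horizontal forms -/

section Horizontal

variable {E : Type*} [NormedAddCommGroup E] [NormedSpace ℝ E] [FiniteDimensional ℝ E]
  {M : Type*} [TopologicalSpace M] [ChartedSpace E M] [IsManifold 𝓘(ℝ, E) ∞ M] {q : ℕ}

open IsManifold

/-- `(φ, π)` is a foliation chart: the leaves in the domain of `φ` are the fibres of `π ∘ φ`. -/
structure IsFoliationChart (F : Foliation E M q) (φ : OpenPartialHomeomorph M E)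
    (π : E →L[ℝ] (Fin q → ℝ)) : Prop where
  mem : φ ∈ maximalAtlas 𝓘(ℝ, E) ∞ M
  surjective : Function.Surjective π
  mem_tangent_iff : ∀ z ∈ φ.source, ∀ X : TangentSpace 𝓘(ℝ, E) z,
    X ∈ F.tangent z ↔ π (mfderiv 𝓘(ℝ, E) 𝓘(ℝ, E) φ z X : E) = 0

theorem Foliation.exists_isFoliationChart (F : Foliation E M q) (p : M) :
    ∃ φ π, IsFoliationChart F φ π ∧ p ∈ φ.source := by
  obtain ⟨φ, hφ, hp, π, hπ, h⟩ := F.exists_foliationChart p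
  exact ⟨φ, π, ⟨hφ, hπ, h⟩, hp⟩

variable {F : Foliation E M q} {φ : OpenPartialHomeomorph M E} {π : E →L[ℝ] (Fin q → ℝ)}

theorem IsFoliationChart.symm_mem_tangent (h : IsFoliationChart F φ π) {y : E} (hy : y ∈ φ.target)
    (v : E) : mfderiv 𝓘(ℝ, E) 𝓘(ℝ, E) φ.symm y v ∈ F.tangent (φ.symm y) ↔ π v = 0 := by
  rw [h.mem_tangent_iff _ (φ.map_target hy)]
  exact iff_of_eq (congrArg (fun w : E => π w = 0) (mfderiv_chart_mfderiv_chart_symm h.mem hy v))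

theorem Foliation.finrank_quotient (F : Foliation E M q) (x : M) :
    Module.finrank ℝ (TangentSpace 𝓘(ℝ, E) x ⧸ F.tangent x) = q := by
  obtain ⟨φ, π, h, hx⟩ := F.exists_isFoliationChart x
  let f : TangentSpace 𝓘(ℝ, E) x →ₗ[ℝ] (Fin q → ℝ) :=
    π.toLinearMap ∘ₗ (mfderiv 𝓘(ℝ, E) 𝓘(ℝ, E) φ x).toLinearMap
  have hker : F.tangent x = LinearMap.ker f := by
    ext X
    exact h.mem_tangent_iff x hx X
  have hsurj : Function.Surjective f := by
    intro w
    obtain ⟨v, rfl⟩ := h.surjective w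
    have h1 := mfderiv_chart_mfderiv_chart_symm h.mem (φ.map_source hx) v
    have h2 : φ.symm (φ x) = x := φ.left_inv hx
    have h3 : ∀ x', x' = x → (∃ X : TangentSpace 𝓘(ℝ, E) x',
        (mfderiv 𝓘(ℝ, E) 𝓘(ℝ, E) φ x' X : E) = v) →
        ∃ X : TangentSpace 𝓘(ℝ, E) x, (mfderiv 𝓘(ℝ, E) 𝓘(ℝ, E) φ x X : E) = v := by
      rintro _ rfl h
      exact h
    obtain ⟨X, hX⟩ := h3 _ h2 ⟨_, h1⟩
    exact ⟨X, congrArg π hX⟩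
  rw [hker, (f.quotKerEquivOfSurjective hsurj).finrank_eq, Module.finrank_fin_fun]

/-- In a foliation chart, a form annihilated by the leaves is annihilated by `ker π`. -/
theorem IsFoliationChart.isAnnihilatedBy_iff (h : IsFoliationChart F φ π) {k : ℕ}
    (α : DiffForm E M k) {y : E} (hy : y ∈ φ.target) :
    IsAnnihilatedBy (F.tangent (φ.symm y)) (α (φ.symm y)) ↔
      IsAnnihilatedBy (LinearMap.ker π.toLinearMap) (localRep φ α y).toAlternatingMap := by
  constructor
  · intro H v i hi
    exact H _ i ((h.symm_mem_tangent hy _).2 hi)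
  · intro H v i hi
    have h1 := H (fun i => (mfderiv 𝓘(ℝ, E) 𝓘(ℝ, E) φ (φ.symm y) (v i) : E)) i
      ((h.mem_tangent_iff _ (φ.map_target hy) _).1 hi)
    refine Eq.trans ?_ h1
    refine Eq.trans (b := formEval α (φ.symm y) v) rfl ?_
    refine Eq.trans ?_ (localRep_apply φ α y _).symm
    refine congrArg (formEval α (φ.symm y)) (funext fun i => ?_)
    have h2 := mfderiv_chart_symm_mfderiv_chart h.mem (φ.map_target hy) (v i)
    rw [φ.right_inv hy] at h2
    exact h2.symm

end Horizontal


section BasicForms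

variable {E : Type*} [NormedAddCommGroup E] [NormedSpace ℝ E] [FiniteDimensional ℝ E]
  {M : Type*} [TopologicalSpace M] [ChartedSpace E M] [IsManifold 𝓘(ℝ, E) ∞ M] {q : ℕ}

open IsManifold

variable {F : Foliation E M q} {φ : OpenPartialHomeomorph M E} {π : E →L[ℝ] (Fin q → ℝ)}

theorem isInvertible_mfderiv_chart (he : φ ∈ maximalAtlas 𝓘(ℝ, E) ∞ M) {x : M}
    (hx : x ∈ φ.source) : (mfderiv 𝓘(ℝ, E) 𝓘(ℝ, E) φ x).IsInvertible := by
  refine ContinuousLinearMap.IsInvertible.of_inverse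
    (g := (mfderiv 𝓘(ℝ, E) 𝓘(ℝ, E) φ.symm (φ x) : E →L[ℝ] E)) ?_ ?_
  · have h1 : ∀ v : E, (mfderiv 𝓘(ℝ, E) 𝓘(ℝ, E) φ (φ.symm (φ x)) : E →L[ℝ] E)
        ((mfderiv 𝓘(ℝ, E) 𝓘(ℝ, E) φ.symm (φ x) : E →L[ℝ] E) v) = v :=
      mfderiv_chart_mfderiv_chart_symm he (φ.map_source hx)
    have h2 : ∀ x', x' = x → (∀ v : E, (mfderiv 𝓘(ℝ, E) 𝓘(ℝ, E) φ x' : E →L[ℝ] E)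
        ((mfderiv 𝓘(ℝ, E) 𝓘(ℝ, E) φ.symm (φ x) : E →L[ℝ] E) v) = v) →
        ∀ v : E, (mfderiv 𝓘(ℝ, E) 𝓘(ℝ, E) φ x : E →L[ℝ] E)
        ((mfderiv 𝓘(ℝ, E) 𝓘(ℝ, E) φ.symm (φ x) : E →L[ℝ] E) v) = v := by
      rintro _ rfl h
      exact h
    exact ContinuousLinearMap.ext (h2 _ (φ.left_inv hx) h1)
  · exact ContinuousLinearMap.ext (mfderiv_chart_symm_mfderiv_chart he hx)

/-- Every vector tangent to a leaf extends to a smooth vector field tangent to the leaves: extend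
it to a constant field in a foliation chart and multiply by a bump function. -/
theorem Foliation.exists_section [T2Space M] (F : Foliation E M q) {x : M}
    {X : TangentSpace 𝓘(ℝ, E) x} (hX : X ∈ F.tangent x) : ∃ Y ∈ F.sections, Y x = X := by
  obtain ⟨φ, π, h, hx⟩ := F.exists_isFoliationChart x
  let w : E := mfderiv 𝓘(ℝ, E) 𝓘(ℝ, E) φ x X
  have hw : π w = 0 := (h.mem_tangent_iff x hx X).1 hX
  let W : (y : E) → TangentSpace 𝓘(ℝ, E) y := fun _ => w
  obtain ⟨f, -, hf⟩ := (SmoothBumpFunction.nhds_basis_tsupport (I := 𝓘(ℝ, E)) x).mem_iff.1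
    (φ.open_source.mem_nhds hx)
  refine ⟨(f : M → ℝ) • VectorField.mpullback 𝓘(ℝ, E) 𝓘(ℝ, E) φ W, ⟨?_, fun z => ?_⟩, ?_⟩
  · refine ContMDiffOn.smul_section_of_tsupport f.contMDiff.contMDiffOn φ.open_source hf ?_
    intro z hz
    refine ContMDiffAt.contMDiffWithinAt ?_
    refine ContMDiffAt.mpullback_vectorField_preimage (n := ∞) ?_
      (contMDiffAt_of_mem_maximalAtlas h.mem hz) (isInvertible_mfderiv_chart h.mem hz) (by simp)
    exact contMDiffAt_vectorSpace_iff_contDiffAt.2 contDiffAt_const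
  · change f z • VectorField.mpullback 𝓘(ℝ, E) 𝓘(ℝ, E) φ W z ∈ F.tangent z
    by_cases hz : z ∈ φ.source
    · refine Submodule.smul_mem _ _ ((h.mem_tangent_iff z hz _).2 ?_)
      have h1 : mfderiv 𝓘(ℝ, E) 𝓘(ℝ, E) φ z
          ((mfderiv 𝓘(ℝ, E) 𝓘(ℝ, E) φ z).inverse (W (φ z))) = W (φ z) :=
        (isInvertible_mfderiv_chart h.mem hz).self_apply_inverse _
      exact (congrArg (fun u : E => π u) h1).trans hw
    · have : f z = 0 := by
        by_contra hne
        exact hz (hf (subset_tsupport _ hne))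
      rw [this, zero_smul]
      exact zero_mem _
  · change f x • VectorField.mpullback 𝓘(ℝ, E) 𝓘(ℝ, E) φ W x = X
    rw [f.eq_one, one_smul]
    exact (isInvertible_mfderiv_chart h.mem hx).inverse_apply_self X

/-- Forms annihilated pointwise by the tangent spaces of the leaves. -/
def IsTransverse (F : Foliation E M q) {k : ℕ} (α : DiffForm E M k) : Prop :=
  ∀ x, IsAnnihilatedBy (F.tangent x) (α x)

theorem isTransverse_iff_contract [T2Space M] {k : ℕ} {α : DiffForm E M (k + 1)} :
    IsTransverse F α ↔ ∀ X ∈ F.sections, contract X α = 0 := by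
  constructor
  · intro h X hX
    funext x
    exact (h x).curryLeft (hX.2 x)
  · intro h x
    refine isAnnihilatedBy_iff_curryLeft.2 fun X hX => ?_
    obtain ⟨Y, hY, rfl⟩ := F.exists_section hX
    exact congrFun (h Y hY) x

/-- By Cartan's formula, a form is basic iff it is smooth and both the form and its differential are
annihilated by the tangent spaces of the leaves. -/
theorem isBasic_iff [T2Space M] {k : ℕ} {α : DiffForm E M k} :
    IsBasic F α ↔ IsSmoothForm α ∧ IsTransverse F α ∧ IsTransverse F (extD α) := by
  refine and_congr_right fun _ => ?_
  cases k with
  | zero =>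
    rw [isTransverse_iff_contract]
    exact and_congr_left fun _ => ⟨fun _ x v i => i.elim0, fun _ => trivial⟩
  | succ k =>
    rw [isTransverse_iff_contract, isTransverse_iff_contract]
    refine and_congr_right fun h => ?_
    refine forall₂_congr fun X hX => ?_
    change extD (contract X α) + contract X (extD α) = 0 ↔ _
    rw [h X hX, extD_zero, zero_add]

/-- If `α` is transverse, then `dα` vanishes on two vectors tangent to the leaves. In a foliation
chart this holds because the vectors may be extended to constant fields. -/
theorem IsTransverse.extD_apply_eq_zero {k : ℕ} {α : DiffForm E M k} (hs : IsSmoothForm α)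
    (h : IsTransverse F α) {x : M} {v : Fin (k + 1) → TangentSpace 𝓘(ℝ, E) x} {i j : Fin (k + 1)}
    (hij : i ≠ j) (hi : v i ∈ F.tangent x) (hj : v j ∈ F.tangent x) : extD α x v = 0 := by
  obtain ⟨φ, π, hφ, hx⟩ := F.exists_isFoliationChart x
  have hy := φ.map_source hx
  let w : Fin (k + 1) → E := fun i => mfderiv 𝓘(ℝ, E) 𝓘(ℝ, E) φ x (v i)
  have hw : ∀ i, v i ∈ F.tangent x → π (w i) = 0 := fun i hi => (hφ.mem_tangent_iff x hx _).1 hi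
  have key : localRep φ (extD α) (φ x) w = 0 := by
    rw [localRep_extD hs hφ.mem hy,
      extDeriv_apply ((hs.contDiffAt hφ.mem hy).differentiableAt (by simp))]
    refine Finset.sum_eq_zero fun l _ => ?_
    -- one of the two tangent vectors is among the arguments of the form that is differentiated
    obtain ⟨m, hm⟩ : ∃ m, π (l.removeNth w m) = 0 := by
      by_cases hl : l = i
      · obtain ⟨m, hm⟩ := Fin.exists_succAbove_eq (x := j) (y := l) (by rw [hl]; exact hij.symm)
        exact ⟨m, by rw [Fin.removeNth_apply, hm]; exact hw j hj⟩
      · obtain ⟨m, hm⟩ := Fin.exists_succAbove_eq (x := i) (y := l) (Ne.symm hl)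
        exact ⟨m, by rw [Fin.removeNth_apply, hm]; exact hw i hi⟩
    have h0 : (fun y => localRep φ α y (l.removeNth w)) =ᶠ[nhds (φ x)] fun _ => 0 :=
      Filter.eventuallyEq_of_mem (φ.open_target.mem_nhds hy) fun y hy' =>
        (hφ.isAnnihilatedBy_iff α hy').1 (h _) _ m hm
    rw [h0.fderiv_eq]
    simp
  rw [← key, localRep_apply]
  exact formEval_congr _ (φ.left_inv hx).symm
    (funext fun i => (mfderiv_chart_symm_mfderiv_chart hφ.mem hx (v i)).symm)

theorem IsTransverse.extD_curryLeft {k : ℕ} {α : DiffForm E M k} (hs : IsSmoothForm α)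
    (h : IsTransverse F α) {x : M} {X : TangentSpace 𝓘(ℝ, E) x} (hX : X ∈ F.tangent x) :
    IsAnnihilatedBy (F.tangent x) ((extD α x).curryLeft X) := fun v i hi =>
  h.extD_apply_eq_zero hs (v := Matrix.vecCons X v) (i := 0) (j := i.succ)
    (Fin.succ_ne_zero i).symm hX hi

theorem isTransverse_zero {k : ℕ} : IsTransverse F (0 : DiffForm E M k) :=
  fun _ => isAnnihilatedBy_zero

variable [T2Space M]

theorem extD_mem_basicForms {k : ℕ} {α : DiffForm E M k} (hα : α ∈ basicForms F k) :
    extD α ∈ basicForms F (k + 1) := by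
  obtain ⟨h1, -, h3⟩ := isBasic_iff.1 hα
  refine isBasic_iff.2 ⟨h1.extD, h3, ?_⟩
  rw [extD_extD h1]
  exact isTransverse_zero

end BasicForms


/-! ### The Lefschetz operator on basic forms -/

section BasicLefschetz

variable {E : Type*} [NormedAddCommGroup E] [NormedSpace ℝ E] [FiniteDimensional ℝ E]
  {M : Type*} [TopologicalSpace M] [ChartedSpace E M] [IsManifold 𝓘(ℝ, E) ∞ M] {n : ℕ}
  {F : Foliation E M (2 * n)} {σ : DiffForm E M 2}

open IsManifold

instance finiteDimensional_tangentSpace (x : M) :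
    FiniteDimensional ℝ (TangentSpace 𝓘(ℝ, E) x) := inferInstanceAs (FiniteDimensional ℝ E)

theorem IsTransverselySymplectic.isTransverse (hσ : IsTransverselySymplectic F σ) :
    IsTransverse F σ := fun x => (flat_descend_bijective (hσ.ker_eq x)).1

theorem IsTransverselySymplectic.flat_bijective (hσ : IsTransverselySymplectic F σ) (x : M) :
    Function.Bijective (flat (descend (F.tangent x) (σ x))) :=
  (flat_descend_bijective (hσ.ker_eq x)).2

theorem isAnnihilatedBy_lefschetz {V : Type*} [AddCommGroup V] [Module ℝ V] {P : Submodule ℝ V}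
    {s : V [⋀^Fin 2]→ₗ[ℝ] ℝ} (hs : IsAnnihilatedBy P s) {k : ℕ} {a : V [⋀^Fin k]→ₗ[ℝ] ℝ}
    (ha : IsAnnihilatedBy P a) (j : ℕ) : IsAnnihilatedBy P (lefschetz s a j) := by
  rw [← hs.lefschetz ha]
  exact isAnnihilatedBy_compLinearMap (fun X hX => by simpa using hX) _

theorem wedge_mem_basicForms [T2Space M] (hσ : IsTransverselySymplectic F σ) {k : ℕ}
    {α : DiffForm E M k} (hα : α ∈ basicForms F k) :
    (fun x => wedge (α x) (σ x) : DiffForm E M (k + 2)) ∈ basicForms F (k + 2) := by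
  obtain ⟨h1, h2, h3⟩ := isBasic_iff.1 hα
  refine isBasic_iff.2 ⟨hσ.smooth.lefschetzForm h1 1, fun x => ?_, fun x => ?_⟩
  · exact isAnnihilatedBy_lefschetz (hσ.isTransverse x) (h2 x) 1
  · rw [extD_wedge_two hσ.smooth hσ.closed h1]
    exact isAnnihilatedBy_lefschetz (hσ.isTransverse x) (h3 x) 1

/-- In a foliation chart, the local expression of a transversely symplectic form is pulled back
from a symplectic form on `ℝ^{2n}`. -/
theorem IsFoliationChart.flat_localRep_bijective (hσ : IsTransverselySymplectic F σ)
    {φ : OpenPartialHomeomorph M E} {π : E →L[ℝ] (Fin (2 * n) → ℝ)} (h : IsFoliationChart F φ π)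
    {ι : (Fin (2 * n) → ℝ) →ₗ[ℝ] E} (hι : ∀ w, π (ι w) = w) {y : E} (hy : y ∈ φ.target) :
    Function.Bijective (flat ((localRep φ σ y).toAlternatingMap.compLinearMap ι)) := by
  have hann := (h.isAnnihilatedBy_iff σ hy).1 (hσ.isTransverse _)
  have hpull := hann.compLinearMap_section (f := π.toLinearMap) (fun X hX => hX) hι
  set s := (localRep φ σ y).toAlternatingMap.compLinearMap ι with hs
  have hinj : Function.Injective (flat s) := by
    rw [← LinearMap.ker_eq_bot, LinearMap.ker_eq_bot']
    intro u hu
    rw [← hι u, ← h.symm_mem_tangent hy, hσ.ker_eq]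
    intro Y
    let v : E := mfderiv 𝓘(ℝ, E) 𝓘(ℝ, E) φ (φ.symm y) Y
    have h1 := mfderiv_chart_symm_mfderiv_chart h.mem (φ.map_target hy) Y
    rw [φ.right_inv hy] at h1
    have h2 : localRep φ σ y ![ι u, v] = 0 := by
      change (localRep φ σ y).toAlternatingMap ![ι u, v] = 0
      rw [← hpull, AlternatingMap.compLinearMap_apply]
      refine Eq.trans ?_ (LinearMap.congr_fun hu (π v))
      change s _ = s _
      congr 1
      funext i
      fin_cases i
      · exact hι u
      · rfl
    rw [← h2, localRep_apply]
    refine congrArg (formEval σ (φ.symm y)) (funext fun i => ?_)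
    fin_cases i
    · rfl
    · exact h1.symm
  exact ⟨hinj, (LinearMap.injective_iff_surjective_of_finrank_eq_finrank
    Subspace.dual_finrank_eq.symm).1 hinj⟩

theorem contDiffAt_of_clm_apply {D H K : Type*} [NormedAddCommGroup D] [NormedSpace ℝ D]
    [NormedAddCommGroup H] [NormedSpace ℝ H] [FiniteDimensional ℝ H] [NormedAddCommGroup K]
    [NormedSpace ℝ K] {r : WithTop ℕ∞} {f : D → H →L[ℝ] K} {x : D}
    (h : ∀ v, ContDiffAt ℝ r (fun y => f y v) x) : ContDiffAt ℝ r f x := by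
  let b := Module.finBasis ℝ H
  have h1 : f = fun y => ∑ i, ContinuousLinearMap.smulRightL ℝ H K
      (LinearMap.toContinuousLinearMap (b.coord i)) (f y (b i)) := by
    funext y
    ext v
    conv_lhs => rw [← b.sum_repr v, map_sum]
    simp only [map_smul, sum_apply]
    rfl
  rw [h1]
  exact ContDiffAt.sum fun i _ =>
    (ContinuousLinearMap.smulRightL ℝ H K _).contDiff.contDiffAt.comp x (h _)

/-- The operator `L^j` between spaces of forms on a vector space, depending smoothly on the
two-form. -/
theorem contDiffAt_lefschetzₗ {D H : Type*} [NormedAddCommGroup D] [NormedSpace ℝ D]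
    [NormedAddCommGroup H] [NormedSpace ℝ H] [FiniteDimensional ℝ H]
    {s : D → H [⋀^Fin 2]→L[ℝ] ℝ} {x : D} (hs : ContDiffAt ℝ ∞ s x) (k j : ℕ) :
    ContDiffAt ℝ ∞ (fun y => LinearMap.toContinuousLinearMap
      ((toContEquiv H (k + 2 * j)).toLinearMap ∘ₗ lefschetzₗ (s y).toAlternatingMap k j ∘ₗ
        (toContEquiv H k).symm.toLinearMap)) x :=
  contDiffAt_of_clm_apply fun v => contDiffAt_lefschetz hs (contDiffAt_const (c := v)) j

/-- A transverse form is smooth as soon as its image under the pointwise injective operator `L^j`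
is: in a foliation chart it is obtained by applying a smooth family of inverse operators. -/
theorem isSmoothForm_of_lefschetzForm (hσ : IsTransverselySymplectic F σ) {k j : ℕ}
    (hk : k + j = n) {α : DiffForm E M k} (hα : IsTransverse F α)
    (h : IsSmoothForm (lefschetzForm σ α j)) : IsSmoothForm α := by
  refine isSmoothForm_of_charts fun x => ?_
  obtain ⟨φ, π, hφ, hx⟩ := F.exists_isFoliationChart x
  refine ⟨φ, hφ.mem, hx, ?_⟩
  have hy := φ.map_source hx
  obtain ⟨ι, hι'⟩ := π.toLinearMap.exists_rightInverse_of_surjective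
    (LinearMap.range_eq_top.2 hφ.surjective)
  have hι : ∀ w, π (ι w) = w := LinearMap.congr_fun hι'
  let s : E → (Fin (2 * n) → ℝ) [⋀^Fin 2]→L[ℝ] ℝ := fun y =>
    (localRep φ σ y).compContinuousLinearMap (LinearMap.toContinuousLinearMap ι)
  let c : E → (Fin (2 * n) → ℝ) [⋀^Fin (k + 2 * j)]→L[ℝ] ℝ := fun y =>
    (localRep φ (lefschetzForm σ α j) y).compContinuousLinearMap (LinearMap.toContinuousLinearMap ι)
  let T : E → ((Fin (2 * n) → ℝ) [⋀^Fin k]→L[ℝ] ℝ) →L[ℝ]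
      ((Fin (2 * n) → ℝ) [⋀^Fin (k + 2 * j)]→L[ℝ] ℝ) := fun y => LinearMap.toContinuousLinearMap
    ((toContEquiv _ (k + 2 * j)).toLinearMap ∘ₗ lefschetzₗ (s y).toAlternatingMap k j ∘ₗ
      (toContEquiv _ k).symm.toLinearMap)
  have hs : ContDiffAt ℝ ∞ s (φ x) :=
    contDiffAt_compContinuousLinearMap (hσ.smooth.contDiffAt hφ.mem hy) contDiffAt_const
  have hc : ContDiffAt ℝ ∞ c (φ x) :=
    contDiffAt_compContinuousLinearMap (h.contDiffAt hφ.mem hy) contDiffAt_const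
  have hT : ContDiffAt ℝ ∞ T (φ x) := contDiffAt_lefschetzₗ hs k j
  have hbij : ∀ y ∈ φ.target, Function.Bijective (T y) := fun y hy =>
    (toContEquiv _ (k + 2 * j)).bijective.comp ((lefschetzₗ_bijective
      (hφ.flat_localRep_bijective hσ hι hy) (Module.finrank_fin_fun ℝ) hk).comp
        (toContEquiv _ k).symm.bijective)
  have hinv : ∀ y ∈ φ.target, ∃ e : ((Fin (2 * n) → ℝ) [⋀^Fin k]→L[ℝ] ℝ) ≃L[ℝ]
      ((Fin (2 * n) → ℝ) [⋀^Fin (k + 2 * j)]→L[ℝ] ℝ), (e : _ →L[ℝ] _) = T y := fun y hy =>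
    ⟨(LinearEquiv.ofBijective (T y).toLinearMap (hbij y hy)).toContinuousLinearEquiv, rfl⟩
  have hTinv : ContDiffAt ℝ ∞ (fun y => (T y).inverse (c y)) (φ x) := by
    obtain ⟨e, he⟩ := hinv _ hy
    have h1 := contDiffAt_map_inverse (𝕜 := ℝ) (n := ∞) e
    rw [he] at h1
    exact (h1.comp (φ x) hT).clm_apply hc
  refine (contDiffAt_compContinuousLinearMap hTinv
    (contDiffAt_const (c := π))).congr_of_eventuallyEq ?_
  refine Filter.eventuallyEq_of_mem (φ.open_target.mem_nhds hy) fun y hy => ?_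
  -- the local expression of `α` is pulled back from `b`, and `L^j b = c`
  let b := (localRep φ α y).compContinuousLinearMap (LinearMap.toContinuousLinearMap ι)
  have hb : T y b = c y := by
    change toCont (lefschetz ((localRep φ σ y).toAlternatingMap.compLinearMap ι)
      ((localRep φ α y).toAlternatingMap.compLinearMap ι) j) = _
    rw [← compLinearMap_lefschetz]
    change _ = (localRep φ (lefschetzForm σ α j) y).compContinuousLinearMap
      (LinearMap.toContinuousLinearMap ι)
    rw [localRep_lefschetzForm]
    rfl
  obtain ⟨e, he⟩ := hinv y hy
  have hb' : (T y).inverse (c y) = b := by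
    rw [← hb, ← he, ContinuousLinearMap.inverse_equiv]
    exact e.symm_apply_apply b
  change localRep φ α y = ((T y).inverse (c y)).compContinuousLinearMap π
  rw [hb']
  have hann := (hφ.isAnnihilatedBy_iff α hy).1 (hα _)
  have hpull := hann.compLinearMap_section (f := π.toLinearMap) (fun X hX => hX) hι
  ext v
  exact (DFunLike.congr_fun hpull v).symm

theorem contractOp_single {V : Type*} [AddCommGroup V] [Module ℝ V] (X : V) {k : ℕ}
    (a : V [⋀^Fin (k + 1)]→ₗ[ℝ] ℝ) :
    contractOp X (Pi.single (k + 1) a) = Pi.single k (a.curryLeft X) := by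
  funext l
  change (Pi.single (M := fun k => V [⋀^Fin k]→ₗ[ℝ] ℝ) (k + 1) a (l + 1)).curryLeft X = _
  by_cases hl : l = k
  · subst hl
    rw [Pi.single_eq_same, Pi.single_eq_same]
  · rw [Pi.single_eq_of_ne hl, Pi.single_eq_of_ne (by omega)]
    rfl

theorem extMulOp_zero {V : Type*} [AddCommGroup V] [Module ℝ V] :
    extMulOp (0 : Module.Dual ℝ V) = 0 := by
  refine LinearMap.ext fun a => funext fun k => ?_
  cases k with
  | zero => rfl
  | succ k =>
    change AlternatingMap.alternatizeUncurryFin ((0 : Module.Dual ℝ V).smulRight (a k)) = 0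
    rw [LinearMap.zero_smulRight]
    exact map_zero AlternatingMap.alternatizeUncurryFinLM

/-- The Lefschetz isomorphism on basic forms. The preimage is given pointwise; its differential is
transverse because `L^j` is injective on transverse forms of degree `k`. -/
theorem exists_lefschetzForm_eq [T2Space M] (hσ : IsTransverselySymplectic F σ) {k j : ℕ}
    (hk : k + j = n) {γ : DiffForm E M (k + 2 * j)} (hγ : γ ∈ basicForms F (k + 2 * j)) :
    ∃ α ∈ basicForms F k, lefschetzForm σ α j = γ := by
  obtain ⟨g1, g2, g3⟩ := isBasic_iff.1 hγ
  have hbij : ∀ x, Function.Bijective (lefschetzₗ (descend (F.tangent x) (σ x)) k j) := fun x =>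
    lefschetzₗ_bijective (hσ.flat_bijective x) (F.finrank_quotient x) hk
  choose c hc using fun x => (hbij x).2 (descend (F.tangent x) (γ x))
  let α : DiffForm E M k := fun x => (c x).compLinearMap (F.tangent x).mkQ
  have hα : IsTransverse F α := fun x =>
    isAnnihilatedBy_compLinearMap (fun X hX => by simpa using hX) _
  have hdesc : ∀ x, descend (F.tangent x) (α x) = c x := fun x => descend_eq rfl
  have hL : lefschetzForm σ α j = γ := by
    funext x
    change lefschetz (σ x) (α x) j = γ x
    rw [← (hσ.isTransverse x).lefschetz (hα x), hdesc]
    have h1 : lefschetz (descend (F.tangent x) (σ x)) (c x) j = _ := hc x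
    rw [h1, (g2 x).compLinearMap_descend]
  have hs : IsSmoothForm α := isSmoothForm_of_lefschetzForm hσ hk hα (hL ▸ g1)
  refine ⟨α, isBasic_iff.2 ⟨hs, hα, fun x => ?_⟩, hL⟩
  refine isAnnihilatedBy_iff_curryLeft.2 fun X hX => ?_
  -- `L^j (ι_X dα) = ι_X (L^j dα) = ι_X dγ = 0`, since `ι_X σ = 0`
  have h1 := single_extD_lefschetzForm hσ.smooth hσ.closed hs j x
  rw [hL] at h1
  have h2 : contractOp X (Pi.single (k + 2 * j + 1) (extD γ x)) = 0 := by
    rw [contractOp_single, (g3 x).curryLeft hX, Pi.single_zero]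
  have hflat : flat (σ x) X = 0 := by
    ext Y
    refine Eq.trans ?_ ((hσ.ker_eq x X).1 hX Y)
    change σ x _ = σ x _
    congr 1
    funext i
    fin_cases i <;> rfl
  rw [h1, contractOp_lefschetzOp_pow, hflat, extMulOp_zero, LinearMap.zero_apply, smul_zero,
    add_zero, contractOp_single, lefschetzOp_pow_single] at h2
  have h4 : lefschetz (σ x) ((extD α x).curryLeft X) j = 0 := by
    simpa using congrFun h2 (k + 2 * j)
  have hX' := hα.extD_curryLeft hs hX
  rw [← (hσ.isTransverse x).lefschetz hX'] at h4
  have h5 : lefschetzₗ (descend (F.tangent x) (σ x)) k j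
      (descend (F.tangent x) ((extD α x).curryLeft X)) = 0 := compLinearMap_mkQ_injective h4
  rw [← hX'.compLinearMap_descend, (hbij x).1 (h5.trans (map_zero _).symm)]
  rfl

end BasicLefschetz


/-! ### The Hodge-Lefschetz structure on basic forms -/

section TotalBasicForms

variable {E : Type*} [NormedAddCommGroup E] [NormedSpace ℝ E] [FiniteDimensional ℝ E]
  {M : Type*} [TopologicalSpace M] [ChartedSpace E M] [IsManifold 𝓘(ℝ, E) ∞ M] [T2Space M]
  {n : ℕ} {F : Foliation E M (2 * n)} {σ : DiffForm E M 2}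

theorem wedge_zero_left {V : Type*} [AddCommGroup V] [Module ℝ V] {k l : ℕ}
    (b : V [⋀^Fin l]→ₗ[ℝ] ℝ) : wedge (0 : V [⋀^Fin k]→ₗ[ℝ] ℝ) b = 0 := by
  simpa using wedge_smul_left (0 : ℝ) (0 : V [⋀^Fin k]→ₗ[ℝ] ℝ) b

/-- Families of basic forms, one in each degree. -/
abbrev TotalBasic (F : Foliation E M (2 * n)) : Type _ := ∀ k : ℕ, basicForms F k

/-- The basic forms of a given integral degree, inside the total space. -/
abbrev basicOfDegree (F : Foliation E M (2 * n)) (k : ℤ) : Submodule ℝ (TotalBasic F) :=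
  gradedPart (fun k => basicForms F k) k

/-- The exterior derivative on basic forms of all degrees. -/
def basicD (F : Foliation E M (2 * n)) : Module.End ℝ (TotalBasic F) where
  toFun a
    | 0 => 0
    | k + 1 => ⟨extD (a k : DiffForm E M k), extD_mem_basicForms (a k).2⟩
  map_add' a b := by
    funext k
    match k with
    | 0 => simp
    | k + 1 => exact Subtype.ext (extD_add (a k).2.1 (b k).2.1)
  map_smul' c a := by
    funext k
    match k with
    | 0 => simp
    | k + 1 => exact Subtype.ext (extD_smul c _)

/-- The Lefschetz operator on basic forms of all degrees. -/
def basicL (hσ : IsTransverselySymplectic F σ) : Module.End ℝ (TotalBasic F) where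
  toFun a
    | 0 => 0
    | 1 => 0
    | k + 2 => ⟨fun x => wedge ((a k : DiffForm E M k) x) (σ x), wedge_mem_basicForms hσ (a k).2⟩
  map_add' a b := by
    funext k
    match k with
    | 0 => simp
    | 1 => simp
    | k + 2 => exact Subtype.ext (funext fun x => wedge_add_left _ _ _)
  map_smul' c a := by
    funext k
    match k with
    | 0 => simp
    | 1 => simp
    | k + 2 => exact Subtype.ext (funext fun x => wedge_smul_left _ _ _)

theorem isTransverse_of_mem {k : ℕ} (α : basicForms F k) : IsTransverse F (α : DiffForm E M k) :=
  (isBasic_iff.1 α.2).2.1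

/-- The value at `x` of a family of basic forms, on the normal space at `x`. -/
def evalAt (F : Foliation E M (2 * n)) (x : M) :
    TotalBasic F →ₗ[ℝ] TotalForms (TangentSpace 𝓘(ℝ, E) x ⧸ F.tangent x) where
  toFun a k := descend (F.tangent x) ((a k : DiffForm E M k) x)
  map_add' a b := funext fun k =>
    descend_add (isTransverse_of_mem (a k) x) (isTransverse_of_mem (b k) x)
  map_smul' c a := funext fun k => descend_smul (isTransverse_of_mem (a k) x) c

theorem compLinearMap_evalAt (a : TotalBasic F) (x : M) (k : ℕ) :
    (evalAt F x a k).compLinearMap (F.tangent x).mkQ = (a k : DiffForm E M k) x :=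
  (isTransverse_of_mem (a k) x).compLinearMap_descend

theorem totalBasic_ext {a b : TotalBasic F} (h : ∀ x, evalAt F x a = evalAt F x b) : a = b := by
  funext k
  refine Subtype.ext (funext fun x => ?_)
  rw [← compLinearMap_evalAt, h, compLinearMap_evalAt]

theorem evalAt_mem {k : ℤ} {a : TotalBasic F} (ha : a ∈ basicOfDegree F k) (x : M) :
    evalAt F x a ∈ formsOfDegree (TangentSpace 𝓘(ℝ, E) x ⧸ F.tangent x) k := fun j hj =>
  compLinearMap_mkQ_injective (by rw [compLinearMap_evalAt, ha j hj]; rfl)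

theorem evalAt_basicL (hσ : IsTransverselySymplectic F σ) (a : TotalBasic F) (x : M) :
    evalAt F x (basicL hσ a) = lefschetzOp (descend (F.tangent x) (σ x)) (evalAt F x a) := by
  funext k
  refine compLinearMap_mkQ_injective ?_
  rw [compLinearMap_evalAt]
  match k with
  | 0 => rfl
  | 1 => rfl
  | k + 2 => exact ((hσ.isTransverse x).lefschetz (isTransverse_of_mem (a k) x) 1).symm

theorem evalAt_basicL_pow (hσ : IsTransverselySymplectic F σ) (a : TotalBasic F) (x : M) (j : ℕ) :
    evalAt F x ((basicL hσ ^ j) a) =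
      (lefschetzOp (descend (F.tangent x) (σ x)) ^ j) (evalAt F x a) := by
  induction j with
  | zero => rfl
  | succ j ih =>
    rw [pow_succ', Module.End.mul_apply, evalAt_basicL, ih, pow_succ', Module.End.mul_apply]

theorem evalAt_single {k : ℕ} (α : basicForms F k) (x : M) :
    evalAt F x (Pi.single k α) =
      Pi.single k (descend (F.tangent x) ((α : DiffForm E M k) x)) := by
  have h : Pi.single k α ∈ basicOfDegree F k :=
    single_mem_gradedPart (B := fun k => basicForms F k) rfl α
  rw [eq_single_of_mem_gradedPart (evalAt_mem h x)]
  congr 1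
  change descend (F.tangent x) ((Pi.single (M := fun k => basicForms F k) k α k :
    DiffForm E M k) x) = _
  rw [Pi.single_eq_same]

theorem basicL_pow_single (hσ : IsTransverselySymplectic F σ) {k : ℕ} (α : basicForms F k) (j : ℕ)
    (γ : basicForms F (k + 2 * j)) (h : lefschetzForm σ (α : DiffForm E M k) j = γ) :
    (basicL hσ ^ j) (Pi.single k α) = Pi.single (k + 2 * j) γ := by
  refine totalBasic_ext fun x => ?_
  rw [evalAt_basicL_pow, evalAt_single, evalAt_single, lefschetzOp_pow_single]
  congr 1
  refine compLinearMap_mkQ_injective ?_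
  rw [(hσ.isTransverse x).lefschetz (isTransverse_of_mem α x),
    (isTransverse_of_mem γ x).compLinearMap_descend, ← h]
  rfl

theorem isLefschetzModule_basic (hσ : IsTransverselySymplectic F σ) :
    IsLefschetzModule (basicOfDegree F) (basicL hσ) n := by
  have hpt := fun x => isLefschetzModule_forms (hσ.flat_bijective x) (F.finrank_quotient x)
  have hzero : ∀ {k : ℤ} {a : TotalBasic F}, (k < 0 ∨ 2 * n < k) → a ∈ basicOfDegree F k →
      a = 0 := fun hk ha => totalBasic_ext fun x => by
    rw [(hpt x).eq_zero hk (evalAt_mem ha x), map_zero]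
  refine ⟨fun {k a} ha j hj => ?_, hzero, fun {k j a} hk ha h => ?_, fun {k j c} hk hc => ?_⟩
  · match j with
    | 0 => rfl
    | 1 => rfl
    | j + 2 =>
      have h0 : a j = 0 := ha j (by push_cast at hj; omega)
      refine Subtype.ext (funext fun x => ?_)
      change wedge ((a j : DiffForm E M j) x) (σ x) = 0
      rw [h0]
      exact wedge_zero_left (σ x)
  · refine totalBasic_ext fun x => ?_
    rw [map_zero]
    refine (hpt x).inj hk (evalAt_mem ha x) ?_
    rw [← evalAt_basicL_pow hσ, h, map_zero]
  · rcases lt_or_ge k 0 with h0 | h0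
    · exact ⟨0, zero_mem _, by rw [map_zero, hzero (Or.inr (by omega)) hc]⟩
    · lift k to ℕ using h0
      obtain ⟨α, hα, h⟩ := exists_lefschetzForm_eq hσ (by exact_mod_cast hk) (c (k + 2 * j)).2
      refine ⟨Pi.single k ⟨α, hα⟩,
        single_mem_gradedPart (B := fun k => basicForms F k) rfl _, ?_⟩
      have hc' : c ∈ basicOfDegree F ((k + 2 * j : ℕ) : ℤ) := by push_cast; exact hc
      rw [basicL_pow_single hσ _ j (c (k + 2 * j)) h, ← eq_single_of_mem_gradedPart hc']

/-- Weil's formula for the Hodge star of a basic form. -/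
theorem hodgeStar_basicL_pow (hσ : IsTransverselySymplectic F σ) {k l p r m : ℕ}
    (h : k + l = 2 * n) (hk : p + 2 * r = k) (hn : p + r + m = n) {a : TotalBasic F}
    (ha : a ∈ basicOfDegree F p) (hL : (basicL hσ ^ (r + m + 1)) a = 0) :
    hodgeStar F σ h ((basicL hσ ^ r) a k : DiffForm E M k) =
      (((m.factorial : ℝ))⁻¹ * (weilSign p * r.factorial)) •
        ((basicL hσ ^ m) a l : DiffForm E M l) := by
  funext x
  have h1 := symplecticStar_eq (hσ.flat_bijective x) (F.finrank_quotient x)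
    (isSymplecticStar_lefschetzOp_pow (hσ.flat_bijective x) (F.finrank_quotient x) k h p r m hk hn
      (evalAt_mem ha x) (by rw [← evalAt_basicL_pow hσ, hL, map_zero]))
  rw [← evalAt_basicL_pow hσ, ← evalAt_basicL_pow hσ] at h1
  change (symplecticStar (descend (F.tangent x) (σ x)) n h
    (evalAt F x ((basicL hσ ^ r) a) k)).compLinearMap (F.tangent x).mkQ = _
  rw [h1, Pi.smul_apply, ← compLinearMap_evalAt]
  rfl

theorem hodgeStar_add (hσ : IsTransverselySymplectic F σ) {k l : ℕ} (h : k + l = 2 * n)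
    (α β : basicForms F k) : hodgeStar F σ h ((α + β : basicForms F k) : DiffForm E M k) =
      hodgeStar F σ h (α : DiffForm E M k) + hodgeStar F σ h (β : DiffForm E M k) := by
  funext x
  simp only [hodgeStar, Submodule.coe_add, Pi.add_apply]
  rw [descend_add (isTransverse_of_mem α x) (isTransverse_of_mem β x),
    symplecticStar_add (hσ.flat_bijective x) (F.finrank_quotient x)]
  rfl

theorem hodgeStar_smul (hσ : IsTransverselySymplectic F σ) {k l : ℕ} (h : k + l = 2 * n) (c : ℝ)
    (α : basicForms F k) : hodgeStar F σ h ((c • α : basicForms F k) : DiffForm E M k) =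
      c • hodgeStar F σ h (α : DiffForm E M k) := by
  funext x
  simp only [hodgeStar, Submodule.coe_smul, Pi.smul_apply]
  rw [descend_smul (isTransverse_of_mem α x),
    symplecticStar_smul (hσ.flat_bijective x) (F.finrank_quotient x)]
  rfl

theorem hodgeStar_zero (hσ : IsTransverselySymplectic F σ) {k l : ℕ} (h : k + l = 2 * n) :
    hodgeStar F σ h (0 : DiffForm E M k) = 0 := by
  have := hodgeStar_smul hσ h 0 (0 : basicForms F k)
  rwa [zero_smul, zero_smul] at this

/-- The Hodge star of a basic form is basic, by Weil's formula and the Lefschetz decomposition. -/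
theorem hodgeStar_mem_basicForms (hσ : IsTransverselySymplectic F σ) {k l : ℕ} (h : k + l = 2 * n)
    (α : basicForms F k) : hodgeStar F σ h (α : DiffForm E M k) ∈ basicForms F l := by
  have key := (isLefschetzModule_basic hσ).induction_on
    (P := fun a => hodgeStar F σ h (a k : DiffForm E M k) ∈ basicForms F l) (k : ℤ)
    (by rw [Pi.zero_apply, Submodule.coe_zero, hodgeStar_zero hσ]; exact zero_mem _)
    (fun a b _ _ ha hb => by rw [Pi.add_apply, hodgeStar_add hσ]; exact add_mem ha hb)
    (fun p r m a hk hn ha hL => by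
      rcases lt_or_ge p 0 with hp | hp
      · rw [(isLefschetzModule_basic hσ).eq_zero (Or.inl hp) ha, map_zero, Pi.zero_apply,
          Submodule.coe_zero, hodgeStar_zero hσ]
        exact zero_mem _
      · lift p to ℕ using hp
        rw [hodgeStar_basicL_pow hσ h (by exact_mod_cast hk) (by exact_mod_cast hn) ha hL]
        exact Submodule.smul_mem _ _ (Subtype.property _))
    (single_mem_gradedPart (B := fun k => basicForms F k) rfl α)
  rwa [Pi.single_eq_same] at key

/-- The Hodge star on basic forms of all degrees. -/
def basicStar (hσ : IsTransverselySymplectic F σ) : Module.End ℝ (TotalBasic F) where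
  toFun a l := if h : l ≤ 2 * n then
    ⟨_, hodgeStar_mem_basicForms hσ (Nat.sub_add_cancel h) (a (2 * n - l))⟩ else 0
  map_add' a b := by
    funext l
    by_cases h : l ≤ 2 * n
    · simp only [dif_pos h, Pi.add_apply]
      exact Subtype.ext (hodgeStar_add hσ _ _ _)
    · simp [dif_neg h]
  map_smul' c a := by
    funext l
    by_cases h : l ≤ 2 * n
    · simp only [dif_pos h, Pi.smul_apply, RingHom.id_apply]
      exact Subtype.ext (hodgeStar_smul hσ _ _ _)
    · simp [dif_neg h]

theorem basicStar_apply (hσ : IsTransverselySymplectic F σ) (a : TotalBasic F) {k l : ℕ}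
    (h : k + l = 2 * n) :
    (basicStar hσ a l : DiffForm E M l) = hodgeStar F σ h (a k : DiffForm E M k) := by
  obtain rfl : k = 2 * n - l := by omega
  change ((if h : l ≤ 2 * n then _ else _ : basicForms F l) : DiffForm E M l) = _
  rw [dif_pos (by omega)]

theorem basicStar_apply_of_lt (hσ : IsTransverselySymplectic F σ) (a : TotalBasic F) {l : ℕ}
    (h : 2 * n < l) : basicStar hσ a l = 0 :=
  dif_neg (by omega)

theorem basicStar_mem (hσ : IsTransverselySymplectic F σ) {a : TotalBasic F} {k l : ℤ}
    (h : k + l = 2 * n) (ha : a ∈ basicOfDegree F k) : basicStar hσ a ∈ basicOfDegree F l := by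
  intro j hj
  rcases le_or_gt j (2 * n) with hjn | hjn
  · refine Subtype.ext ?_
    rw [basicStar_apply hσ a (Nat.sub_add_cancel hjn), ha _ (by omega)]
    exact hodgeStar_zero hσ _
  · exact basicStar_apply_of_lt hσ a hjn

theorem basicD_mem {a : TotalBasic F} {k : ℤ} (ha : a ∈ basicOfDegree F k) :
    basicD F a ∈ basicOfDegree F (k + 1) := by
  intro j hj
  match j with
  | 0 => rfl
  | j + 1 =>
    refine Subtype.ext ?_
    change extD (a j : DiffForm E M j) = 0
    rw [ha j (by push_cast at hj; omega)]
    exact extD_zero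

/-- The codifferential `δ = (-1)^{k+1} ⋆ d ⋆` on basic forms of all degrees; its component in degree
`k` comes from degree `k + 1`. -/
def basicDelta (hσ : IsTransverselySymplectic F σ) : Module.End ℝ (TotalBasic F) where
  toFun a k := (-1 : ℝ) ^ (k + 1 + 1) • basicStar hσ (basicD F (basicStar hσ a)) k
  map_add' a b := by
    funext k
    simp only [map_add, Pi.add_apply, smul_add]
  map_smul' c a := by
    funext k
    simp only [map_smul, Pi.smul_apply, RingHom.id_apply]
    rw [smul_comm]

theorem basicDelta_apply (hσ : IsTransverselySymplectic F σ) (a : TotalBasic F) (k : ℕ) :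
    (basicDelta hσ a k : DiffForm E M k) = delta F σ (a (k + 1) : DiffForm E M (k + 1)) := by
  change (-1 : ℝ) ^ (k + 1 + 1) • (basicStar hσ (basicD F (basicStar hσ a)) k : DiffForm E M k) = _
  by_cases h : k + 1 ≤ 2 * n
  · rw [delta, dif_pos h, basicStar_apply hσ _ (k := 2 * n - (k + 1) + 1) (l := k) (by omega)]
    congr 2
    change extD (basicStar hσ a (2 * n - (k + 1)) : DiffForm E M (2 * n - (k + 1))) = _
    rw [basicStar_apply hσ a (k := k + 1) (by omega)]
  · rw [delta, dif_neg h]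
    rcases lt_or_ge (2 * n) k with h' | h'
    · rw [basicStar_apply_of_lt hσ _ h']
      simp
    · rw [basicStar_apply hσ _ (k := 0) (by omega)]
      change _ • hodgeStar F σ _ (0 : DiffForm E M 0) = 0
      rw [hodgeStar_zero hσ, smul_zero]

theorem isHodgeLefschetz_basic (hσ : IsTransverselySymplectic F σ) :
    IsHodgeLefschetz (basicOfDegree F) (basicL hσ) (basicD F) (basicStar hσ) (basicDelta hσ) n where
  toIsLefschetzModule := isLefschetzModule_basic hσ
  d_mem := basicD_mem
  d_d {k a} _ := by
    funext j
    match j with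
    | 0 => rfl
    | 1 => exact Subtype.ext extD_zero
    | j + 2 => exact Subtype.ext (extD_extD (a j).2.1)
  d_L {k a} _ := by
    funext j
    match j with
    | 0 => rfl
    | 1 => exact Subtype.ext extD_zero
    | 2 =>
      refine Subtype.ext (extD_zero.trans ?_)
      funext x
      exact (wedge_zero_left (k := 0) (σ x)).symm
    | j + 3 =>
      exact Subtype.ext (funext fun x => extD_wedge_two hσ.smooth hσ.closed (a j).2.1 x)
  weil p r m a hn ha hL := by
    rcases lt_or_ge p 0 with hp | hp
    · rw [(isLefschetzModule_basic hσ).eq_zero (Or.inl hp) ha]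
      simp
    · lift p to ℕ using hp
      have hn' : p + r + m = n := by exact_mod_cast hn
      have hr : (basicL hσ ^ r) a ∈ basicOfDegree F ((p + 2 * r : ℕ) : ℤ) :=
        (isLefschetzModule_basic hσ).pow_mem ha (by push_cast; ring)
      have hm : (basicL hσ ^ m) a ∈ basicOfDegree F ((p + 2 * m : ℕ) : ℤ) :=
        (isLefschetzModule_basic hσ).pow_mem ha (by push_cast; ring)
      have hs := basicStar_mem hσ (l := ((p + 2 * m : ℕ) : ℤ)) (by push_cast; omega) hr
      have h : p + 2 * r + (p + 2 * m) = 2 * n := by omega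
      rw [eq_single_of_mem_gradedPart hs, eq_single_of_mem_gradedPart hm, ← Pi.single_smul,
        ← Pi.single_smul]
      congr 1
      refine Subtype.ext ?_
      rw [Submodule.coe_smul, Submodule.coe_smul, basicStar_apply hσ _ h,
        hodgeStar_basicL_pow hσ h rfl hn' ha hL, smul_smul, ← mul_assoc,
        mul_inv_cancel₀ (by positivity), one_mul]
  δ_eq {k a} ha := by
    have hm : basicStar hσ (basicD F (basicStar hσ a)) ∈ basicOfDegree F (k - 1) :=
      basicStar_mem hσ (k := 2 * n - k + 1) (by ring)
        (basicD_mem (basicStar_mem hσ (l := 2 * n - k) (by ring) ha))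
    funext j
    change (-1 : ℝ) ^ (j + 1 + 1) • basicStar hσ (basicD F (basicStar hσ a)) j =
      (-1 : ℝ) ^ (k + 1) • basicStar hσ (basicD F (basicStar hσ a)) j
    by_cases hj : (j : ℤ) = k - 1
    · obtain rfl : k = j + 1 := by omega
      norm_cast
    · rw [hm j hj, smul_zero, smul_zero]

end TotalBasicForms


/-! ### Identities and cohomology in terms of the total space -/

section Translation

variable {E : Type*} [NormedAddCommGroup E] [NormedSpace ℝ E] [FiniteDimensional ℝ E]
  {M : Type*} [TopologicalSpace M] [ChartedSpace E M] [IsManifold 𝓘(ℝ, E) ∞ M] [T2Space M]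
  {n : ℕ} {F : Foliation E M (2 * n)} {σ : DiffForm E M 2}

theorem mem_submoduleOf_iff {V : Type*} [AddCommGroup V] [Module ℝ V] {P Q : Submodule ℝ V}
    {x : Q} : x ∈ P.submoduleOf Q ↔ (x : V) ∈ P := Iff.rfl

theorem basicOfDegree_ext {k : ℕ} {a b : TotalBasic F} (ha : a ∈ basicOfDegree F k)
    (hb : b ∈ basicOfDegree F k) (h : (a k : DiffForm E M k) = b k) : a = b := by
  rw [eq_single_of_mem_gradedPart ha, eq_single_of_mem_gradedPart hb, Subtype.ext h]

theorem exists_mem_basicOfDegree {k : ℕ} {l : ℤ} (h : l = k) {α : DiffForm E M k}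
    (hα : α ∈ basicForms F k) : ∃ a ∈ basicOfDegree F l, (a k : DiffForm E M k) = α :=
  ⟨Pi.single k ⟨α, hα⟩, single_mem_gradedPart (B := fun k => basicForms F k) h _, by
    rw [Pi.single_eq_same]⟩

theorem mem_exactBasic_iff {k : ℕ} {α : DiffForm E M k} :
    α ∈ exactBasic F k ↔
      ∃ a ∈ basicOfDegree F ((k : ℤ) - 1), (basicD F a k : DiffForm E M k) = α := by
  cases k with
  | zero => exact ⟨fun h => ⟨0, zero_mem _, h.symm⟩, fun ⟨a, _, h⟩ => h.symm⟩
  | succ k =>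
    constructor
    · rintro ⟨β, hβ, rfl⟩
      obtain ⟨a, ha, rfl⟩ := exists_mem_basicOfDegree (F := F) (l := ((k + 1 : ℕ) : ℤ) - 1)
        (by push_cast; ring) hβ
      exact ⟨a, ha, rfl⟩
    · rintro ⟨a, -, rfl⟩
      exact ⟨a k, (a k).2, rfl⟩

theorem mem_closedBasic_iff {k : ℕ} {α : DiffForm E M k} :
    α ∈ closedBasic F k ↔
      ∃ a ∈ basicOfDegree F (k : ℤ), basicD F a = 0 ∧ (a k : DiffForm E M k) = α := by
  constructor
  · rintro ⟨h1, h2⟩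
    obtain ⟨a, ha, rfl⟩ := exists_mem_basicOfDegree (F := F) (l := (k : ℤ)) rfl h1
    have hd : basicD F a ∈ basicOfDegree F ((k + 1 : ℕ) : ℤ) := by
      push_cast
      exact basicD_mem ha
    exact ⟨a, ha, basicOfDegree_ext hd (zero_mem _) h2, rfl⟩
  · rintro ⟨a, -, h, rfl⟩
    exact ⟨(a k).2, congrArg Subtype.val (congrFun h (k + 1))⟩

theorem basicDelta_eq_zero (hσ : IsTransverselySymplectic F σ) {l : ℤ} (hl : l ≤ 0)
    {a : TotalBasic F} (ha : a ∈ basicOfDegree F l) :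
    basicDelta hσ a = 0 :=
  (isHodgeLefschetz_basic hσ).eq_zero (Or.inl (by omega)) ((isHodgeLefschetz_basic hσ).δ_mem ha)

theorem mem_deltaExact_iff (hσ : IsTransverselySymplectic F σ) {k : ℕ} {α : DiffForm E M k} :
    α ∈ deltaExact F σ k ↔
      ∃ a ∈ basicOfDegree F ((k : ℤ) + 1), (basicDelta hσ a k : DiffForm E M k) = α := by
  constructor
  · rintro ⟨β, hβ, rfl⟩
    obtain ⟨a, ha, rfl⟩ := exists_mem_basicOfDegree (F := F) (l := (k : ℤ) + 1) (by push_cast; rfl)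
      hβ
    exact ⟨a, ha, basicDelta_apply hσ a k⟩
  · rintro ⟨a, -, rfl⟩
    exact ⟨a (k + 1), (a (k + 1)).2, (basicDelta_apply hσ a k).symm⟩

theorem mem_deltaClosed_iff (hσ : IsTransverselySymplectic F σ) {k : ℕ} {α : DiffForm E M k} :
    α ∈ deltaClosed F σ k ↔
      ∃ a ∈ basicOfDegree F (k : ℤ), basicDelta hσ a = 0 ∧ (a k : DiffForm E M k) = α := by
  cases k with
  | zero =>
    constructor
    · intro h
      obtain ⟨a, ha, rfl⟩ := exists_mem_basicOfDegree (F := F) (l := ((0 : ℕ) : ℤ)) rfl h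
      exact ⟨a, ha, basicDelta_eq_zero hσ (by simp) ha, rfl⟩
    · rintro ⟨a, -, -, rfl⟩
      exact (a 0).2
  | succ k =>
    constructor
    · rintro ⟨h1, h2⟩
      obtain ⟨a, ha, rfl⟩ := exists_mem_basicOfDegree (F := F) (l := ((k + 1 : ℕ) : ℤ)) rfl h1
      refine ⟨a, ha, ?_, rfl⟩
      have hd := (isHodgeLefschetz_basic hσ).δ_mem ha
      rw [show ((k + 1 : ℕ) : ℤ) - 1 = k by push_cast; ring] at hd
      exact basicOfDegree_ext hd (zero_mem _) ((basicDelta_apply hσ a k).trans h2)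
    · rintro ⟨a, -, h, rfl⟩
      refine ⟨(a (k + 1)).2, ?_⟩
      rw [← basicDelta_apply hσ, h]
      rfl

theorem mem_dDeltaExact_iff (hσ : IsTransverselySymplectic F σ) {k : ℕ} {α : DiffForm E M k} :
    α ∈ dDeltaExact F σ k ↔ ∃ a ∈ basicOfDegree F (k : ℤ),
      (basicD F (basicDelta hσ a) k : DiffForm E M k) = α := by
  cases k with
  | zero => exact ⟨fun h => ⟨0, zero_mem _, by rw [map_zero, map_zero]; exact h.symm⟩,
      fun ⟨a, _, h⟩ => h.symm⟩
  | succ k =>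
    constructor
    · rintro ⟨β, hβ, rfl⟩
      obtain ⟨a, ha, rfl⟩ := exists_mem_basicOfDegree (F := F) (l := ((k + 1 : ℕ) : ℤ)) rfl hβ
      exact ⟨a, ha, congrArg extD (basicDelta_apply hσ a k)⟩
    · rintro ⟨a, -, rfl⟩
      exact ⟨a (k + 1), (a (k + 1)).2, congrArg extD (basicDelta_apply hσ a k).symm⟩

theorem exactIdentity_iff (hσ : IsTransverselySymplectic F σ) (k : ℕ) : ExactIdentity F σ k ↔
    GradedExactIdentity (basicOfDegree F) (basicD F) (basicDelta hσ) k := by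
  have H := isHodgeLefschetz_basic hσ
  have hd : ∀ {a}, a ∈ basicOfDegree F ((k : ℤ) - 1) → basicD F a ∈ basicOfDegree F (k : ℤ) :=
    fun {a} ha => by simpa using H.d_mem ha
  constructor
  · intro h a ha h0
    have h1 : (basicD F a k : DiffForm E M k) ∈ dDeltaExact F σ k := by
      rw [← h]
      exact ⟨mem_exactBasic_iff.2 ⟨a, ha, rfl⟩,
        (mem_deltaClosed_iff hσ).2 ⟨_, hd ha, h0, rfl⟩⟩
    obtain ⟨b, hb, h2⟩ := (mem_dDeltaExact_iff hσ).1 h1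
    exact ⟨b, hb, basicOfDegree_ext (hd (H.δ_mem hb)) (hd ha) h2⟩
  · intro h
    ext α
    constructor
    · rintro ⟨h1, h2⟩
      obtain ⟨a, ha, rfl⟩ := mem_exactBasic_iff.1 h1
      obtain ⟨c, hc, h3, h4⟩ := (mem_deltaClosed_iff hσ).1 h2
      obtain ⟨b, hb, h5⟩ := h a ha (by rw [← basicOfDegree_ext hc (hd ha) h4, h3])
      exact (mem_dDeltaExact_iff hσ).2 ⟨b, hb, by rw [h5]⟩
    · intro h1
      obtain ⟨b, hb, rfl⟩ := (mem_dDeltaExact_iff hσ).1 h1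
      have hδ := H.δ_mem hb
      refine ⟨mem_exactBasic_iff.2 ⟨_, hδ, rfl⟩,
        (mem_deltaClosed_iff hσ).2 ⟨_, hd hδ, ?_, rfl⟩⟩
      have h2 := H.d_δ hδ
      rw [H.δ_δ hb, map_zero] at h2
      exact neg_eq_zero.1 h2.symm

theorem coexactIdentity_iff (hσ : IsTransverselySymplectic F σ) (k : ℕ) : CoexactIdentity F σ k ↔
    GradedCoexactIdentity (basicOfDegree F) (basicD F) (basicDelta hσ) k := by
  have H := isHodgeLefschetz_basic hσ
  have hd : ∀ {a}, a ∈ basicOfDegree F ((k : ℤ) - 1) → basicD F a ∈ basicOfDegree F (k : ℤ) :=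
    fun {a} ha => by simpa using H.d_mem ha
  have hδ : ∀ {a}, a ∈ basicOfDegree F ((k : ℤ) + 1) →
      basicDelta hσ a ∈ basicOfDegree F (k : ℤ) := fun {a} ha => by simpa using H.δ_mem ha
  constructor
  · intro h a ha h0
    have h1 : (basicDelta hσ a k : DiffForm E M k) ∈ dDeltaExact F σ k := by
      rw [← h]
      exact ⟨(mem_deltaExact_iff hσ).2 ⟨a, ha, rfl⟩, mem_closedBasic_iff.2 ⟨_, hδ ha, h0, rfl⟩⟩
    obtain ⟨b, hb, h2⟩ := (mem_dDeltaExact_iff hσ).1 h1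
    exact ⟨b, hb, basicOfDegree_ext (hd (H.δ_mem hb)) (hδ ha) h2⟩
  · intro h
    ext α
    constructor
    · rintro ⟨h1, h2⟩
      obtain ⟨a, ha, rfl⟩ := (mem_deltaExact_iff hσ).1 h1
      obtain ⟨c, hc, h3, h4⟩ := mem_closedBasic_iff.1 h2
      obtain ⟨b, hb, h5⟩ := h a ha (by rw [← basicOfDegree_ext hc (hδ ha) h4, h3])
      exact (mem_dDeltaExact_iff hσ).2 ⟨b, hb, by rw [h5]⟩
    · intro h1
      obtain ⟨b, hb, rfl⟩ := (mem_dDeltaExact_iff hσ).1 h1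
      have hb' := H.δ_mem hb
      have h2 := H.d_d hb'
      refine ⟨(mem_deltaExact_iff hσ).2 ⟨-basicD F b, neg_mem (H.d_mem hb), ?_⟩,
        mem_closedBasic_iff.2 ⟨_, hd hb', h2, rfl⟩⟩
      rw [map_neg, H.d_δ hb]

theorem dDeltaLemmaFrom_iff (hσ : IsTransverselySymplectic F σ) {s : ℕ} (hs : s < n) :
    DDeltaLemmaFrom F σ s ↔ DDeltaLemmaUpTo F σ s := by
  have H := isHodgeLefschetz_basic hσ
  simp only [DDeltaLemmaFrom, DDeltaLemmaUpTo, exactIdentity_iff hσ, coexactIdentity_iff hσ]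
  have e1 : GradedCoexactIdentity (basicOfDegree F) (basicD F) (basicDelta hσ)
      ((2 * n - s - 1 : ℕ) : ℤ) ↔
      GradedExactIdentity (basicOfDegree F) (basicD F) (basicDelta hσ) ((s + 1 : ℕ) : ℤ) :=
    H.gradedCoexactIdentity_iff (by omega)
  rw [e1]
  refine and_congr_left fun _ => ⟨fun h k hk => ?_, fun h k hk => ?_⟩
  · obtain ⟨h1, h2⟩ := h (2 * n - k) (by omega)
    exact ⟨(H.gradedCoexactIdentity_iff (by omega)).1 h2,
      (H.gradedCoexactIdentity_iff (by omega)).2 h1⟩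
  · rcases le_or_gt k (2 * n) with hk' | hk'
    · obtain ⟨h1, h2⟩ := h (2 * n - k) (by omega)
      exact ⟨(H.gradedCoexactIdentity_iff (by omega)).1 h2,
        (H.gradedCoexactIdentity_iff (by omega)).2 h1⟩
    · -- the complementary degree is negative
      exact ⟨(H.gradedCoexactIdentity_iff (k := k) (l := 2 * n - k) (by omega)).1
          (H.gradedCoexactIdentity_of_neg (by omega)),
        (H.gradedCoexactIdentity_iff (k := 2 * n - k) (l := k) (by omega)).2
          (H.gradedExactIdentity_of_neg (by omega))⟩

theorem basicL_pow_apply (hσ : IsTransverselySymplectic F σ) (a : TotalBasic F) (k j : ℕ) :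
    ((basicL hσ ^ j) a (k + 2 * j) : DiffForm E M (k + 2 * j)) =
      lefschetzForm σ (a k : DiffForm E M k) j := by
  induction j with
  | zero => rfl
  | succ j ih =>
    rw [pow_succ', Module.End.mul_apply]
    change (fun x => wedge (((basicL hσ ^ j) a (k + 2 * j) : DiffForm E M (k + 2 * j)) x) (σ x)) = _
    rw [ih]
    rfl

/-- The operator `L^j` on closed basic forms. -/
def closedLefschetz (hσ : IsTransverselySymplectic F σ) (k j : ℕ) :
    closedBasic F k →ₗ[ℝ] closedBasic F (k + 2 * j) where
  toFun α := ⟨lefschetzForm σ (α : DiffForm E M k) j, by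
    obtain ⟨a, ha, h1, h2⟩ := mem_closedBasic_iff.1 α.2
    have H := isHodgeLefschetz_basic hσ
    rw [← h2, ← basicL_pow_apply hσ]
    exact mem_closedBasic_iff.2 ⟨_, H.pow_mem ha (by push_cast; rfl),
      by rw [H.d_pow ha, h1, map_zero], rfl⟩⟩
  map_add' α β := Subtype.ext (funext fun x => (lefschetzₗ (σ x) k j).map_add _ _)
  map_smul' c α := Subtype.ext (funext fun x => (lefschetzₗ (σ x) k j).map_smul c _)

theorem transverseLefschetz_iff (hσ : IsTransverselySymplectic F σ) (s : ℕ) :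
    TransverseLefschetz F σ s ↔ ∀ k ≤ s,
      GradedLefschetz (basicOfDegree F) (basicD F) (basicL hσ) k (n - k) := by
  have H := isHodgeLefschetz_basic hσ
  refine forall₂_congr fun k _ => ?_
  generalize n - k = j
  have hlow : ∀ {a}, a ∈ basicOfDegree F ((k : ℤ) - 1) → basicD F a ∈ basicOfDegree F (k : ℤ) :=
    fun {a} ha => by simpa using H.d_mem ha
  have hcast : (k : ℤ) + 2 * (j : ℕ) = ((k + 2 * j : ℕ) : ℤ) := by push_cast; rfl
  have hupp : ∀ {a}, a ∈ basicOfDegree F (((k + 2 * j : ℕ) : ℤ) - 1) →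
      basicD F a ∈ basicOfDegree F ((k + 2 * j : ℕ) : ℤ) :=
    fun {a} ha => by simpa using H.d_mem ha
  have hpow : ∀ {a}, a ∈ basicOfDegree F (k : ℤ) →
      (basicL hσ ^ j) a ∈ basicOfDegree F ((k + 2 * j : ℕ) : ℤ) :=
    fun ha => H.pow_mem ha hcast.symm
  rw [GradedLefschetz, hcast]
  constructor
  · rintro ⟨f, hf⟩
    constructor
    · rintro a ha hda ⟨b, hb, hdb⟩
      obtain ⟨β, hβ, hfβ⟩ := hf ⟨a k, mem_closedBasic_iff.2 ⟨a, ha, hda, rfl⟩⟩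
      have h0 : (Submodule.Quotient.mk β : BasicCohomology F (k + 2 * j)) = 0 := by
        rw [Submodule.Quotient.mk_eq_zero, mem_submoduleOf_iff, hβ]
        refine mem_exactBasic_iff.2 ⟨b, hb, ?_⟩
        rw [hdb, basicL_pow_apply]
      rw [h0, LinearEquiv.map_eq_zero_iff, Submodule.Quotient.mk_eq_zero,
        mem_submoduleOf_iff] at hfβ
      obtain ⟨b', hb', h1⟩ := mem_exactBasic_iff.1 hfβ
      exact ⟨b', hb', basicOfDegree_ext (hlow hb') ha h1⟩
    · intro c hc hdc
      obtain ⟨y, hy⟩ := f.surjective (Submodule.Quotient.mk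
        ⟨c (k + 2 * j), mem_closedBasic_iff.2 ⟨c, hc, hdc, rfl⟩⟩)
      obtain ⟨α, rfl⟩ := Submodule.Quotient.mk_surjective _ y
      obtain ⟨β, hβ, hfβ⟩ := hf α
      obtain ⟨a, ha, hda, haα⟩ := mem_closedBasic_iff.1 α.2
      rw [hfβ, eq_comm, Submodule.Quotient.eq, mem_submoduleOf_iff] at hy
      obtain ⟨b, hb, h1⟩ := mem_exactBasic_iff.1 hy
      refine ⟨a, ha, hda, b, hb, basicOfDegree_ext (hupp hb) (sub_mem hc (hpow ha)) ?_⟩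
      rw [h1, Pi.sub_apply, Submodule.coe_sub, Submodule.coe_sub, basicL_pow_apply, haα, ← hβ]
  · rintro ⟨hinj, hsurj⟩
    have hle : (exactBasic F k).submoduleOf (closedBasic F k) ≤
        ((exactBasic F (k + 2 * j)).submoduleOf (closedBasic F (k + 2 * j))).comap
          (closedLefschetz hσ k j) := by
      intro α hα
      rw [mem_submoduleOf_iff] at hα
      rw [Submodule.mem_comap, mem_submoduleOf_iff]
      obtain ⟨b, hb, h1⟩ := mem_exactBasic_iff.1 hα
      refine mem_exactBasic_iff.2 ⟨(basicL hσ ^ j) b, H.pow_mem hb (by push_cast; ring), ?_⟩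
      rw [H.d_pow hb, basicL_pow_apply, h1]
      rfl
    refine ⟨LinearEquiv.ofBijective (Submodule.mapQ _ _ (closedLefschetz hσ k j) hle) ⟨?_, ?_⟩,
      fun α => ⟨closedLefschetz hσ k j α, rfl, rfl⟩⟩
    · rw [← LinearMap.ker_eq_bot, LinearMap.ker_eq_bot']
      intro y hy
      obtain ⟨α, rfl⟩ := Submodule.Quotient.mk_surjective _ y
      rw [Submodule.mapQ_apply, Submodule.Quotient.mk_eq_zero, mem_submoduleOf_iff] at hy
      rw [Submodule.Quotient.mk_eq_zero, mem_submoduleOf_iff]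
      obtain ⟨a, ha, hda, haα⟩ := mem_closedBasic_iff.1 α.2
      obtain ⟨b, hb, h1⟩ := mem_exactBasic_iff.1 hy
      obtain ⟨b', hb', h2⟩ := hinj a ha hda ⟨b, hb, basicOfDegree_ext (hupp hb) (hpow ha) (by
        rw [h1, basicL_pow_apply, haα]
        rfl)⟩
      exact mem_exactBasic_iff.2 ⟨b', hb', by rw [h2, haα]⟩
    · intro y
      obtain ⟨γ, rfl⟩ := Submodule.Quotient.mk_surjective _ y
      obtain ⟨c, hc, hdc, hcγ⟩ := mem_closedBasic_iff.1 γ.2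
      obtain ⟨a, ha, hda, b, hb, h1⟩ := hsurj c hc hdc
      refine ⟨Submodule.Quotient.mk ⟨a k, mem_closedBasic_iff.2 ⟨a, ha, hda, rfl⟩⟩, ?_⟩
      rw [Submodule.mapQ_apply, eq_comm, Submodule.Quotient.eq, mem_submoduleOf_iff]
      refine mem_exactBasic_iff.2 ⟨b, hb, ?_⟩
      rw [h1, Pi.sub_apply, Submodule.coe_sub, Submodule.coe_sub, basicL_pow_apply, hcγ]
      rfl

theorem transverseLefschetz_iff_dDeltaLemmaUpTo (hσ : IsTransverselySymplectic F σ) {s : ℕ}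
    (hs : s < n) : TransverseLefschetz F σ s ↔ DDeltaLemmaUpTo F σ s := by
  have H := isHodgeLefschetz_basic hσ
  simp only [transverseLefschetz_iff hσ, DDeltaLemmaUpTo, exactIdentity_iff hσ,
    coexactIdentity_iff hσ]
  constructor
  · intro h
    obtain ⟨h1, h2⟩ := H.identities_of_lefschetz hs fun k j hk hkj => by
      obtain rfl : j = n - k := by omega
      exact h k hk
    exact ⟨fun k hk => ⟨h1 k (by omega), h2 k (by omega)⟩, h1 _ (by push_cast; omega)⟩
  · rintro ⟨h1, h2⟩ k hk
    have hE : GradedExactIdentity (basicOfDegree F) (basicD F) (basicDelta hσ) ((k : ℤ) + 1) := by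
      rcases hk.lt_or_eq with hk' | rfl
      · exact_mod_cast (h1 (k + 1) hk').1
      · exact_mod_cast h2
    rw [show n - k = (n - k - 1) + 1 by omega]
    exact H.lefschetz_of_identities (by omega) (h1 k hk).2 hE

end Translation

end TransverseHodge

end

/-- Let `σ` be a transversely symplectic form for a foliation `F` of codimension `2n` on a connected
manifold `M`, and let `0 ≤ s ≤ n - 1`. The transverse `s`-Lefschetz property, the symplectic
`dδ`-lemma up to degree `s`, and the `dδ`-identities in degrees `≥ 2n - s` (with the one-sided
identity in degree `2n - s - 1`) are equivalent. -/
theorem theorem4p8 {E : Type*} [NormedAddCommGroup E] [NormedSpace ℝ E] [FiniteDimensional ℝ E]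
    {M : Type*} [TopologicalSpace M] [ChartedSpace E M] [IsManifold 𝓘(ℝ, E) ∞ M]
    [T2Space M] [SecondCountableTopology M] [ConnectedSpace M]
    {n : ℕ} (F : TransverseHodge.Foliation E M (2 * n)) (σ : TransverseHodge.DiffForm E M 2)
    (hσ : TransverseHodge.IsTransverselySymplectic F σ) {s : ℕ} (hs : s < n) :
    List.TFAE
      [TransverseHodge.TransverseLefschetz F σ s,
        TransverseHodge.DDeltaLemmaUpTo F σ s,
        TransverseHodge.DDeltaLemmaFrom F σ s] := by
  have h1 := TransverseHodge.transverseLefschetz_iff_dDeltaLemmaUpTo hσ hs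
  have h2 := TransverseHodge.dDeltaLemmaFrom_iff hσ hs
  tfae_have 1 ↔ 2 := h1
  tfae_have 3 ↔ 2 := h2
  tfae_finish
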